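/- Let $\mathsf{k}$ be a field, $M$ a lattice (finitely generated free abelian group), $M_{\mathbb R}=M\otimes_{\mathbb Z}\mathbb R$, and let $C\subset M_{\mathbb R}$ be a pointed, full-dimensional rational polyhedral cone, with toric algebra $R=\mathsf{k}[C\cap M]\subset \mathsf{k}[M]$. For $v\in M_{\mathbb R}$ let $A_v$ (the conic module) and $\mathring A_v$ (the open conic module) be the $R$-submodules of the Laurent ring $\mathsf{k}[M]$ spanned by the monomials $x^m$ with $m\in M\cap(C+v)$, respectively with $m\in M$ in the interior of $C+v$. A chamber of constancy is an equivalence class $\Delta\subset M_{\mathbb R}$ of the relation $A_v=A_w$; write $A_\Delta=A_v$ for $v\in\Delta$. Let $\Sigma_1\subset\mathrm{Hom}(M,\mathbb Z)$ be the set of primitive generators of the extremal rays of the dual cone of $C$, and for a chamber $\Delta\ni v$ put $d_n=\lceil\langle v,n\rangle\rceil$ for $n\in\Sigma_1$. The open cells of $\Delta$ are the non-empty sets of the form $$\tau_\Omega=\{x\in M_{\mathbb R} \mid d_n-1<\langle x,n\rangle<d_n \text{ for } n\in\Omega,\ \langle x,n\rangle=d_n \text{ for } n\in\Sigma_1\setminus\Omega\},\qquad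 \Omega\subseteq\Sigma_1 .$$ The codimension of a cell is that of its affine span, and $\mathring A_\tau:=\mathring A_x$ for any $x\in\tau$. Let $\mathbb A$ be a complete sum of conic modules, i.e. a finite direct sum of conic $R$-modules such that every conic $R$-module is isomorphic to one of the summands. For a chamber $\Delta$ let $P_\Delta=\mathrm{Hom}_R(\mathbb A,A_\Delta)$, a right $\mathrm{End}_R(\mathbb A)$-module by precomposition, graded by $M$, and let $S_\Delta$ be its unique graded simple quotient, i.e. the quotient of $P_\Delta$ by its unique maximal proper graded submodule. Then for any two chambers of constancy $\Delta,\Delta'$ and every integer $i\ge 0$, the number of open cells $\tau$ of $\Delta$ of codimension $i$ with $\mathring A_\tau\cong A_{\Delta'}$ as $R$-modules is finite, and $$\dim_{\mathsf{k}}\mathrm{Ext}^i_{\mathrm{End}_R(\mathbb A)}(S_\Delta,S_{\Delta'})=\#\{\tau \text{ a cell of codimension } i \text{ in } \Delta \mid \mathring A_\tau\cong A_{\Delta'}\},$$ where Ext is taken in the category of right $\mathrm{End}_R(\mathbb A)$-modules. -/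

import Mathlib

set_option maxSynthPendingDepth 3

open scoped MulOpposite

noncomputable section

universe u v

namespace Toric

section Geometry

variable {V : Type v} [NormedAddCommGroup V] [NormedSpace ℝ V]

/-- `C` is a pointed full-dimensional rational polyhedral cone in the real vector space `V = M_ℝ`
with lattice `L = M`: the set of non-negative real combinations of finitely many lattice vectors,
containing no line, and spanning `V`. (A `PointedCone` is merely a convex cone containing `0`.) -/
structure IsToricCone (L : Submodule ℤ V) (C : PointedCone ℝ V) : Prop where
  rational_polyhedral : ∃ s : Set V, s.Finite ∧ s ⊆ (L : Set V) ∧ C = PointedCone.hull ℝ s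
  pointed : ∀ x ∈ C, -x ∈ C → x = 0
  full_dimensional : Submodule.span ℝ (C : Set V) = ⊤

/-- The linear functional `n` belongs to the dual lattice `N = Hom(M, ℤ)`. -/
def IsIntegral (L : Submodule ℤ V) (n : Module.Dual ℝ V) : Prop :=
  ∀ m ∈ L, ∃ z : ℤ, n m = z

/-- The dual cone `σ` of `C`. -/
def dualCone (C : PointedCone ℝ V) : Set (Module.Dual ℝ V) :=
  {n | ∀ x ∈ C, 0 ≤ n x}

/-- The set `Σ₁` of primitive inward-pointing normals to the facets of `C`: the non-zero integral
functionals in `σ` that are primitive and span an extremal ray of `σ`. -/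
def primitiveNormals (L : Submodule ℤ V) (C : PointedCone ℝ V) : Set (Module.Dual ℝ V) :=
  {n | n ∈ dualCone C ∧ n ≠ 0 ∧ IsIntegral L n ∧
    (∀ ε : ℝ, 0 < ε → ε < 1 → ¬ IsIntegral L (ε • n)) ∧
    ∀ a ∈ dualCone C, ∀ b ∈ dualCone C, a + b = n → ∃ t : ℝ, 0 ≤ t ∧ a = t • n}

/-- The chamber of constancy containing `v`: all `w` with `(C + w) ∩ M = (C + v) ∩ M`. -/
def chamber (L : Submodule ℤ V) (C : PointedCone ℝ V) (v : V) : Set V :=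
  {w | ∀ m ∈ L, m - w ∈ C ↔ m - v ∈ C}

/-- A subset of `V` is a chamber of constancy. -/
def IsChamber (L : Submodule ℤ V) (C : PointedCone ℝ V) (Δ : Set V) : Prop :=
  ∃ v, Δ = chamber L C v

/-- The set `τ_Ω`, for a set `Ω` of primitive normals, computed with the integers
`d_n = ⌈⟨v, n⟩⌉`. -/
def cellSet (L : Submodule ℤ V) (C : PointedCone ℝ V) (v : V) (Ω : Set (Module.Dual ℝ V)) :
    Set V :=
  {x | (∀ n ∈ Ω, (⌈n v⌉ : ℝ) - 1 < n x ∧ n x < (⌈n v⌉ : ℝ)) ∧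
    ∀ n ∈ primitiveNormals L C, n ∉ Ω → n x = (⌈n v⌉ : ℝ)}

/-- `τ` is one of the (non-empty) open cells of the chamber of constancy `Δ`. -/
def IsCell (L : Submodule ℤ V) (C : PointedCone ℝ V) (Δ τ : Set V) : Prop :=
  τ.Nonempty ∧ ∃ v ∈ Δ, ∃ Ω ⊆ primitiveNormals L C, τ = cellSet L C v Ω

/-- `τ` has codimension `i`: the direction space of its affine span has codimension `i`. -/
def HasCodim (τ : Set V) (i : ℕ) : Prop :=
  Module.finrank ℝ (vectorSpan ℝ τ) + i = Module.finrank ℝ V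

theorem add_mem_interior (C : PointedCone ℝ V) {c x : V} (hc : c ∈ C)
    (hx : x ∈ interior (C : Set V)) : c + x ∈ interior (C : Set V) := by
  have h1 : (fun y => c + y) '' interior (C : Set V) ⊆ (C : Set V) := by
    rintro _ ⟨y, hy, rfl⟩
    exact C.add_mem hc (interior_subset hy)
  have h2 : IsOpen ((fun y => c + y) '' interior (C : Set V)) :=
    (Homeomorph.addLeft c).isOpenMap _ isOpen_interior
  exact interior_maximal h1 h2 ⟨x, hx, rfl⟩

end Geometry

section Algebra

variable (𝕜 : Type u) [Field 𝕜] {V : Type v} [NormedAddCommGroup V] [NormedSpace ℝ V]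
  (L : Submodule ℤ V) (C : PointedCone ℝ V)

/-- The Laurent ring `𝕜[M]`, with basis the monomials `x^m`, `m ∈ M`. -/
abbrev Laurent : Type (max u v) := AddMonoidAlgebra 𝕜 L

/-- The toric algebra `R = 𝕜[C ∩ M]`: the Laurent polynomials all of whose monomials `x^m` have
`m ∈ C`. -/
def toricAlgebra : Subalgebra 𝕜 (Laurent 𝕜 L) where
  carrier := {f | ∀ m ∈ f.coeff.support, (m : V) ∈ C}
  mul_mem' := by
    classical
    intro f g hf hg m hm
    obtain ⟨a, ha, b, hb, rfl⟩ := Finset.mem_add.1 (AddMonoidAlgebra.support_coeff_mul_subset f g hm)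
    exact C.add_mem (hf a ha) (hg b hb)
  add_mem' := by
    classical
    intro f g hf hg m hm
    exact (Finset.mem_union.1 (Finsupp.support_add hm)).elim (hf m) (hg m)
  algebraMap_mem' := by
    intro r m hm
    have h : m = 0 := by
      by_contra h
      simp [AddMonoidAlgebra.coe_algebraMap, h] at hm
    subst h
    exact C.zero_mem

variable {C} in
/-- The `R`-submodule of `𝕜[M]` spanned by the monomials `x^m` with `m ∈ T ∩ M`, where `C + T ⊆ T`. -/
def monomialSubmodule (T : Set V) (hT : ∀ c ∈ C, ∀ x ∈ T, c + x ∈ T) :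
    Submodule (toricAlgebra 𝕜 L C) (Laurent 𝕜 L) where
  carrier := {f | ∀ m ∈ f.coeff.support, (m : V) ∈ T}
  zero_mem' := by
    intro m hm
    simp at hm
  add_mem' := by
    classical
    intro f g hf hg m hm
    exact (Finset.mem_union.1 (Finsupp.support_add hm)).elim (hf m) (hg m)
  smul_mem' := by
    classical
    intro r f hf m hm
    obtain ⟨a, ha, b, hb, rfl⟩ :=
      Finset.mem_add.1 (AddMonoidAlgebra.support_coeff_mul_subset (r : Laurent 𝕜 L) f hm)
    exact hT _ (r.2 a ha) _ (hf b hb)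

/-- The conic module `A_v`, spanned by the monomials `x^m` with `m ∈ M ∩ (C + v)`. -/
def conicModule (v : V) : Submodule (toricAlgebra 𝕜 L C) (Laurent 𝕜 L) :=
  monomialSubmodule 𝕜 L (C := C) {x | x - v ∈ C} fun c hc x hx => by
    simpa [add_sub_assoc] using C.add_mem hc hx

/-- The open conic module `Å_v`, spanned by the monomials `x^m` with `m` in `M` and in the
interior of `C + v`. -/
def openConicModule (v : V) : Submodule (toricAlgebra 𝕜 L C) (Laurent 𝕜 L) :=
  monomialSubmodule 𝕜 L (C := C) {x | x - v ∈ interior (C : Set V)} fun c hc x hx => by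
    simpa [add_sub_assoc] using add_mem_interior C hc hx

instance (v : V) : SMul (toricAlgebra 𝕜 L C) (conicModule 𝕜 L C v) :=
  (conicModule 𝕜 L C v).module.toSMul

instance (v : V) : SMul 𝕜 (conicModule 𝕜 L C v) :=
  (conicModule 𝕜 L C v).module'.toSMul

variable {ι : Type} (w : ι → V)

/-- The direct sum `𝔸` of the finitely many conic modules `A_{w i}`. -/
abbrev conicSum : Type (max u v) := ∀ i, conicModule 𝕜 L C (w i)

instance : SMul (toricAlgebra 𝕜 L C) (conicSum 𝕜 L C w) := Pi.instSMul

instance : SMul 𝕜 (conicSum 𝕜 L C w) := Pi.instSMul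

instance : Module (toricAlgebra 𝕜 L C) (conicSum 𝕜 L C w) := Pi.module _ _ _

instance : Module 𝕜 (conicSum 𝕜 L C w) := Pi.module _ _ _

instance (v : V) : SMulCommClass (toricAlgebra 𝕜 L C) 𝕜 (conicModule 𝕜 L C v) :=
  IsScalarTower.to_smulCommClass'

instance : SMulCommClass (toricAlgebra 𝕜 L C) 𝕜 (conicSum 𝕜 L C w) := Pi.smulCommClass

/-- The direct sum of the conic modules `A_{w i}` is complete: every conic module is isomorphic to
one of the summands. -/
def IsComplete : Prop :=
  ∀ v : V, ∃ i, Nonempty (conicModule 𝕜 L C v ≃ₗ[toricAlgebra 𝕜 L C] conicModule 𝕜 L C (w i))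

/-- The endomorphism ring `End_R(𝔸)`, with composition as multiplication. -/
abbrev conicEnd : Type (max u v) := Module.End (toricAlgebra 𝕜 L C) (conicSum 𝕜 L C w)

/-- The `𝕜`-algebra structure of `End_R(𝔸)`, with `c` acting as multiplication by `c`. -/
instance : Algebra 𝕜 (conicEnd 𝕜 L C w) :=
  Module.End.instAlgebra 𝕜 (toricAlgebra 𝕜 L C) (conicSum 𝕜 L C w)

/-- The right `End_R(𝔸)`-module `P_v = Hom_R(𝔸, A_v)`. -/
def projModule (v : V) : Type (max u v) :=
  conicSum 𝕜 L C w →ₗ[toricAlgebra 𝕜 L C] conicModule 𝕜 L C v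

instance (v : V) : AddCommGroup (projModule 𝕜 L C w v) :=
  inferInstanceAs
    (AddCommGroup (conicSum 𝕜 L C w →ₗ[toricAlgebra 𝕜 L C] conicModule 𝕜 L C v))

/-- Right modules over `End_R(𝔸)` are left modules over the opposite ring; an endomorphism acts on
`P_v` by precomposition. -/
instance (v : V) : Module (conicEnd 𝕜 L C w)ᵐᵒᵖ (projModule 𝕜 L C w v) where
  smul g f := LinearMap.comp f g.unop
  one_smul _ := rfl
  mul_smul _ _ _ := rfl
  smul_zero _ := rfl
  smul_add _ _ _ := rfl
  add_smul g h f := LinearMap.comp_add g.unop h.unop f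
  zero_smul f := LinearMap.comp_zero f

variable {𝕜 L C w} in
/-- The map `f : 𝔸 → A_v` is homogeneous of degree `m` for the `M`-gradings: it sends the degree
`n` part of `𝔸`, consisting of tuples of scalar multiples of `x^n`, to the degree `n + m` part
of `A_v`. -/
def IsHomogeneousOfDegree {v : V} (f : projModule 𝕜 L C w v) (m : L) : Prop :=
  ∀ (n : L) (a : conicSum 𝕜 L C w),
    (∀ i, (a i : Laurent 𝕜 L).coeff.support ⊆ {n}) →
      ((show conicSum 𝕜 L C w →ₗ[toricAlgebra 𝕜 L C] conicModule 𝕜 L C v from f) a :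
        Laurent 𝕜 L).coeff.support ⊆ {n + m}

variable {𝕜 L C w} in
/-- An `End_R(𝔸)`-submodule of `P_v` is graded if each of its elements is a sum of homogeneous
elements belonging to it. -/
def IsGraded {v : V} (N : Submodule (conicEnd 𝕜 L C w)ᵐᵒᵖ (projModule 𝕜 L C w v)) : Prop :=
  ∀ f ∈ N, f ∈ AddSubgroup.closure {g | g ∈ N ∧ ∃ m, IsHomogeneousOfDegree g m}

/-- The unique maximal (proper) graded submodule of `P_v`, obtained as the sum of all proper graded
submodules. -/
def maximalGradedSubmodule (v : V) :
    Submodule (conicEnd 𝕜 L C w)ᵐᵒᵖ (projModule 𝕜 L C w v) :=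
  sSup {N | IsGraded N ∧ N ≠ ⊤}

/-- The unique graded simple quotient `S_v` of `P_v`, as a right `End_R(𝔸)`-module. -/
def simpleModule (v : V) : ModuleCat.{max u v} (conicEnd 𝕜 L C w)ᵐᵒᵖ :=
  ModuleCat.of _ (projModule 𝕜 L C w v ⧸ maximalGradedSubmodule 𝕜 L C w v)

/-- The cells `τ` of codimension `i` of the chamber of constancy `Δ` such that the open conic module
`Å_τ` (that is, `Å_x` for any `x ∈ τ`) is isomorphic to the conic module `A_v`. -/
def cellsOfType (Δ : Set V) (v : V) (i : ℕ) : Set (Set V) :=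
  {τ | IsCell L C Δ τ ∧ HasCodim τ i ∧ ∀ x ∈ τ,
    Nonempty (openConicModule 𝕜 L C x ≃ₗ[toricAlgebra 𝕜 L C] conicModule 𝕜 L C v)}

end Algebra

end Toric

end

noncomputable section

universe u v

namespace Toric

/-! The algebra reduces to the order `Dominates`. A homomorphism `A_u → A_v` is multiplication by a
Laurent polynomial (`IsToricCone.exists_multiplier`), and the monomial `x^m` is allowed exactly when
`⌈⟨u + m, n⟩⌉ ≥ ⌈⟨v, n⟩⌉` for every facet normal `n`. Hence an element of `P_v` is a tuple of
Laurent polynomials, one per summand `A_{w i}`, with prescribed possible monomials, and each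
bidegree `(i, m)` contributes dimension at most one. The maximal graded submodule consists of the
tuples none of whose monomials is an isomorphism of a summand onto `A_v`
(`IsComplete.maximalGradedSubmodule_eq`). It follows that `Hom(P_u, S_v)` is one-dimensional when
`A_u ≅ A_v` and zero otherwise.

The simple module `S_Δ` has a cellular resolution. Each open conic module `Å_τ` is itself a conic
module `A_{y τ}`. Put the projective modules of the cells of codimension `k` in homological degree
`k`, with the inclusions multiplied by incidence numbers as differential. In bidegree `(i, m)`, with
`u = w i + m`, only the cells whose active constraints are all strictly exceeded at `u` contribute,
provided `u` dominates the chamber. If `u` lies in the chamber, only the open cell contributes, and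
this accounts for `S_Δ`. Otherwise these are the faces visible from a point outside the half-open
polyhedron `d_n - 1 < ⟨x, n⟩ ≤ d_n`, and their cellular complex is exact (`exactOn_visible`).

That exactness is proved by induction on the number of violated constraints. On a generic segment
from the region to `u`, the last hyperplane crossed splits the visible faces into a subcomplex and a
quotient complex, each of them the visible complex of a point violating fewer constraints. In the
last case two faces remain, joined by an incidence number `±1`. The incidence numbers come from
orienting all conormal spaces by one flag in general position and from the diamond property of faces
(`exists_isIncidence`, `exists_diamond`).

The resolution is minimal: its differentials are built from strict inclusions, which every map to a
simple module kills. So `Ext^i(S_Δ, S_Δ')` is `Hom` from its `i`-th term to `S_Δ'`, and its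
dimension counts the cells of codimension `i` with `Å_τ ≅ A_Δ'`. -/

/-! ### Flags in general position -/

theorem exists_apply_ne_zero_of_notMem {V : Type*} [AddCommGroup V] [Module ℝ V]
    [FiniteDimensional ℝ V] (W : Submodule ℝ (Module.Dual ℝ V)) {y : Module.Dual ℝ V}
    (hy : y ∉ W) : ∃ x : V, (∀ z ∈ W, z x = 0) ∧ y x ≠ 0 := by
  by_contra! h
  apply hy
  rw [← Subspace.dualCoannihilator_dualAnnihilator_eq (W := W), Submodule.mem_dualAnnihilator]
  intro x hx
  exact h x ((Submodule.mem_dualCoannihilator x).1 hx)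

/-- A finite family of subspaces of the dual space admits a flag of vectors in general position. -/
theorem exists_generic_flag {V κ : Type*} [AddCommGroup V] [Module ℝ V] [FiniteDimensional ℝ V]
    [Finite κ] (N : κ → Submodule ℝ (Module.Dual ℝ V)) :
    ∃ g : ℕ → V, ∀ i, ∀ y ∈ N i, (∀ j < Module.finrank ℝ (N i), y (g j) = 0) → y = 0 := by
  classical
  let K (g : ℕ → V) (k : ℕ) (i : κ) : Submodule ℝ (Module.Dual ℝ V) :=
    N i ⊓ ⨅ j : Fin k, LinearMap.ker (Module.Dual.eval ℝ V (g j))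
  have hK : ∀ g k i y, y ∈ K g k i ↔ y ∈ N i ∧ ∀ j < k, y (g j) = 0 := by
    intro g k i y
    simp only [K, Submodule.mem_inf, Submodule.mem_iInf, LinearMap.mem_ker,
      Module.Dual.eval_apply, Fin.forall_iff]
  -- The truncated subtraction is intended: once `l` reaches the dimension of `N i`, the bound says
  -- that the intersection is zero.
  have main : ∀ k : ℕ, ∃ g : ℕ → V, ∀ l ≤ k, ∀ i,
      Module.finrank ℝ (K g l i) ≤ Module.finrank ℝ (N i) - l := by
    intro k
    induction k with
    | zero =>
      refine ⟨0, fun l hl i => ?_⟩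
      obtain rfl : l = 0 := by lia
      exact Submodule.finrank_mono inf_le_left
    | succ k ih =>
      obtain ⟨g, hg⟩ := ih
      -- A vector avoiding finitely many proper subspaces: no non-zero intersection reached so far
      -- vanishes at `x`, so appending `x` to the flag lowers the dimension of each of them.
      obtain ⟨x, hx⟩ : ∃ x : V, ∀ i : {i // K g k i ≠ ⊥}, ∃ y ∈ K g k i, y x ≠ 0 := by
        have h1 : ∀ i : {i // K g k i ≠ ⊥}, ∃ y ∈ K g k i, y ≠ 0 := fun i =>
          (Submodule.ne_bot_iff _).1 i.2
        choose y hy hy0 using h1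
        obtain ⟨x, hx⟩ := Module.Dual.exists_forall_ne_zero_of_forall_exists y fun i => by
          by_contra! h
          exact hy0 i (LinearMap.ext h)
        exact ⟨x, fun i => ⟨y i, hy i, hx i⟩⟩
      refine ⟨Function.update g k x, fun l hl i => ?_⟩
      rcases Nat.lt_or_ge k l with hkl | hkl
      · obtain rfl : l = k + 1 := by lia
        have hle : K (Function.update g k x) (k + 1) i ≤ K g k i := by
          intro y hy
          rw [hK] at hy ⊢
          refine ⟨hy.1, fun j hj => ?_⟩
          have := hy.2 j (by lia)
          rwa [Function.update_of_ne (by lia)] at this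
        by_cases hb : K g k i = ⊥
        · rw [hb, le_bot_iff] at hle
          rw [hle]; simp
        · obtain ⟨y, hy, hyx⟩ := hx ⟨i, hb⟩
          have hlt : K (Function.update g k x) (k + 1) i < K g k i := by
            refine lt_of_le_of_ne hle fun he => hyx ?_
            rw [← he, hK] at hy
            simpa using hy.2 k (by lia)
          have := Submodule.finrank_lt_finrank_of_lt hlt
          have := hg k le_rfl i
          lia
      · have he : K (Function.update g k x) l i = K g l i := by
          ext y
          rw [hK, hK]
          refine and_congr_right fun _ => forall₂_congr fun j hj => ?_
          rw [Function.update_of_ne (by lia)]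
        rw [he]
        exact hg l hkl i
  obtain ⟨g, hg⟩ := main (Module.finrank ℝ (Module.Dual ℝ V))
  refine ⟨g, fun i y hy hy0 => ?_⟩
  have h := hg _ (Submodule.finrank_le (N i)) i
  rw [Nat.sub_self, Nat.le_zero, Submodule.finrank_eq_zero] at h
  have : y ∈ K g (Module.finrank ℝ (N i)) i := (hK _ _ _ _).2 ⟨hy, hy0⟩
  rw [h] at this
  simpa using this

/-- Evaluation at `g 0, …, g r` is injective on `N` and hence bijective by dimension; `y` is the
preimage of the last basis vector. The value `1` at `g r` picks an orientation coherently for all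
subspaces in general position to the flag. -/
theorem exists_normal_of_generic {V : Type*} [AddCommGroup V] [Module ℝ V]
    [FiniteDimensional ℝ V] (N : Submodule ℝ (Module.Dual ℝ V)) (g : ℕ → V) (r : ℕ)
    (hr : Module.finrank ℝ N = r + 1)
    (hg : ∀ y ∈ N, (∀ j < r + 1, y (g j) = 0) → y = 0) :
    ∃ y ∈ N, (∀ j < r, y (g j) = 0) ∧ y (g r) = 1 := by
  let φ : N →ₗ[ℝ] (Fin (r + 1) → ℝ) :=
    LinearMap.pi fun j => (Module.Dual.eval ℝ V (g j)).comp N.subtype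
  have hφ : ∀ y j, φ y j = (y : Module.Dual ℝ V) (g j) := fun y j => rfl
  have hinj : Function.Injective φ := by
    rw [injective_iff_map_eq_zero]
    intro y hy
    ext1
    refine hg y y.2 fun j hj => ?_
    rw [← hφ y ⟨j, hj⟩, hy]; rfl
  have hsurj := (LinearMap.injective_iff_surjective_of_finrank_eq_finrank
    (f := φ) (by simp [hr])).1 hinj
  obtain ⟨y, hy⟩ := hsurj (Pi.single (Fin.last r) 1)
  refine ⟨y, y.2, fun j hj => ?_, ?_⟩
  · rw [← hφ y ⟨j, by lia⟩, hy, Pi.single_eq_of_ne]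
    intro h
    simp [Fin.ext_iff] at h
    lia
  · have := congrFun hy (Fin.last r)
    rw [hφ] at this
    simpa using this

/-! ### Faces of a half-open polyhedron -/

section Arrangement

variable {V ν : Type*} [AddCommGroup V] [Module ℝ V] (f : ν → Module.Dual ℝ V) (d : ν → ℝ)

/-- The half-open polyhedron cut out by `d n - 1 < f n x ≤ d n`. -/
def InRegion (x : V) : Prop := ∀ n, d n - 1 < f n x ∧ f n x ≤ d n

/-- The span of the functionals in `I`. -/
def conormal (I : Finset ν) : Submodule ℝ (Module.Dual ℝ V) := Submodule.span ℝ (f '' I)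

/-- The codimension of the face with active set `I`. -/
def codim (I : Finset ν) : ℕ := Module.finrank ℝ (conormal f I)

variable {f} in
theorem mem_conormal {I : Finset ν} {n : ν} (hn : n ∈ I) : f n ∈ conormal f I :=
  Submodule.subset_span ⟨n, hn, rfl⟩

variable {f} in
theorem conormal_mono {I J : Finset ν} (h : I ⊆ J) : conormal f I ≤ conormal f J :=
  Submodule.span_mono (Set.image_mono h)

variable {f} in
theorem conormal_apply_eq_zero {I : Finset ν} {x : V} (h : ∀ n ∈ I, f n x = 0)
    {y : Module.Dual ℝ V} (hy : y ∈ conormal f I) : y x = 0 := by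
  induction hy using Submodule.span_induction with
  | mem y hy => obtain ⟨n, hn, rfl⟩ := hy; exact h n hn
  | zero => rfl
  | add y z _ _ hy hz => simp [hy, hz]
  | smul a y _ hy => simp [hy]

variable {f} in
theorem codim_lt_of_not_mem [FiniteDimensional ℝ V] {I J : Finset ν} (h : I ⊆ J) {y}
    (hy : y ∈ conormal f J) (hy' : y ∉ conormal f I) : codim f I < codim f J :=
  Submodule.finrank_lt_finrank_of_lt (lt_of_le_of_ne (conormal_mono h) fun e => hy' (e ▸ hy))

variable [Fintype ν]

open Classical in
/-- The set of functionals attaining their upper bound at `x`. -/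
def active (x : V) : Finset ν := {n | f n x = d n}

/-- The active sets of the points of the region index its open faces. -/
def IsFace (I : Finset ν) : Prop := ∃ x, InRegion f d x ∧ active f d x = I

variable {f d}

@[simp]
theorem mem_active {x : V} {n : ν} : n ∈ active f d x ↔ f n x = d n := by
  simp [active]

/-- Finitely many strict inequalities survive a small displacement. Only the lower bounds are
required of `x`, so that this also applies to points outside the region. -/
theorem eventually_mem_region {x : V} (hx : ∀ n, d n - 1 < f n x) (w : V) :
    ∀ᶠ δ : ℝ in nhdsWithin 0 (Set.Ioi 0), 0 < δ ∧ (∀ n, d n - 1 < f n (x + δ • w)) ∧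
      (∀ n, f n x < d n → f n (x + δ • w) < d n) ∧
      ∀ n, d n < f n x → d n < f n (x + δ • w) := by
  have hc : ∀ n, Filter.Tendsto (fun δ : ℝ => f n (x + δ • w)) (nhdsWithin 0 (Set.Ioi 0))
      (nhds (f n x)) := by
    intro n
    have : Continuous fun δ : ℝ => f n (x + δ • w) := by
      simp only [map_add, map_smul, smul_eq_mul]; fun_prop
    have := this.tendsto 0
    simp only [zero_smul, add_zero] at this
    exact this.mono_left nhdsWithin_le_nhds
  refine Filter.Eventually.and (show ∀ᶠ δ : ℝ in _, 0 < δ from self_mem_nhdsWithin)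
    (Filter.Eventually.and ?_ (Filter.Eventually.and ?_ ?_))
  · exact Filter.eventually_all.2 fun n => (hc n).eventually_const_lt (hx n)
  · refine Filter.eventually_all.2 fun n => ?_
    by_cases h : f n x < d n
    · filter_upwards [(hc n).eventually_lt_const h] with δ hδ _ using hδ
    · exact Filter.Eventually.of_forall fun _ h' => absurd h' h
  · refine Filter.eventually_all.2 fun n => ?_
    by_cases h : d n < f n x
    · filter_upwards [(hc n).eventually_const_lt h] with δ hδ _ using hδ
    · exact Filter.Eventually.of_forall fun _ h' => absurd h' h

theorem exists_mem_region {x : V} (hx : ∀ n, d n - 1 < f n x) (w : V) :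
    ∃ δ : ℝ, 0 < δ ∧ (∀ n, d n - 1 < f n (x + δ • w)) ∧
      (∀ n, f n x < d n → f n (x + δ • w) < d n) ∧
      ∀ n, d n < f n x → d n < f n (x + δ • w) :=
  (eventually_mem_region hx w).exists

end Arrangement

/-! ### The diamond property -/

section Arrangement

variable {V ν : Type*} [AddCommGroup V] [Module ℝ V] [FiniteDimensional ℝ V] [Fintype ν]
  {f : ν → Module.Dual ℝ V} {d : ν → ℝ}

/-- A ray of a two-dimensional corner of the region, reached from the interior direction `w` by
moving in the direction `w₁`. -/
theorem exists_ray {p w w₁ : V} {J : Finset ν}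
    (hp : InRegion f d p) (hJ : J ⊆ active f d p)
    (hcod : codim f (active f d p) = codim f J + 2)
    (hw : ∀ n ∈ J, f n w = 0) (hw' : ∀ n ∈ active f d p, n ∉ J → f n w < 0)
    (hw₁ : ∀ n ∈ J, f n w₁ = 0) (hpos : ∃ n ∈ active f d p, 0 < f n w₁)
    (hneg : ∃ n ∈ active f d p, f n w₁ < 0) :
    ∃ t : ℝ, 0 < t ∧ (∀ n ∈ active f d p, f n (w + t • w₁) ≤ 0) ∧
      ∃ K : Finset ν, IsFace f d K ∧ J ⊆ K ∧ K ⊆ active f d p ∧ codim f K = codim f J + 1 ∧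
        (∀ n, n ∈ K ↔ n ∈ active f d p ∧ f n (w + t • w₁) = 0) ∧
        ∃ n ∈ K, n ∉ J ∧ 0 < f n w₁ := by
  classical
  obtain ⟨n₀, hn₀, hn₀'⟩ := hpos
  obtain ⟨n₁, hn₁, hn₁'⟩ := hneg
  have hsne : ((active f d p).filter fun n => 0 < f n w₁).Nonempty := ⟨n₀, Finset.mem_filter.2 ⟨hn₀, hn₀'⟩⟩
  -- Ratio test: among the active constraints increasing along `w₁`, `m` is the first to become
  -- tight when moving from `w` towards `w₁`, and `t` is the time at which this happens.
  obtain ⟨m, hm, hmin⟩ := Finset.exists_min_image _ (fun n => -f n w / f n w₁) hsne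
  rw [Finset.mem_filter] at hm
  have hmJ : m ∉ J := fun h => by have := hw₁ m h; linarith [hm.2]
  have hmw := hw' m hm.1 hmJ
  set t := -f m w / f m w₁ with ht
  have ht0 : 0 < t := div_pos (by linarith) hm.2
  have hle : ∀ n ∈ active f d p, f n (w + t • w₁) ≤ 0 := by
    intro n hn
    simp only [map_add, map_smul, smul_eq_mul]
    by_cases hnJ : n ∈ J
    · simp [hw n hnJ, hw₁ n hnJ]
    · have h1 := hw' n hn hnJ
      rcases le_or_gt (f n w₁) 0 with h2 | h2
      · nlinarith
      · have := hmin n (by simp only [Finset.mem_filter]; exact ⟨hn, h2⟩)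
        rw [le_div_iff₀ h2] at this
        linarith
  have hmt : f m (w + t • w₁) = 0 := by
    have := hm.2.ne'
    simp only [map_add, map_smul, smul_eq_mul, ht]
    field_simp
    ring
  obtain ⟨δ, hδ, h1, h2, -⟩ := exists_mem_region (f := f) (d := d) (fun n => (hp n).1) (w + t • w₁)
  have hmem : ∀ n, n ∈ active f d (p + δ • (w + t • w₁)) ↔
      n ∈ active f d p ∧ f n (w + t • w₁) = 0 := by
    intro n
    constructor
    · intro h
      rw [mem_active] at h
      have hn : n ∈ active f d p := by
        rw [mem_active]
        by_contra hne
        exact (h2 n (lt_of_le_of_ne (hp n).2 hne)).ne h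
      refine ⟨hn, ?_⟩
      rw [mem_active] at hn
      rw [map_add, map_smul, hn, smul_eq_mul] at h
      have : δ * f n (w + t • w₁) = 0 := by linarith
      exact (mul_eq_zero.1 this).resolve_left hδ.ne'
    · rintro ⟨h, h'⟩
      rw [mem_active] at h ⊢
      rw [map_add, map_smul, h, h']; simp
  have hJK : J ⊆ active f d (p + δ • (w + t • w₁)) := by
    intro n hn
    rw [hmem]
    refine ⟨hJ hn, ?_⟩
    simp [hw n hn, hw₁ n hn]
  have hKI : active f d (p + δ • (w + t • w₁)) ⊆ active f d p := fun n hn => ((hmem n).1 hn).1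
  refine ⟨t, ht0, hle, active f d (p + δ • (w + t • w₁)), ⟨_, fun n => ⟨h1 n, ?_⟩, rfl⟩, hJK, hKI,
    ?_, hmem, m, (hmem m).2 ⟨hm.1, hmt⟩, hmJ, hm.2⟩
  · by_cases hn : n ∈ active f d p
    · have := mul_nonneg hδ.le (neg_nonneg.2 (hle n hn))
      rw [mem_active] at hn
      rw [map_add, map_smul, hn, smul_eq_mul]; linarith
    · rw [mem_active] at hn
      exact (h2 n (lt_of_le_of_ne (hp n).2 hn)).le
  · have ha : codim f J < codim f (active f d (p + δ • (w + t • w₁))) := by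
      refine codim_lt_of_not_mem hJK (mem_conormal ((hmem m).2 ⟨hm.1, hmt⟩)) fun h => ?_
      have := conormal_apply_eq_zero hw h
      linarith
    -- The constraint `n₁` decreases along `w₁`, so it is not tight on the ray and is independent of
    -- the constraints that are. The codimension is thus strictly between two numbers that differ by
    -- two.
    have hb : codim f (active f d (p + δ • (w + t • w₁))) < codim f (active f d p) := by
      refine codim_lt_of_not_mem hKI (mem_conormal hn₁) fun h => ?_
      have h3 := conormal_apply_eq_zero (fun n hn => ((hmem n).1 hn).2) h
      have h4 : n₁ ∉ J := fun h => by have := hw₁ _ h; linarith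
      have h5 := hw' _ hn₁ h4
      simp only [map_add, map_smul, smul_eq_mul] at h3
      nlinarith
    lia

/-- Between two faces whose codimensions differ by two there are exactly two faces. -/
theorem exists_diamond {p q : V} (hp : InRegion f d p) (hq : InRegion f d q)
    (hsub : active f d q ⊆ active f d p)
    (hcod : codim f (active f d p) = codim f (active f d q) + 2) :
    ∃ K₁ K₂ : Finset ν, K₁ ≠ K₂ ∧
      (∀ K, (IsFace f d K ∧ active f d q ⊆ K ∧ K ⊆ active f d p ∧
        codim f K = codim f (active f d q) + 1) ↔ K = K₁ ∨ K = K₂) ∧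
      ∀ x₁ x₂, InRegion f d x₁ → active f d x₁ = K₁ → InRegion f d x₂ → active f d x₂ = K₂ →
        ∃ α β : ℝ, 0 < α ∧ 0 < β ∧ ∀ y ∈ conormal f (active f d p),
          y (q - p) = α * y (x₁ - p) + β * y (x₂ - p) := by
  classical
  set I := active f d p with hI
  set J := active f d q with hJ
  set w := q - p with hwdef
  have hIJ : ∀ n ∈ I, n ∉ J → f n w < 0 := by
    intro n hn hnJ
    rw [hI, mem_active] at hn
    rw [hJ, mem_active] at hnJ
    rw [hwdef, map_sub, hn]
    linarith [lt_of_le_of_ne (hq n).2 hnJ]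
  have hJw : ∀ n ∈ J, f n w = 0 := by
    intro n hn
    have h1 := hsub hn
    rw [hI, mem_active] at h1
    rw [hJ, mem_active] at hn
    rw [hwdef, map_sub, hn, h1, sub_self]
  -- A height function on the corner at `p`: it is negative on every direction that satisfies these
  -- constraints and leaves one of them strictly. A direction `w₁` of height zero will be
  -- transversal to `w`.
  set s : Module.Dual ℝ V := ∑ n ∈ I \ J, f n with hs
  have hsI : s ∈ conormal f I :=
    Submodule.sum_mem _ fun n hn => mem_conormal (Finset.sdiff_subset hn)
  have hneIJ : (I \ J).Nonempty := by
    rw [Finset.sdiff_nonempty]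
    intro h
    have := Finset.Subset.antisymm h hsub
    rw [this] at hcod
    lia
  have hsneg : ∀ x, (∀ n ∈ I, n ∉ J → f n x ≤ 0) → (∃ n ∈ I, n ∉ J ∧ f n x < 0) → s x < 0 := by
    intro x h ⟨n, hn, hnJ, hlt⟩
    rw [hs, LinearMap.sum_apply]
    exact Finset.sum_neg' (fun m hm => h m (Finset.mem_sdiff.1 hm).1 (Finset.mem_sdiff.1 hm).2)
      ⟨n, Finset.mem_sdiff.2 ⟨hn, hnJ⟩, hlt⟩
  have hsw : s w < 0 := by
    obtain ⟨n, hn⟩ := hneIJ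
    rw [Finset.mem_sdiff] at hn
    exact hsneg w (fun n hn hnJ => (hIJ n hn hnJ).le) ⟨n, hn.1, hn.2, hIJ n hn.1 hn.2⟩
  -- a second direction
  set W := conormal f J ⊔ Submodule.span ℝ {s} with hW
  have hWle : W ≤ conormal f I :=
    sup_le (conormal_mono hsub) ((Submodule.span_singleton_le_iff_mem _ _).2 hsI)
  have hfinspan : ∀ y : Module.Dual ℝ V, Module.finrank ℝ (Submodule.span ℝ {y}) ≤ 1 := fun y =>
    (finrank_span_le_card _).trans (by simp)
  have hWfin : Module.finrank ℝ W < codim f I := by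
    have h1 := Submodule.finrank_add_le_finrank_add_finrank (conormal f J) (Submodule.span ℝ {s})
    have h2 := hfinspan s
    have h3 : codim f J = Module.finrank ℝ (conormal f J) := rfl
    rw [← hW] at h1
    lia
  obtain ⟨n₀, hn₀, hn₀W⟩ : ∃ n ∈ I, f n ∉ W := by
    by_contra! h
    have : conormal f I ≤ W := Submodule.span_le.2 (by rintro _ ⟨n, hn, rfl⟩; exact h n hn)
    exact absurd (Submodule.finrank_mono this) (not_le.2 hWfin)
  obtain ⟨w₁, hw₁W, hw₁⟩ := exists_apply_ne_zero_of_notMem W hn₀W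
  have hw₁J : ∀ n ∈ J, f n w₁ = 0 := fun n hn =>
    hw₁W _ (Submodule.mem_sup_left (mem_conormal hn))
  have hsw₁ : s w₁ = 0 := hw₁W _ (Submodule.mem_sup_right (Submodule.mem_span_singleton_self s))
  have hspan : ∀ y ∈ conormal f I, ∃ z ∈ conormal f J, ∃ a b : ℝ, y = z + a • s + b • f n₀ := by
    have hlt : W < W ⊔ Submodule.span ℝ {f n₀} := by
      refine lt_of_le_of_ne le_sup_left fun h => hn₀W ?_
      rw [h]
      exact Submodule.mem_sup_right (Submodule.mem_span_singleton_self _)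
    have hlt' : conormal f J < W := by
      refine lt_of_le_of_ne le_sup_left fun h => ?_
      have : s ∈ conormal f J := by
        rw [h]; exact Submodule.mem_sup_right (Submodule.mem_span_singleton_self s)
      have := conormal_apply_eq_zero hJw this
      linarith
    have h1 := Submodule.finrank_lt_finrank_of_lt hlt
    have h2 := Submodule.finrank_lt_finrank_of_lt hlt'
    have h3 : W ⊔ Submodule.span ℝ {f n₀} = conormal f I := by
      refine Submodule.eq_of_le_of_finrank_le
        (sup_le hWle ((Submodule.span_singleton_le_iff_mem _ _).2 (mem_conormal hn₀))) ?_
      change codim f I ≤ _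
      have h3 : codim f J = Module.finrank ℝ (conormal f J) := rfl
      lia
    intro y hy
    rw [← h3, Submodule.mem_sup] at hy
    obtain ⟨y₁, hy₁, y₂, hy₂, rfl⟩ := hy
    rw [hW, Submodule.mem_sup] at hy₁
    obtain ⟨z, hz, y₃, hy₃, rfl⟩ := hy₁
    obtain ⟨a, rfl⟩ := Submodule.mem_span_singleton.1 hy₃
    obtain ⟨b, rfl⟩ := Submodule.mem_span_singleton.1 hy₂
    exact ⟨z, hz, a, b, rfl⟩
  -- Modulo `conormal f J`, the space `conormal f I` is spanned by `s` and `f n₀`. Dually, `w` and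
  -- `w₁` give coordinates on the directions killed by `J`, as far as `conormal f I` can see.
  have hcoord : ∀ x, (∀ n ∈ J, f n x = 0) → ∃ b : ℝ, ∀ y ∈ conormal f I,
      y x = s x / s w * y w + b * y w₁ := by
    intro x hx
    refine ⟨(f n₀ x - f n₀ w * (s x / s w)) / f n₀ w₁, fun y hy => ?_⟩
    obtain ⟨z, hz, a, b, rfl⟩ := hspan y hy
    have h1 := conormal_apply_eq_zero hx hz
    have h2 := conormal_apply_eq_zero hJw hz
    have h3 := conormal_apply_eq_zero hw₁J hz
    simp only [LinearMap.add_apply, LinearMap.smul_apply, smul_eq_mul, h1, h2, h3, hsw₁]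
    have := hsw.ne
    field_simp
    ring
  -- The values at `w₁` add up to zero and are not all zero, so both signs occur; each sign yields
  -- one of the two rays.
  have hsum : ∑ n ∈ I \ J, f n w₁ = 0 := by rw [← LinearMap.sum_apply]; exact hsw₁
  have hn₀' : n₀ ∈ I \ J := by
    rw [Finset.mem_sdiff]
    exact ⟨hn₀, fun h => hw₁ (hw₁J _ h)⟩
  have hpos : ∃ n ∈ I, 0 < f n w₁ := by
    obtain ⟨n, hn, h⟩ := Finset.exists_pos_of_sum_zero_of_exists_nonzero _ hsum ⟨n₀, hn₀', hw₁⟩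
    exact ⟨n, Finset.sdiff_subset hn, h⟩
  have hneg : ∃ n ∈ I, f n w₁ < 0 := by
    obtain ⟨n, hn, h⟩ := Finset.exists_pos_of_sum_zero_of_exists_nonzero (s := I \ J)
      (fun n => - f n w₁) (by rw [Finset.sum_neg_distrib, hsum, neg_zero])
      ⟨n₀, hn₀', neg_ne_zero.2 hw₁⟩
    exact ⟨n, Finset.sdiff_subset hn, by linarith⟩
  obtain ⟨t₁, ht₁, hle₁, K₁, hK₁, hJK₁, hKI₁, hc₁, hmem₁, m₁, hm₁, hm₁J, hm₁p⟩ :=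
    exists_ray hp hsub hcod hJw hIJ hw₁J hpos hneg
  obtain ⟨t₂, ht₂, hle₂, K₂, hK₂, hJK₂, hKI₂, hc₂, hmem₂, m₂, hm₂, hm₂J, hm₂p⟩ :=
    exists_ray hp hsub hcod hJw hIJ (w₁ := -w₁) (fun n hn => by simp [hw₁J n hn])
      (hneg.imp fun n h => ⟨h.1, by simpa using h.2⟩)
      (hpos.imp fun n h => ⟨h.1, by simpa using h.2⟩)
  simp only [map_add, map_smul, smul_eq_mul, map_neg] at hle₁ hle₂ hmem₁ hmem₂ hm₂p
  -- directions of intermediate faces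
  have hdir : ∀ x, InRegion f d x → J ⊆ active f d x → active f d x ⊆ I →
      codim f (active f d x) = codim f J + 1 → ∃ a : ℝ, 0 < a ∧
        ((active f d x = K₁ ∧ ∀ y ∈ conormal f I, y (x - p) = a * (y w + t₁ * y w₁)) ∨
        (active f d x = K₂ ∧ ∀ y ∈ conormal f I, y (x - p) = a * (y w - t₂ * y w₁))) := by
    intro x hx hJx hxI hcx
    have hv : ∀ n ∈ I, f n (x - p) = f n x - d n := by
      intro n hn
      rw [hI, mem_active] at hn
      rw [map_sub, hn]
    have hv0 : ∀ n ∈ I, (n ∈ active f d x ↔ f n (x - p) = 0) := by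
      intro n hn
      rw [hv n hn, mem_active, sub_eq_zero]
    have hvle : ∀ n ∈ I, f n (x - p) ≤ 0 := by
      intro n hn
      rw [hv n hn]; linarith [(hx n).2]
    obtain ⟨b, hb⟩ := hcoord (x - p) (fun n hn => (hv0 n (hsub hn)).1 (hJx hn))
    have hsv : s (x - p) < 0 := by
      refine hsneg _ (fun n hn _ => hvle n hn) ?_
      obtain ⟨n, hn⟩ : (I \ active f d x).Nonempty := by
        rw [Finset.sdiff_nonempty]
        intro h
        have := Finset.Subset.antisymm h hxI
        rw [← this] at hcx
        lia
      rw [Finset.mem_sdiff] at hn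
      exact ⟨n, hn.1, fun h => hn.2 (hJx h),
        lt_of_le_of_ne (hvle n hn.1) fun h => hn.2 ((hv0 n hn.1).2 h)⟩
    set a := s (x - p) / s w with ha
    have ha0 : 0 < a := div_pos_of_neg_of_neg hsv hsw
    obtain ⟨k, hkx, hkJ⟩ : ∃ k ∈ active f d x, k ∉ J := by
      by_contra! h
      have := Finset.Subset.antisymm (fun n hn => h n hn) hJx
      rw [this] at hcx
      lia
    have hkI := hxI hkx
    have hk0 := (hv0 k hkI).1 hkx
    rw [hb _ (mem_conormal hkI)] at hk0
    have hkw := hIJ k hkI hkJ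
    refine ⟨a, ha0, ?_⟩
    have key : ∀ n ∈ I, a * f n w + b * f n w₁ ≤ 0 := fun n hn =>
      (hb _ (mem_conormal hn)).symm.trans_le (hvle n hn)
    have hm₁I := hKI₁ hm₁
    have hm₂I := hKI₂ hm₂
    have e₁ := ((hmem₁ m₁).1 hm₁).2
    have e₂ := ((hmem₂ m₂).1 hm₂).2
    have k₁ := key _ hm₁I
    have k₂ := key _ hm₂I
    have l₁ := hle₁ k hkI
    have l₂ := hle₂ k hkI
    -- The sign of `b` decides the ray. The constraint `k`, tight at `x`, and `m₁` or `m₂`, tight on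
    -- the ray, bound `b / a` from the two sides.
    rcases le_or_gt 0 b with hb0 | hb0
    · have hkp : 0 < f k w₁ := by
        by_contra h
        nlinarith [mul_nonneg hb0 (neg_nonneg.2 (not_lt.1 h)), mul_pos ha0 (neg_pos.2 hkw)]
      have hbt : b = a * t₁ := by
        apply le_antisymm
        · have : (b - a * t₁) * f m₁ w₁ ≤ 0 := by nlinarith
          nlinarith
        · have : (b - a * t₁) * f k w₁ ≥ 0 := by nlinarith
          nlinarith
      have hy : ∀ y ∈ conormal f I, y (x - p) = a * (y w + t₁ * y w₁) := by
        intro y hy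
        rw [hb y hy, hbt]; ring
      refine Or.inl ⟨?_, hy⟩
      ext n
      rw [hmem₁]
      constructor
      · intro hn
        have hnI := hxI hn
        have := (hv0 n hnI).1 hn
        rw [hy _ (mem_conormal hnI)] at this
        exact ⟨hnI, (mul_eq_zero.1 this).resolve_left ha0.ne'⟩
      · rintro ⟨hnI, h⟩
        rw [hv0 n hnI, hy _ (mem_conormal hnI), h, mul_zero]
    · have hkp : f k w₁ < 0 := by
        by_contra h
        nlinarith [mul_nonneg (neg_nonneg.2 hb0.le) (not_lt.1 h), mul_pos ha0 (neg_pos.2 hkw)]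
      have hbt : b = -(a * t₂) := by
        apply le_antisymm
        · have : (b + a * t₂) * f k w₁ ≥ 0 := by nlinarith
          nlinarith
        · have : (b + a * t₂) * f m₂ w₁ ≤ 0 := by nlinarith
          nlinarith
      have hy : ∀ y ∈ conormal f I, y (x - p) = a * (y w - t₂ * y w₁) := by
        intro y hy
        rw [hb y hy, hbt]; ring
      refine Or.inr ⟨?_, hy⟩
      ext n
      rw [hmem₂]
      constructor
      · intro hn
        have hnI := hxI hn
        have := (hv0 n hnI).1 hn
        rw [hy _ (mem_conormal hnI)] at this
        have := (mul_eq_zero.1 this).resolve_left ha0.ne'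
        exact ⟨hnI, by linarith⟩
      · rintro ⟨hnI, h⟩
        rw [hv0 n hnI, hy _ (mem_conormal hnI), mul_eq_zero]
        right; linarith
  have hne : K₁ ≠ K₂ := by
    intro h
    have h1 := ((hmem₁ m₁).1 hm₁).2
    have h2 := ((hmem₂ m₁).1 (h ▸ hm₁)).2
    have := mul_pos (add_pos ht₁ ht₂) hm₁p
    linarith
  refine ⟨K₁, K₂, hne, fun K => ⟨?_, ?_⟩, ?_⟩
  · rintro ⟨⟨x, hx, rfl⟩, h1, h2, h3⟩
    obtain ⟨a, -, h | h⟩ := hdir x hx h1 h2 h3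
    exacts [Or.inl h.1, Or.inr h.1]
  · rintro (rfl | rfl)
    exacts [⟨hK₁, hJK₁, hKI₁, hc₁⟩, ⟨hK₂, hJK₂, hKI₂, hc₂⟩]
  · intro x₁ x₂ hx₁ hxK₁ hx₂ hxK₂
    obtain ⟨a₁, ha₁, h | h⟩ := hdir x₁ hx₁ (hxK₁ ▸ hJK₁) (hxK₁ ▸ hKI₁) (hxK₁ ▸ hc₁)
    swap
    · exact absurd (hxK₁.symm.trans h.1) hne
    obtain ⟨a₂, ha₂, h' | h'⟩ := hdir x₂ hx₂ (hxK₂ ▸ hJK₂) (hxK₂ ▸ hKI₂) (hxK₂ ▸ hc₂)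
    · exact absurd (hxK₂.symm.trans h'.1) hne.symm
    -- These solve `w = α a₁ (w + t₁ w₁) + β a₂ (w - t₂ w₁)`.
    refine ⟨t₂ / ((t₁ + t₂) * a₁), t₁ / ((t₁ + t₂) * a₂), div_pos ht₂ (mul_pos (add_pos ht₁ ht₂) ha₁),
      div_pos ht₁ (mul_pos (add_pos ht₁ ht₂) ha₂), fun y hy => ?_⟩
    rw [h.2 y hy, h'.2 y hy]
    have h1 := ha₁.ne'
    have h2 := ha₂.ne'
    have h3 := (add_pos ht₁ ht₂).ne'
    generalize y w = A, y w₁ = B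
    clear * - h1 h2 h3
    field_simp
    ring

end Arrangement

/-! ### Incidence numbers -/

section Arrangement

variable {V ν : Type*} [AddCommGroup V] [Module ℝ V] [Fintype ν]
  (f : ν → Module.Dual ℝ V) (d : ν → ℝ)

/-- `ε` is a system of incidence numbers for the faces of the region. -/
structure IsIncidence (ε : Finset ν → Finset ν → ℤ) : Prop where
  of_ne_zero : ∀ I J, ε I J ≠ 0 →
    IsFace f d I ∧ IsFace f d J ∧ J ⊆ I ∧ codim f I = codim f J + 1
  eq_or : ∀ I J, IsFace f d I → IsFace f d J → J ⊆ I → codim f I = codim f J + 1 →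
    ε I J = 1 ∨ ε I J = -1
  sum_mul : ∀ I J, ∑ K, ε I K * ε K J = 0

/-- Let `N I` be the element of `conormal f I` that vanishes on all but the last of the first `codim
f I` vectors of a generic flag and is `1` on the last. For a covering pair, `ε I J` is the sign of
`N I` on a displacement from a chosen point of the face `I` to one of the face `J`. In a diamond
with middle faces `K₁`, `K₂`, the difference `N K₁ - N K₂` is a multiple of `N I`, and this makes
the two products of signs cancel. -/
theorem exists_isIncidence [FiniteDimensional ℝ V] : ∃ ε, IsIncidence f d ε := by
  classical
  obtain ⟨g, hg⟩ := exists_generic_flag (V := V) fun I : Finset ν => conormal f I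
  have hN : ∀ I : Finset ν, ∃ y : Module.Dual ℝ V, codim f I ≠ 0 →
      y ∈ conormal f I ∧ (∀ j < codim f I - 1, y (g j) = 0) ∧ y (g (codim f I - 1)) = 1 := by
    intro I
    by_cases h : codim f I = 0
    · exact ⟨0, fun h' => absurd h h'⟩
    · obtain ⟨y, hy⟩ := exists_normal_of_generic (conormal f I) g (codim f I - 1)
        (show codim f I = _ by lia) fun y hy hy0 =>
          hg I y hy fun j hj => hy0 j (by change j < codim f I at hj; lia)
      exact ⟨y, fun _ => hy⟩
  choose N hN using hN
  have hP : ∀ I : Finset ν, ∃ x : V, IsFace f d I → InRegion f d x ∧ active f d x = I := by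
    intro I
    by_cases h : IsFace f d I
    · exact ⟨h.choose, fun _ => h.choose_spec⟩
    · exact ⟨0, fun h' => absurd h' h⟩
  choose P hP using hP
  -- the covering relation
  let cov (I J : Finset ν) : Prop :=
    IsFace f d I ∧ IsFace f d J ∧ J ⊆ I ∧ codim f I = codim f J + 1
  let ε (I J : Finset ν) : ℤ := if cov I J then (SignType.sign (N I (P J - P I)) : ℤ) else 0
  have hvan : ∀ I J, cov I J → ∀ y ∈ conormal f J, y (P J - P I) = 0 := by
    intro I J h y hy
    obtain ⟨hI, hJ, hJI, -⟩ := h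
    refine conormal_apply_eq_zero (fun n hn => ?_) hy
    have h1 : n ∈ active f d (P J) := by rwa [(hP J hJ).2]
    have h2 : n ∈ active f d (P I) := by rw [(hP I hI).2]; exact hJI hn
    rw [mem_active] at h1 h2
    rw [map_sub, h1, h2, sub_self]
  have hne : ∀ I J, cov I J → N I (P J - P I) ≠ 0 := by
    intro I J h h0
    obtain ⟨hI, hJ, hJI, hc⟩ := h
    obtain ⟨n1, n2, n3⟩ := hN I (by lia)
    -- `N I` vanishes on the first `codim f J` flag vectors, which detect every non-zero element of
    -- `conormal f J`.
    have hnot : N I ∉ conormal f J := fun hmem => by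
      have := hg J _ hmem fun j hj => n2 j (by change j < codim f J at hj; lia)
      rw [this] at n3
      simp at n3
    have heq : conormal f J ⊔ Submodule.span ℝ {N I} = conormal f I := by
      refine Submodule.eq_of_le_of_finrank_le
        (sup_le (conormal_mono hJI) ((Submodule.span_singleton_le_iff_mem _ _).2 n1)) ?_
      have hlt : conormal f J < conormal f J ⊔ Submodule.span ℝ {N I} := by
        refine lt_of_le_of_ne le_sup_left fun h => hnot ?_
        rw [h]
        exact Submodule.mem_sup_right (Submodule.mem_span_singleton_self _)
      have := Submodule.finrank_lt_finrank_of_lt hlt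
      change codim f I ≤ _
      have h3 : codim f J = Module.finrank ℝ (conormal f J) := rfl
      lia
    have hall : ∀ y ∈ conormal f I, y (P J - P I) = 0 := by
      intro y hy
      rw [← heq, Submodule.mem_sup] at hy
      obtain ⟨y₁, hy₁, y₂, hy₂, rfl⟩ := hy
      obtain ⟨a, rfl⟩ := Submodule.mem_span_singleton.1 hy₂
      simp [hvan I J ⟨hI, hJ, hJI, hc⟩ y₁ hy₁, h0]
    have : I ⊆ J := by
      intro n hn
      have h1 := hall _ (mem_conormal hn)
      rw [← (hP I hI).2, mem_active] at hn
      rw [map_sub, hn, sub_eq_zero] at h1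
      rwa [← (hP J hJ).2, mem_active]
    rw [Finset.Subset.antisymm this hJI] at hc
    lia
  have hε : ∀ I J, cov I J → ε I J = (SignType.sign (N I (P J - P I)) : ℤ) := fun I J h => if_pos h
  have hε0 : ∀ I J, ¬ cov I J → ε I J = 0 := fun I J h => if_neg h
  refine ⟨ε, ⟨fun I J h => ?_, fun I J h1 h2 h3 h4 => ?_, fun I J => ?_⟩⟩
  · by_contra h'
    exact h (hε0 I J h')
  · rw [hε I J ⟨h1, h2, h3, h4⟩]
    rcases lt_or_gt_of_ne (hne I J ⟨h1, h2, h3, h4⟩) with h | h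
    · right; rw [sign_neg h]; rfl
    · left; rw [sign_pos h]; rfl
  · by_cases hIJ : IsFace f d I ∧ IsFace f d J ∧ J ⊆ I ∧ codim f I = codim f J + 2
    · obtain ⟨hI, hJ, hJI, hc⟩ := hIJ
      obtain ⟨pI, aI⟩ := hP I hI
      obtain ⟨pJ, aJ⟩ := hP J hJ
      obtain ⟨K₁, K₂, hK, hcond, hpts⟩ := exists_diamond pI pJ (by rwa [aI, aJ]) (by rwa [aI, aJ])
      rw [aI, aJ] at hcond
      rw [aI] at hpts
      have hK₁ := (hcond K₁).2 (Or.inl rfl)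
      have hK₂ := (hcond K₂).2 (Or.inr rfl)
      obtain ⟨α, β, hα, hβ, hrel⟩ := hpts (P K₁) (P K₂) (hP K₁ hK₁.1).1 (hP K₁ hK₁.1).2
        (hP K₂ hK₂.1).1 (hP K₂ hK₂.1).2
      have c1 : cov I K₁ := ⟨hI, hK₁.1, hK₁.2.2.1, by lia⟩
      have c2 : cov I K₂ := ⟨hI, hK₂.1, hK₂.2.2.1, by lia⟩
      have c1' : cov K₁ J := ⟨hK₁.1, hJ, hK₁.2.1, by lia⟩
      have c2' : cov K₂ J := ⟨hK₂.1, hJ, hK₂.2.1, by lia⟩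
      have hsum : ∑ K, ε I K * ε K J = ε I K₁ * ε K₁ J + ε I K₂ * ε K₂ J := by
        rw [← Finset.sum_pair (f := fun K => ε I K * ε K J) hK]
        refine (Finset.sum_subset (Finset.subset_univ _) fun K _ hKn => ?_).symm
        by_cases h1 : cov I K
        · by_cases h2 : cov K J
          · exfalso
            apply hKn
            rw [Finset.mem_insert, Finset.mem_singleton]
            exact (hcond K).1 ⟨h2.1, h2.2.2.1, h1.2.2.1, h2.2.2.2⟩
          · rw [hε0 K J h2, mul_zero]
        · rw [hε0 I K h1, zero_mul]
      have n0 := hN I (by lia)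
      have n1 := hN K₁ (by lia)
      have n2 := hN K₂ (by lia)
      have hm1 := conormal_mono (f := f) c1.2.2.1 n1.1
      have hm2 := conormal_mono (f := f) c2.2.2.1 n2.1
      have v1 := hvan I K₁ c1 _ n1.1
      have v2 := hvan I K₂ c2 _ n2.1
      -- `N K₁` kills `P K₁ - P I`, so the diamond relation leaves only the contribution of `P K₂`;
      -- `e2` is symmetric.
      have e1 : N K₁ (P J - P K₁) = β * N K₁ (P K₂ - P I) := by
        have := hrel _ hm1
        rw [v1] at this
        have h : P J - P K₁ = (P J - P I) - (P K₁ - P I) := by abel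
        rw [h, map_sub, v1, this]; ring
      have e2 : N K₂ (P J - P K₂) = α * N K₂ (P K₁ - P I) := by
        have := hrel _ hm2
        rw [v2] at this
        have h : P J - P K₂ = (P J - P I) - (P K₂ - P I) := by abel
        rw [h, map_sub, v2, this]; ring
      have hr1 : codim f K₁ - 1 = codim f J := by lia
      have hr2 : codim f K₂ - 1 = codim f J := by lia
      have hr0 : codim f I - 1 = codim f J + 1 := by lia
      rw [hr1] at n1
      rw [hr2] at n2
      rw [hr0] at n0
      -- `N K₁` and `N K₂` agree on the first `codim f J + 1` flag vectors, so only the next one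
      -- distinguishes them, and there `N I` takes the value `1`.
      have e3 : N K₁ = N K₂ + (N K₁ (g (codim f J + 1)) - N K₂ (g (codim f J + 1))) • N I := by
        rw [← sub_eq_zero]
        refine hg I _ (Submodule.sub_mem _ hm1
          (Submodule.add_mem _ hm2 (Submodule.smul_mem _ _ n0.1))) fun j hj => ?_
        change j < codim f I at hj
        simp only [LinearMap.sub_apply, LinearMap.add_apply, LinearMap.smul_apply, smul_eq_mul]
        rcases lt_trichotomy j (codim f J) with h | rfl | h
        · rw [n1.2.1 j h, n2.2.1 j h, n0.2.1 j (by lia)]; ring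
        · rw [n1.2.2, n2.2.2, n0.2.1 _ (by lia)]; ring
        · obtain rfl : j = codim f J + 1 := by lia
          rw [n0.2.2]; ring
      set c := N K₁ (g (codim f J + 1)) - N K₂ (g (codim f J + 1)) with hcdef
      have e4 : N K₁ (P K₂ - P I) = c * N I (P K₂ - P I) := by
        conv_lhs => rw [e3]
        simp [v2]
      have e5 : N K₂ (P K₁ - P I) = -c * N I (P K₁ - P I) := by
        have : N K₂ = N K₁ - c • N I := by
          conv_rhs => rw [e3]
          simp
        rw [this]
        simp [v1]
      -- Both products are the sign of `c` times the signs of `N I` on the two displacements, but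
      -- `e5` carries an extra minus sign.
      rw [hsum, hε _ _ c1, hε _ _ c2, hε _ _ c1', hε _ _ c2', e1, e2, e4, e5]
      simp only [sign_mul, sign_pos hα, sign_pos hβ, Left.sign_neg, one_mul, SignType.coe_mul,
        SignType.coe_neg]
      ring
    · refine Finset.sum_eq_zero fun K _ => ?_
      by_cases h1 : cov I K
      · by_cases h2 : cov K J
        · exact absurd ⟨h1.1, h2.2.1, h2.2.2.1.trans h1.2.2.1, by
            have := h1.2.2.2; have := h2.2.2.2; lia⟩ hIJ
        · rw [hε0 K J h2, mul_zero]
      · rw [hε0 I K h1, zero_mul]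

end Arrangement

/-! ### Exactness of pieces of the cellular complex -/

section Arrangement

variable {V ν : Type*} [AddCommGroup V] [Module ℝ V] [Fintype ν]
  {f : ν → Module.Dual ℝ V} {d : ν → ℝ} {ε : Finset ν → Finset ν → ℤ}

/-- The cellular complex with incidence numbers `ε`, restricted to the faces in `X`, is exact. -/
def ExactOn (𝕜 : Type*) [Field 𝕜] (ε : Finset ν → Finset ν → ℤ) (X : Finset ν → Prop) : Prop :=
  ∀ c : Finset ν → 𝕜, (∀ I, c I ≠ 0 → X I) → (∀ J, X J → ∑ I, (ε I J : 𝕜) * c I = 0) →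
    ∃ b : Finset ν → 𝕜, (∀ I, b I ≠ 0 → X I) ∧ ∀ J, X J → ∑ I, (ε I J : 𝕜) * b I = c J

variable (f d) in
/-- The faces visible from `u`: those on which every constraint satisfied strictly at `u` is
strict and every constraint active at `u` is active. -/
def Visible (u : V) (I : Finset ν) : Prop :=
  IsFace f d I ∧ active f d u ⊆ I ∧ ∀ n ∈ I, d n ≤ f n u

/-- By `hYW` no incidence number leads from `Y` to `W`, so `Y` is a subcomplex of `X` with quotient
`W`, and an extension of exact complexes is exact. Convexity of `X` in the face order makes the
restricted differential square to zero. -/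
theorem ExactOn.union {𝕜 : Type*} [Field 𝕜] (hε : IsIncidence f d ε) {X Y W : Finset ν → Prop}
    (hX : ∀ I, X I ↔ Y I ∨ W I)
    (hconv : ∀ I J K, X I → IsFace f d K → X J → J ⊆ K → K ⊆ I → X K)
    (hYW : ∀ I J, Y I → W J → ¬ J ⊆ I)
    (hY : ExactOn 𝕜 ε Y) (hW : ExactOn 𝕜 ε W) : ExactOn 𝕜 ε X := by
  classical
  have h0 : ∀ I J, Y I → W J → ε I J = 0 := fun I J h h' => by
    by_contra hne
    exact hYW I J h h' (hε.of_ne_zero I J hne).2.2.1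
  intro c hc hdc
  obtain ⟨b, hb, hdb⟩ := hW (fun I => if W I then c I else 0) (fun I h => by
      by_contra h'; simp [h'] at h) (fun J hJ => by
      refine Eq.trans ?_ (hdc J ((hX J).2 (Or.inr hJ)))
      refine Finset.sum_congr rfl fun I _ => ?_
      by_cases hI : W I
      · rw [if_pos hI]
      · rw [if_neg hI, mul_zero]
        by_cases hcI : c I = 0
        · rw [hcI, mul_zero]
        · rw [h0 I J (((hX I).1 (hc I hcI)).resolve_right hI) hJ]; simp)
  have hbX : ∀ I, b I ≠ 0 → X I := fun I h => (hX I).2 (Or.inr (hb I h))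
  -- the boundary of `b` is a cycle
  have hdd : ∀ J, X J → ∑ K, (ε K J : 𝕜) * (if X K then ∑ I, (ε I K : 𝕜) * b I else 0) = 0 := by
    intro J hJ
    have h1 : ∀ K, (ε K J : 𝕜) * (if X K then ∑ I, (ε I K : 𝕜) * b I else 0) =
        ∑ I, (ε I K : 𝕜) * (ε K J : 𝕜) * b I := by
      intro K
      by_cases hK : X K
      · rw [if_pos hK, Finset.mul_sum]
        exact Finset.sum_congr rfl fun I _ => by ring
      · rw [if_neg hK, mul_zero]
        refine (Finset.sum_eq_zero fun I _ => ?_).symm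
        by_cases hbI : b I = 0
        · rw [hbI, mul_zero]
        by_cases h2 : ε I K = 0
        · simp [h2]
        by_cases h3 : ε K J = 0
        · simp [h3]
        obtain ⟨-, hK', hKI, -⟩ := hε.of_ne_zero I K h2
        exact absurd (hconv I J K (hbX I hbI) hK' hJ (hε.of_ne_zero K J h3).2.2.1 hKI) hK
    rw [Finset.sum_congr rfl fun K _ => h1 K, Finset.sum_comm]
    refine Finset.sum_eq_zero fun I _ => ?_
    rw [← Finset.sum_mul]
    have := hε.sum_mul I J
    have h2 : ∑ K, (ε I K : 𝕜) * (ε K J : 𝕜) = 0 := by exact_mod_cast congrArg (Int.cast (R := 𝕜)) this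
    rw [h2, zero_mul]
  have hYb : ∀ J, W J → ∑ I, (ε I J : 𝕜) * b I = c J := fun J hJ => by
    rw [hdb J hJ, if_pos hJ]
  obtain ⟨b', hb', hdb'⟩ := hY
    (fun J => if Y J then c J - ∑ I, (ε I J : 𝕜) * b I else 0) (fun I h => by
      by_contra h'; simp [h'] at h) (fun J hJ => by
      have hXJ : X J := (hX J).2 (Or.inl hJ)
      have e : ∀ K, (ε K J : 𝕜) * (if Y K then c K - ∑ I, (ε I K : 𝕜) * b I else 0) =
          (ε K J : 𝕜) * c K - (ε K J : 𝕜) * (if X K then ∑ I, (ε I K : 𝕜) * b I else 0) := by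
        intro K
        by_cases hK : Y K
        · rw [if_pos hK, if_pos ((hX K).2 (Or.inl hK))]; ring
        · rw [if_neg hK]
          by_cases hK' : W K
          · rw [if_pos ((hX K).2 (Or.inr hK')), hYb K hK']; ring
          · have hK2 : ¬ X K := fun h => ((hX K).1 h).elim hK hK'
            have hcK : c K = 0 := by
              by_contra h
              exact hK2 (hc K h)
            rw [if_neg hK2, hcK]; ring
      rw [Finset.sum_congr rfl fun K _ => e K, Finset.sum_sub_distrib, hdc J hXJ, hdd J hXJ,
        sub_zero])
  refine ⟨fun I => b I + b' I, fun I h => ?_, fun J hJ => ?_⟩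
  · rw [hX]
    by_contra! h'
    have h1 : b I = 0 := by
      by_contra h2; exact h'.2 (hb I h2)
    have h2 : b' I = 0 := by
      by_contra h2; exact h'.1 (hb' I h2)
    simp [h1, h2] at h
  · simp only [mul_add, Finset.sum_add_distrib]
    rcases (hX J).1 hJ with h | h
    · rw [hdb' J h, if_pos h]; ring
    · rw [hYb J h]
      have : ∑ I, (ε I J : 𝕜) * b' I = 0 := by
        refine Finset.sum_eq_zero fun I _ => ?_
        by_cases h2 : b' I = 0
        · rw [h2, mul_zero]
        · rw [h0 I J (hb' I h2) h]; simp
      rw [this, add_zero]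

/-- The complex is `𝕜 → 𝕜` with differential `±1`. -/
theorem ExactOn.of_pair {𝕜 : Type*} [Field 𝕜] (hε : IsIncidence f d ε) {I J : Finset ν}
    {X : Finset ν → Prop} (hX : ∀ K, X K ↔ K = I ∨ K = J) (hI : IsFace f d I) (hJ : IsFace f d J)
    (hJI : J ⊆ I) (hc : codim f I = codim f J + 1) : ExactOn 𝕜 ε X := by
  classical
  have hne : I ≠ J := fun h => by rw [h] at hc; lia
  have hself : ∀ K, ε K K = 0 := fun K => by
    by_contra h
    have := (hε.of_ne_zero K K h).2.2.2
    lia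
  have hsum : ∀ (b : Finset ν → 𝕜), (∀ K, b K ≠ 0 → X K) → ∀ K,
      ∑ I, (ε I K : 𝕜) * b I = (ε I K : 𝕜) * b I + (ε J K : 𝕜) * b J := by
    intro b hb K
    rw [← Finset.sum_pair (f := fun I => (ε I K : 𝕜) * b I) hne]
    refine (Finset.sum_subset (Finset.subset_univ _) fun L _ hL => ?_).symm
    have : b L = 0 := by
      by_contra h
      exact hL (by simpa using (hX L).1 (hb L h))
    rw [this, mul_zero]
  have hpm : (ε I J : 𝕜) * (ε I J : 𝕜) = 1 := by
    rcases hε.eq_or I J hI hJ hJI hc with h | h <;> rw [h] <;> simp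
  intro c hc' hdc
  have h1 := hdc J ((hX J).2 (Or.inr rfl))
  rw [hsum c hc', hself J] at h1
  simp only [Int.cast_zero, zero_mul, add_zero] at h1
  have h2 : c I = 0 := by
    calc c I = (ε I J : 𝕜) * ((ε I J : 𝕜) * c I) := by rw [← mul_assoc, hpm, one_mul]
      _ = 0 := by rw [h1, mul_zero]
  have hb : ∀ K, (if K = I then (ε I J : 𝕜) * c J else 0) ≠ 0 → X K := fun K h => by
    by_contra h'
    rw [hX] at h'
    rw [if_neg fun h => h' (Or.inl h)] at h
    exact h rfl
  refine ⟨_, hb, fun K hK => ?_⟩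
  rw [hsum _ hb, if_pos rfl, if_neg hne.symm, mul_zero, add_zero]
  rcases (hX K).1 hK with rfl | rfl
  · rw [hself, h2]; simp
  · rw [← mul_assoc, hpm, one_mul]

end Arrangement

/-! ### The faces visible from an outside point -/

section Arrangement

variable {V ν : Type*} [AddCommGroup V] [Module ℝ V] [Fintype ν]
  {f : ν → Module.Dual ℝ V} {d : ν → ℝ} {ε : Finset ν → Finset ν → ℤ}

/-- If some face is visible from `u`, so is the face of a point `z` of the region at which
exactly the constraints active at `u` are active. -/
theorem exists_inRegion_active_eq {u : V} {I : Finset ν}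
    (hI : Visible f d u I) : ∃ z, InRegion f d z ∧ active f d z = active f d u := by
  obtain ⟨⟨x, hx, rfl⟩, hsub, hle⟩ := hI
  -- Moving from `x` straight away from `u` loosens every active constraint violated at `u`, and
  -- keeps tight the ones that are tight at `u`.
  obtain ⟨η, hη, h1, h2, -⟩ := exists_mem_region (fun n => (hx n).1) (x - u)
  have heq : ∀ n, f n u = d n → f n (x + η • (x - u)) = d n := by
    intro n hn
    have := hsub (mem_active.2 hn)
    rw [mem_active] at this
    rw [map_add, map_smul, map_sub, this, hn]; simp
  have hlt : ∀ n, f n u ≠ d n → f n (x + η • (x - u)) < d n := by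
    intro n hn
    by_cases hxn : f n x = d n
    · have := lt_of_le_of_ne (hle n (mem_active.2 hxn)) (Ne.symm hn)
      rw [map_add, map_smul, map_sub, hxn, smul_eq_mul]
      nlinarith
    · exact h2 n (lt_of_le_of_ne (hx n).2 hxn)
  refine ⟨x + η • (x - u), fun n => ⟨h1 n, ?_⟩, ?_⟩
  · by_cases hn : f n u = d n
    · exact (heq n hn).le
    · exact (hlt n hn).le
  · ext n
    rw [mem_active, mem_active]
    exact ⟨fun h => by_contra fun hn => (hlt n hn).ne h, heq n⟩

/-- Moving `u` slightly makes the crossing times of the segment from `z` to `u` distinct, except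
for functionals that are proportional along the constraints active at `u`. -/
theorem exists_generic_perturbation [FiniteDimensional ℝ V] {u z : V}
    (hu : ∀ n, d n - 1 < f n u) :
    ∃ u', (∀ n, d n - 1 < f n u') ∧ active f d u' = active f d u ∧
      (∀ n, f n u < d n → f n u' < d n) ∧ (∀ n, d n < f n u → d n < f n u') ∧
      ∀ n m, ((d n - f n z) • f m - (d m - f m z) • f n) (u' - z) = 0 →
        (d n - f n z) • f m - (d m - f m z) • f n ∈ conormal f (active f d u) := by
  classical
  -- `G (n, m)` vanishes at `u' - z` when the hyperplanes of `n` and `m` are met at the same time on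
  -- the segment from `z` to `u'`, as one sees by cross-multiplying the two crossing times.
  let G (p : ν × ν) : Module.Dual ℝ V := (d p.1 - f p.1 z) • f p.2 - (d p.2 - f p.2 z) • f p.1
  obtain ⟨w, hw, hwG⟩ : ∃ w, (∀ n ∈ active f d u, f n w = 0) ∧
      ∀ p, G p ∉ conormal f (active f d u) → G p w ≠ 0 := by
    obtain ⟨w, hw, hw'⟩ := Module.Dual.exists_forall_mem_ne_zero_of_forall_exists
      (conormal f (active f d u)).dualCoannihilator
      (fun p : {p // G p ∉ conormal f (active f d u)} => G p) (fun p => by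
        obtain ⟨x, hx, hx'⟩ := exists_apply_ne_zero_of_notMem _ p.2
        exact ⟨x, (Submodule.mem_dualCoannihilator x).2 hx, hx'⟩)
    exact ⟨w, fun n hn => (Submodule.mem_dualCoannihilator w).1 hw _ (mem_conormal hn),
      fun p hp => hw' ⟨p, hp⟩⟩
  have hev : ∀ p, ∀ᶠ δ : ℝ in nhdsWithin 0 (Set.Ioi 0),
      G p (u + δ • w - z) = 0 → G p ∈ conormal f (active f d u) := by
    intro p
    by_cases hp : G p ∈ conormal f (active f d u)
    · exact Filter.Eventually.of_forall fun _ _ => hp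
    -- Along `w` the value of `G p` is an affine function of `δ` with non-zero slope, so a single
    -- `δ` has to be avoided.
    · have hne := hwG p hp
      have hfin : ∀ᶠ δ : ℝ in nhdsWithin 0 (Set.Ioi 0), δ ≠ -(G p (u - z)) / G p w := by
        by_cases h0 : -(G p (u - z)) / G p w = 0
        · rw [h0]
          filter_upwards [self_mem_nhdsWithin] with δ hδ using (ne_of_gt hδ)
        · exact nhdsWithin_le_nhds (isOpen_ne.mem_nhds (Ne.symm h0))
      filter_upwards [hfin] with δ hδ h
      exfalso
      apply hδ
      rw [eq_div_iff hne]
      have : u + δ • w - z = (u - z) + δ • w := by abel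
      rw [this, map_add, map_smul, smul_eq_mul] at h
      linarith
  obtain ⟨δ, ⟨-, h1, h2, h3⟩, h4⟩ :=
    ((eventually_mem_region hu w).and (Filter.eventually_all.2 hev)).exists
  refine ⟨u + δ • w, h1, ?_, h2, h3, fun n m => h4 (n, m)⟩
  ext n
  rw [mem_active, mem_active]
  constructor
  · intro h
    rcases lt_trichotomy (f n u) (d n) with h' | h' | h'
    · exact absurd h (h2 n h').ne
    · exact h'
    · exact absurd h (h3 n h').ne'
  · intro h
    rw [map_add, map_smul, h, hw n (mem_active.2 h)]; simp

/-- Travelling from `z` to `u`, let `q` be the last point at which a constraint `n₀` becomes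
violated, and `p` a point just before it. By genericity, the other violated constraints met at `q`
are tight on a face visible from `u` exactly when `n₀` is. So the visible faces split into those
with `n₀` active, seen from `q`, and those without, seen from `p`; both points violate fewer
constraints than `u`. -/
theorem exactOn_visible_of_generic [FiniteDimensional ℝ V] (𝕜 : Type*) [Field 𝕜]
    (hε : IsIncidence f d ε) (u z : V) (hu : ∀ n, d n - 1 < f n u) (hpos : ∃ n, d n < f n u)
    (hz : InRegion f d z) (hzu : active f d z = active f d u)
    (hgen : ∀ n m, ((d n - f n z) • f m - (d m - f m z) • f n) (u - z) = 0 →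
        (d n - f n z) • f m - (d m - f m z) • f n ∈ conormal f (active f d u))
    (ih : ∀ u', (∀ n, d n - 1 < f n u') → (∃ n, d n < f n u') →
      (∀ n, d n < f n u' → d n < f n u) → (∃ n, d n < f n u ∧ f n u' ≤ d n) →
      ExactOn 𝕜 ε (Visible f d u')) : ExactOn 𝕜 ε (Visible f d u) := by
  classical
  have hzlt : ∀ n, f n u ≠ d n → f n z < d n := by
    intro n hn
    refine lt_of_le_of_ne (hz n).2 fun h => hn ?_
    rwa [← mem_active, ← hzu, mem_active]
  have hzeq : ∀ n, f n u = d n → f n z = d n := by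
    intro n hn
    rwa [← mem_active, hzu, mem_active]
  -- the last crossing
  obtain ⟨n₀, hn₀, hmax⟩ := Finset.exists_max_image
    (Finset.univ.filter fun n => d n < f n u) (fun n => (d n - f n z) / (f n u - f n z))
    (hpos.imp fun n hn => by simpa using hn)
  simp only [Finset.mem_filter, Finset.mem_univ, true_and] at hn₀ hmax
  have hz₀ := hzlt n₀ hn₀.ne'
  set t := (d n₀ - f n₀ z) / (f n₀ u - f n₀ z) with ht
  have ht0 : 0 < t := div_pos (by linarith) (by linarith)
  have ht1 : t < 1 := by rw [ht, div_lt_one (by linarith)]; linarith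
  have htn₀ : t * (f n₀ u - f n₀ z) = d n₀ - f n₀ z := by
    rw [ht, div_mul_cancel₀]
    exact (by linarith : 0 < f n₀ u - f n₀ z).ne'
  set q := z + t • (u - z) with hq
  have hfq : ∀ n, f n q = f n z + t * (f n u - f n z) := by
    intro n; simp [hq]
  have hqn₀ : f n₀ q = d n₀ := by rw [hfq, htn₀]; ring
  have hqK : ∀ n, d n < f n u → d n ≤ f n q := by
    intro n hn
    have h1 := hmax n hn
    have h2 := hzlt n hn.ne'
    rw [div_le_iff₀ (by linarith)] at h1
    rw [hfq]; linarith
  have hqJ : ∀ n, f n u < d n → f n q < d n := by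
    intro n hn
    have h2 := hzlt n hn.ne
    rw [hfq]; nlinarith
  have hqZ : ∀ n, f n u = d n → f n q = d n := by
    intro n hn
    rw [hfq, hzeq n hn, hn]; ring
  have hqlow : ∀ n, d n - 1 < f n q := by
    intro n
    have h1 := hu n
    have h2 := (hz n).1
    rw [hfq]; nlinarith
  have hcase : ∀ n, f n q = d n → d n ≤ f n u := by
    intro n hn
    by_contra! h
    exact (hqJ n h).ne hn
  -- functionals vanishing at the last crossing are proportional to the one of `n₀`
  have hprop : ∀ n, d n < f n u → f n q = d n → ∀ x, (∀ m ∈ active f d u, f m x = d m) →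
      (d n₀ - f n₀ z) * (f n x - d n) = (d n - f n z) * (f n₀ x - d n₀) := by
    intro n hn hnq x hx
    have h1 := hgen n₀ n (by
      rw [hfq] at hnq
      have h2 : f n u - f n z = (d n - f n z) / t := by
        rw [eq_div_iff ht0.ne']; linarith
      have h3 : f n₀ u - f n₀ z = (d n₀ - f n₀ z) / t := by
        rw [eq_div_iff ht0.ne']; linarith
      rw [LinearMap.sub_apply, LinearMap.smul_apply, LinearMap.smul_apply, map_sub, map_sub, h2, h3,
        smul_eq_mul, smul_eq_mul]
      ring)
    have h2 := conormal_apply_eq_zero (x := x - z) (fun m hm => by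
      rw [map_sub, hx m hm]
      rw [← hzu, mem_active] at hm
      rw [hm, sub_self]) h1
    simp only [LinearMap.sub_apply, LinearMap.smul_apply, map_sub, smul_eq_mul] at h2
    linarith
  -- a point just before the last crossing
  obtain ⟨η, hη, hl, hlt, hgt⟩ := exists_mem_region hqlow (z - u)
  set p := q + η • (z - u) with hp
  have hfp : ∀ n, f n p = f n q - η * (f n u - f n z) := by
    intro n; simp only [hp, map_add, map_smul, map_sub, smul_eq_mul]; ring
  have hpZ : ∀ n, f n u = d n → f n p = d n := by
    intro n hn
    rw [hfp, hqZ n hn, hzeq n hn, hn]; ring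
  have hpK₀ : ∀ n, d n < f n u → f n q = d n → f n p < d n := by
    intro n hn hnq
    have h2 := hzlt n hn.ne'
    rw [hfp, hnq]
    nlinarith
  have hactp : active f d p = active f d u := by
    ext n
    rw [mem_active, mem_active]
    refine ⟨fun h => ?_, hpZ n⟩
    rcases lt_trichotomy (f n u) (d n) with h' | h' | h'
    · exact absurd h (hlt n (hqJ n h')).ne
    · exact h'
    · rcases (hqK n h').eq_or_lt with h'' | h''
      · exact absurd h (hpK₀ n h' h''.symm).ne
      · exact absurd h (hgt n h'').ne'
  have hpge : ∀ n, d n ≤ f n p ↔ d n ≤ f n u ∧ ¬ (d n < f n u ∧ f n q = d n) := by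
    intro n
    constructor
    · intro h
      constructor
      · by_contra! h'
        exact (hlt n (hqJ n h')).not_ge h
      · rintro ⟨h1, h2⟩
        exact (hpK₀ n h1 h2).not_ge h
    · rintro ⟨h1, h2⟩
      rcases h1.eq_or_lt with h3 | h3
      · exact (hpZ n h3.symm).ge
      · exact (hgt n (lt_of_le_of_ne (hqK n h3) fun h => h2 ⟨h3, h.symm⟩)).le
  -- the visible faces are split according to whether `n₀` is active
  have hsplit : ∀ I, Visible f d u I ↔ Visible f d p I ∨ Visible f d q I := by
    intro I
    constructor
    · rintro ⟨hI, hsub, hle⟩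
      have hx : ∃ x, InRegion f d x ∧ active f d x = I := hI
      obtain ⟨x, hx, rfl⟩ := hx
      have hxu : ∀ m ∈ active f d u, f m x = d m := fun m hm => mem_active.1 (hsub hm)
      by_cases hn₀I : f n₀ x = d n₀
      · refine Or.inr ⟨hI, fun n hn => ?_, fun n hn => ?_⟩
        · rw [mem_active] at hn ⊢
          rcases (hcase n hn).eq_or_lt with h | h
          · exact hxu n (mem_active.2 h.symm)
          · have := hprop n h hn x hxu
            rw [hn₀I, sub_self, mul_zero, mul_eq_zero] at this
            exact sub_eq_zero.1 (this.resolve_left (by linarith : 0 < d n₀ - f n₀ z).ne')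
        · rcases (hle n hn).eq_or_lt with h | h
          · exact (hqZ n h.symm).ge
          · exact hqK n h
      · refine Or.inl ⟨hI, hactp ▸ hsub, fun n hn => (hpge n).2 ⟨hle n hn, fun h => hn₀I ?_⟩⟩
        have := hprop n h.1 h.2 x hxu
        rw [mem_active.1 hn, sub_self, mul_zero, eq_comm, mul_eq_zero] at this
        have h2 := hzlt n h.1.ne'
        exact sub_eq_zero.1 (this.resolve_left (by linarith : 0 < d n - f n z).ne')
    · rintro (⟨hI, hsub, hle⟩ | ⟨hI, hsub, hle⟩)
      · exact ⟨hI, hactp ▸ hsub, fun n hn => ((hpge n).1 (hle n hn)).1⟩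
      · refine ⟨hI, fun n hn => hsub ?_, fun n hn => ?_⟩
        · rw [mem_active] at hn ⊢
          exact hqZ n hn
        · by_contra! h
          exact (hle n hn).not_gt (hqJ n h)
  have hpq : ∀ I J, Visible f d p I → Visible f d q J → ¬ J ⊆ I := by
    intro I J hI hJ hJI
    have := hI.2.2 n₀ (hJI (hJ.2.1 (mem_active.2 hqn₀)))
    exact (hpK₀ n₀ hn₀ hqn₀).not_ge this
  -- If `q` is still outside the region, induction handles both pieces. Otherwise `q` lies in the
  -- region, each piece is a single face, and the two faces form a covering pair.
  by_cases hK : ∃ n, d n < f n q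
  · have hsame : ∀ n, d n < f n q → d n < f n u := by
      intro n hn
      by_contra! h
      rcases h.eq_or_lt with h | h
      · exact hn.ne' (hqZ n h)
      · exact hn.not_gt (hqJ n h)
    refine ExactOn.union hε hsplit ?_ hpq ?_ ?_
    · intro I J K hI hK' hJ hJK hKI
      exact ⟨hK', hJ.2.1.trans hJK, fun n hn => hI.2.2 n (hKI hn)⟩
    · refine ih p hl (hK.imp fun n hn => hgt n hn) (fun n hn => ?_)
        ⟨n₀, hn₀, (hpK₀ n₀ hn₀ hqn₀).le⟩
      refine lt_of_le_of_ne ((hpge n).1 hn.le).1 fun h => ?_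
      exact hn.ne' (hpZ n h.symm)
    · exact ih q hqlow hK hsame ⟨n₀, hn₀, hqn₀.le⟩
  · push Not at hK
    have hqface : IsFace f d (active f d q) := ⟨q, fun n => ⟨hqlow n, hK n⟩, rfl⟩
    have hsub : active f d z ⊆ active f d q := by
      intro n hn
      rw [hzu, mem_active] at hn
      exact mem_active.2 (hqZ n hn)
    refine ExactOn.of_pair hε (I := active f d q) (J := active f d z) (fun K => ?_) hqface
      ⟨z, hz, rfl⟩ hsub ?_
    · rw [hsplit, or_comm]
      refine or_congr ⟨?_, ?_⟩ ⟨?_, ?_⟩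
      · rintro ⟨-, h1, h2⟩
        exact Finset.Subset.antisymm
          (fun n hn => mem_active.2 (le_antisymm (hK n) (h2 n hn))) h1
      · rintro rfl
        exact ⟨hqface, subset_rfl, fun n hn => (mem_active.1 hn).ge⟩
      · rintro ⟨-, h1, h2⟩
        rw [hzu, ← hactp]
        refine Finset.Subset.antisymm (fun n hn => mem_active.2 (le_antisymm ?_ (h2 n hn))) h1
        have h3 := (hpge n).1 (h2 n hn)
        rcases h3.1.eq_or_lt with h4 | h4
        · exact (hpZ n h4.symm).le
        · exact absurd ⟨h4, le_antisymm (hK n) (hqK n h4)⟩ h3.2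
      · rintro rfl
        refine ⟨⟨z, hz, rfl⟩, by rw [hactp, hzu], fun n hn => ?_⟩
        rw [hzu, mem_active] at hn
        exact (hpZ n hn).ge
    -- Modulo the constraints active at `z`, all those active at `q` are multiples of `f n₀`, which
    -- is itself non-zero there because it changes between `z` and `q`.
    · apply le_antisymm
      · have hle : conormal f (active f d q) ≤
            conormal f (active f d z) ⊔ Submodule.span ℝ {f n₀} := by
          refine Submodule.span_le.2 ?_
          rintro _ ⟨n, hn, rfl⟩
          rw [Finset.mem_coe, mem_active] at hn
          by_contra hnot
          obtain ⟨x, hx, hx'⟩ := exists_apply_ne_zero_of_notMem _ hnot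
          rcases (hcase n hn).eq_or_lt with h | h
          · refine hx' (hx _ (Submodule.mem_sup_left (mem_conormal ?_)))
            rw [hzu, mem_active, h]
          · have h1 := hprop n h hn (x + q) (fun m hm => by
              have h3 : f m x = 0 := hx _ (Submodule.mem_sup_left (mem_conormal (hzu ▸ hm)))
              rw [map_add, h3, hqZ m (mem_active.1 hm), zero_add])
            have h2 : f n₀ x = 0 :=
              hx _ (Submodule.mem_sup_right (Submodule.mem_span_singleton_self _))
            rw [(f n).map_add x q, (f n₀).map_add x q, h2, hqn₀, hn] at h1
            have h4 : (d n₀ - f n₀ z) * f n x = 0 := by linarith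
            exact hx' ((mul_eq_zero.1 h4).resolve_left (by linarith : 0 < d n₀ - f n₀ z).ne')
        have h1 := Submodule.finrank_mono hle
        have h2 := Submodule.finrank_add_le_finrank_add_finrank (conormal f (active f d z))
          (Submodule.span ℝ {f n₀})
        have h3 : Module.finrank ℝ (Submodule.span ℝ {f n₀}) ≤ 1 :=
          (finrank_span_le_card _).trans (by simp)
        change Module.finrank ℝ _ ≤ Module.finrank ℝ _ + 1
        lia
      · refine codim_lt_of_not_mem hsub (mem_conormal (mem_active.2 hqn₀)) fun h => ?_
        have := conormal_apply_eq_zero (x := q - z) (fun n hn => by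
          have h1 := hsub hn
          rw [mem_active] at hn h1
          rw [map_sub, hn, h1, sub_self]) h
        rw [map_sub, hqn₀] at this
        linarith

/-- The cellular complex of the faces visible from a point outside of the region is exact. -/
theorem exactOn_visible [FiniteDimensional ℝ V] (𝕜 : Type*) [Field 𝕜] (hε : IsIncidence f d ε) (u : V)
    (hu : ∀ n, d n - 1 < f n u) (hpos : ∃ n, d n < f n u) : ExactOn 𝕜 ε (Visible f d u) := by
  classical
  -- The induction is on the number of constraints violated at `u`.
  induction hk : (Finset.univ.filter fun n => d n < f n u).card using Nat.strong_induction_on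
    generalizing u with
  | _ k ih =>
  by_cases hX : ∃ I, Visible f d u I
  swap
  · intro c hc _
    have h0 : ∀ I, c I = 0 := fun I => by
      by_contra h; exact hX ⟨I, hc I h⟩
    exact ⟨0, fun I h => absurd rfl h, fun J _ => by simp [h0 J]⟩
  obtain ⟨I₀, hI₀⟩ := hX
  obtain ⟨z, hz, hzu⟩ := exists_inRegion_active_eq hI₀
  -- Visibility depends only on the signs of `f n u - d n`, and the perturbation preserves all of
  -- them.
  obtain ⟨u', hu', hact, hlt', hgt', hgen⟩ := exists_generic_perturbation (z := z) hu
  have heq' : ∀ n, f n u' = d n ↔ f n u = d n := fun n => by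
    rw [← mem_active, ← mem_active, hact]
  have hgt : ∀ n, d n < f n u' ↔ d n < f n u := fun n =>
    ⟨fun h => by
      rcases lt_trichotomy (f n u) (d n) with h' | h' | h'
      · exact absurd h (hlt' n h').not_gt
      · exact absurd h ((heq' n).2 h').le.not_gt
      · exact h', hgt' n⟩
  have hvis : ∀ I, Visible f d u I ↔ Visible f d u' I := by
    intro I
    unfold Visible
    rw [hact]
    refine and_congr_right fun _ => and_congr_right fun _ => forall₂_congr fun n _ => ?_
    rw [le_iff_lt_or_eq, le_iff_lt_or_eq, hgt, eq_comm, ← heq', eq_comm (a := d n)]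
  have hvis' : Visible f d u = Visible f d u' := funext fun I => propext (hvis I)
  rw [hvis']
  have hpos' : ∃ n, d n < f n u' := hpos.imp fun n hn => hgt' n hn
  have hk' : (Finset.univ.filter fun n => d n < f n u').card = k := by
    rw [← hk]; congr 1; ext n; simp [hgt]
  rw [← hact] at hzu hgen
  refine exactOn_visible_of_generic 𝕜 hε u' z hu' hpos' hz hzu hgen fun p hp hp' hsub hne => ?_
  refine ih _ ?_ p hp hp' rfl
  rw [← hk']
  refine Finset.card_lt_card ⟨fun n hn => ?_, fun h => ?_⟩
  · simp only [Finset.mem_filter, Finset.mem_univ, true_and] at hn ⊢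
    exact hsub n hn
  · obtain ⟨n, h1, h2⟩ := hne
    have := h (Finset.mem_filter.2 ⟨Finset.mem_univ n, h1⟩)
    simp only [Finset.mem_filter, Finset.mem_univ, true_and] at this
    exact this.not_ge h2

end Arrangement

/-! ### Farkas' lemma and rational functionals -/

section Polyhedral

/-- **Farkas' lemma** for finitely generated cones. -/
theorem exists_dual_neg_of_notMem_hull {V : Type*} [AddCommGroup V] [Module ℝ V] (s : Finset V)
    (x : V) (hx : x ∉ PointedCone.hull ℝ (s : Set V)) :
    ∃ n : Module.Dual ℝ V, (∀ y ∈ s, 0 ≤ n y) ∧ n x < 0 := by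
  classical
  obtain ⟨k, hk⟩ : ∃ k, s.card ≤ k := ⟨_, le_rfl⟩
  induction k generalizing s x with
  | zero =>
    rw [Nat.le_zero, Finset.card_eq_zero] at hk
    subst hk
    have hx0 : x ≠ 0 := fun h => hx (h ▸ zero_mem _)
    obtain ⟨n, hn⟩ := Module.exists_dual_forall_apply_ne_zero (K := ℝ) (fun _ : Unit => x)
      fun _ => hx0
    rcases lt_or_gt_of_ne (hn ()) with h | h
    · exact ⟨n, by simp, h⟩
    · exact ⟨-n, by simp, by simpa using h⟩
  | succ k ih =>
    rcases hk.lt_or_eq with hk | hk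
    · exact ih s x hx (by lia)
    obtain ⟨a, s', ha, rfl, hk'⟩ := Finset.card_eq_succ.1 hk
    have hmono : PointedCone.hull ℝ (s' : Set V) ≤ PointedCone.hull ℝ (insert a s' : Set V) :=
      Submodule.span_mono (Set.subset_insert _ _)
    have haC : a ∈ PointedCone.hull ℝ (insert a s' : Set V) :=
      Submodule.subset_span (Set.mem_insert _ _)
    rw [Finset.coe_insert] at hx
    obtain ⟨n, hn, hnx⟩ := ih s' x (fun h => hx (hmono h)) hk'.le
    rcases le_or_gt 0 (n a) with hna | hna
    · refine ⟨n, fun y hy => ?_, hnx⟩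
      rcases Finset.mem_insert.1 hy with rfl | hy
      exacts [hna, hn y hy]
    -- The projection along `a` onto the kernel of `n`. It stays inside the cone on the generators,
    -- and since it moves `x` by a multiple of `a` with the right sign, it keeps `x` outside. A
    -- functional found after projecting kills `a`.
    · let π : V →ₗ[ℝ] V := LinearMap.id - (LinearMap.toSpanSingleton ℝ V ((n a)⁻¹ • a)).comp n
      have hπ : ∀ y, π y = y - (n y * (n a)⁻¹) • a := fun y => by
        simp [π, smul_smul]
      have hπa : π a = 0 := by rw [hπ, mul_inv_cancel₀ hna.ne, one_smul, sub_self]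
      have hadd : ∀ y ∈ PointedCone.hull ℝ (insert a s' : Set V), ∀ r : ℝ, 0 ≤ r →
          y + r • a ∈ PointedCone.hull ℝ (insert a s' : Set V) := fun y hy r hr =>
        add_mem hy (Submodule.smul_mem _ (⟨r, hr⟩ : {c : ℝ // 0 ≤ c}) haC)
      have hsub : PointedCone.hull ℝ ((s'.image π : Finset V) : Set V) ≤
          PointedCone.hull ℝ (insert a s' : Set V) := by
        refine Submodule.span_le.2 ?_
        intro y hy
        rw [Finset.mem_coe, Finset.mem_image] at hy
        obtain ⟨z, hz, rfl⟩ := hy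
        rw [hπ, sub_eq_add_neg, ← neg_smul]
        exact hadd z (hmono (Submodule.subset_span hz)) _
          (neg_nonneg.2 (mul_nonpos_of_nonneg_of_nonpos (hn z hz) (inv_nonpos.2 hna.le)))
      have hx' : π x ∉ PointedCone.hull ℝ ((s'.image π : Finset V) : Set V) := by
        intro h
        have := hadd _ (hsub h) (n x * (n a)⁻¹)
          (mul_nonneg_of_nonpos_of_nonpos hnx.le (inv_nonpos.2 hna.le))
        rw [hπ, sub_add_cancel] at this
        exact hx this
      obtain ⟨t, h1, h2⟩ := ih _ _ hx' (Finset.card_image_le.trans hk'.le)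
      refine ⟨t.comp π, fun y hy => ?_, h2⟩
      rcases Finset.mem_insert.1 hy with rfl | hy
      · simp [hπa]
      · exact h1 _ (Finset.mem_image_of_mem _ hy)

variable {V : Type v} [NormedAddCommGroup V] [NormedSpace ℝ V] {L : Submodule ℤ V}
  {C : PointedCone ℝ V}

theorem eq_zero_of_forall_mem_lattice [DiscreteTopology L] [IsZLattice ℝ L] {n : Module.Dual ℝ V}
    (h : ∀ l ∈ L, n l = 0) : n = 0 := by
  refine LinearMap.ext fun x => ?_
  have hx : x ∈ Submodule.span ℝ (L : Set V) := by
    rw [IsZLattice.span_top]; trivial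
  induction hx using Submodule.span_induction with
  | mem y hy => exact h y hy
  | zero => simp
  | add y z _ _ hy hz => simp [hy, hz]
  | smul a y _ hy => simp [hy]

/-- A non-zero integral functional is a positive integer multiple of one taking the value `1`. -/
theorem exists_nat_of_isIntegral [DiscreteTopology L] [IsZLattice ℝ L] {n : Module.Dual ℝ V} (hn : IsIntegral L n)
    (h0 : n ≠ 0) : ∃ g : ℕ, 0 < g ∧ (∃ l ∈ L, n l = g) ∧ IsIntegral L ((g : ℝ)⁻¹ • n) := by
  choose! z hz using hn
  let φ : L →+ ℤ :=
    { toFun := fun l => z l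
      map_zero' := by
        have := hz 0 L.zero_mem
        rw [map_zero] at this
        exact_mod_cast this.symm
      map_add' := fun a b => by
        have h1 := hz _ (L.add_mem a.2 b.2)
        rw [map_add, hz _ a.2, hz _ b.2] at h1
        exact_mod_cast h1.symm }
  -- The values on the lattice form a subgroup `aℤ`; the required integer is `|a|`.
  obtain ⟨a, ha⟩ := Int.subgroup_cyclic φ.range
  rw [← AddSubgroup.zmultiples_eq_closure] at ha
  have hmem : ∀ l (hl : l ∈ L), ∃ k : ℤ, z l = k * a := by
    intro l hl
    have : φ ⟨l, hl⟩ ∈ φ.range := ⟨_, rfl⟩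
    rw [ha, AddSubgroup.mem_zmultiples_iff] at this
    obtain ⟨k, hk⟩ := this
    exact ⟨k, by rw [← smul_eq_mul, hk]; rfl⟩
  have ha0 : a ≠ 0 := by
    rintro rfl
    apply h0
    refine eq_zero_of_forall_mem_lattice (L := L) fun l hl => ?_
    obtain ⟨k, hk⟩ := hmem l hl
    rw [hz l hl, hk]; simp
  refine ⟨a.natAbs, Int.natAbs_pos.2 ha0, ?_, fun l hl => ?_⟩
  · have : (a.natAbs : ℤ) ∈ φ.range := by
      rw [ha, AddSubgroup.mem_zmultiples_iff]
      rcases Int.natAbs_eq a with h | h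
      · exact ⟨1, by rw [one_smul]; exact h⟩
      · exact ⟨-1, by rw [neg_smul, one_smul]; lia⟩
    obtain ⟨l, hl⟩ := this
    refine ⟨l, l.2, ?_⟩
    rw [hz l l.2, show z l = (a.natAbs : ℤ) from hl, Int.cast_natCast]
  · obtain ⟨k, hk⟩ := hmem l hl
    have h1 : (a.natAbs : ℝ) ≠ 0 := by simpa using ha0
    rw [LinearMap.smul_apply, hz l hl, hk, smul_eq_mul]
    rcases Int.natAbs_eq a with h | h
    · refine ⟨k, ?_⟩
      have h2 : (a : ℝ) = (a.natAbs : ℝ) :=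
        (congrArg (Int.cast (R := ℝ)) h).trans (Int.cast_natCast _)
      push_cast
      rw [← h2] at h1 ⊢
      field_simp
    · refine ⟨-k, ?_⟩
      have h2 : (a : ℝ) = -(a.natAbs : ℝ) :=
        (congrArg (Int.cast (R := ℝ)) h).trans (by rw [Int.cast_neg, Int.cast_natCast])
      push_cast
      rw [h2]
      field_simp

/-- If the values on the lattice generated `gℤ` with `g > 1`, then `n / g` would be integral,
contradicting primitivity. -/
theorem exists_apply_eq_one [DiscreteTopology L] [IsZLattice ℝ L] {n : Module.Dual ℝ V}
    (hn : n ∈ primitiveNormals L C) : ∃ l ∈ L, n l = 1 := by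
  obtain ⟨-, h0, hint, hprim, -⟩ := hn
  obtain ⟨g, hg, ⟨l, hl, hlg⟩, hgi⟩ := exists_nat_of_isIntegral hint h0
  have : g = 1 := by
    by_contra h1
    have h2 : (1 : ℝ) < g := by exact_mod_cast (by lia : 1 < g)
    exact hprim _ (by positivity) (inv_lt_one_of_one_lt₀ h2) hgi
  exact ⟨l, hl, by rw [hlg, this]; simp⟩

variable [FiniteDimensional ℝ V] [DiscreteTopology L] [IsZLattice ℝ L]

/-- A functional determined up to scaling by lattice vectors on which it vanishes is rational. -/
theorem exists_isIntegral_smul {n : Module.Dual ℝ V} (h0 : n ≠ 0) (Z : Set V) (hZ : Z ⊆ L)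
    (hn : ∀ x ∈ Z, n x = 0)
    (huniq : ∀ g : Module.Dual ℝ V, (∀ x ∈ Z, g x = 0) → ∃ t : ℝ, g = t • n) :
    ∃ t : ℝ, 0 < t ∧ IsIntegral L (t • n) := by
  classical
  have : Module.Free ℤ L := ZLattice.module_free ℝ L
  have : Module.Finite ℤ L := ZLattice.module_finite ℝ L
  let b := Module.Free.chooseBasis ℤ L
  let B : Module.Basis (Module.Free.ChooseBasisIndex ℤ L) ℝ V := b.ofZLatticeBasis ℝ L
  have hB : ∀ i, B i = b i := fun i => Module.Basis.ofZLatticeBasis_apply ℝ L b i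
  obtain ⟨i₀, hi₀⟩ : ∃ i, n (b i) ≠ 0 := by
    by_contra! h
    exact h0 (B.ext fun i => by rw [hB, h i]; rfl)
  -- Composing `n` with a `ℚ`-linear map `θ : ℝ → ℚ` gives a functional with rational values on the
  -- lattice that still kills `Z`. By uniqueness it is a multiple of `n`, non-zero because of `b
  -- i₀`.
  obtain ⟨θ, hθ⟩ := Module.exists_dual_forall_apply_ne_zero (K := ℚ)
    (fun _ : Unit => n (b i₀)) fun _ => hi₀
  specialize hθ ()
  let g : Module.Dual ℝ V := B.constr ℝ fun i => (θ (n (b i)) : ℝ)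
  have hg : ∀ l (hl : l ∈ L), g l = (θ (n l) : ℝ) := by
    intro l hl
    have h1 := b.sum_repr ⟨l, hl⟩
    have h2 : l = ∑ i, (b.repr ⟨l, hl⟩ i) • (b i : V) := by
      have h3 := congrArg ((↑) : L → V) h1
      rw [AddSubmonoidClass.coe_finsetSum] at h3
      exact h3.symm
    rw [h2, map_sum, map_sum, map_sum, Rat.cast_sum]
    refine Finset.sum_congr rfl fun i _ => ?_
    have h3 : g (b i) = (θ (n (b i)) : ℝ) := by
      rw [← B.constr_basis ℝ (fun i => (θ (n (b i)) : ℝ)) i, hB]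
    rw [map_zsmul, map_zsmul, map_zsmul, h3]
    simp
  obtain ⟨t, ht⟩ := huniq g fun x hx => by rw [hg x (hZ hx), hn x hx]; simp
  have ht0 : t ≠ 0 := by
    rintro rfl
    have := hg (b i₀) (b i₀).2
    rw [ht, zero_smul, LinearMap.zero_apply] at this
    exact hθ (by exact_mod_cast this.symm)
  -- clear denominators
  obtain ⟨D, hD⟩ := IsLocalization.exist_integer_multiples (nonZeroDivisors ℤ) Finset.univ
    fun i => θ (n (b i))
  have hD0 : (D : ℤ) ≠ 0 := nonZeroDivisors.ne_zero D.2
  have hint : IsIntegral L (((D : ℤ) : ℝ) • g) := by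
    intro l hl
    have h1 := b.sum_repr ⟨l, hl⟩
    have h2 : l = ∑ i, (b.repr ⟨l, hl⟩ i) • (b i : V) := by
      have h3 := congrArg ((↑) : L → V) h1
      rw [AddSubmonoidClass.coe_finsetSum] at h3
      exact h3.symm
    choose k hk using fun i => hD i (Finset.mem_univ i)
    refine ⟨∑ i, b.repr ⟨l, hl⟩ i * k i, ?_⟩
    have h4 : ∀ i, ((D : ℤ) : ℝ) * g (b i) = k i := by
      intro i
      have h3 : g (b i) = (θ (n (b i)) : ℝ) := by
        rw [← B.constr_basis ℝ (fun i => (θ (n (b i)) : ℝ)) i, hB]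
      have := hk i
      simp only [algebraMap_int_eq, eq_intCast, zsmul_eq_mul] at this
      rw [h3]
      exact_mod_cast (congrArg (Rat.cast (K := ℝ)) this).symm
    conv_lhs => rw [h2]
    rw [LinearMap.smul_apply, map_sum, Finset.smul_sum, Int.cast_sum]
    refine Finset.sum_congr rfl fun i _ => ?_
    rw [map_zsmul, smul_eq_mul, zsmul_eq_mul, mul_left_comm, h4]
    simp
  rw [ht, smul_smul] at hint
  have hDt : ((D : ℤ) : ℝ) * t ≠ 0 := mul_ne_zero (by exact_mod_cast hD0) ht0
  rcases lt_or_gt_of_ne hDt with h | h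
  · refine ⟨-(((D : ℤ) : ℝ) * t), by linarith, fun l hl => ?_⟩
    obtain ⟨z, hz⟩ := hint l hl
    exact ⟨-z, by rw [neg_smul, LinearMap.neg_apply, hz]; simp⟩
  · exact ⟨_, h, hint⟩

end Polyhedral

/-! ### Facet normals of the cone, chambers, and the order on translates -/

section Polyhedral
variable {V : Type v} [NormedAddCommGroup V] [NormedSpace ℝ V] {L : Submodule ℤ V}
  {C : PointedCone ℝ V}

theorem mem_dualCone_hull {s : Set V} {n : Module.Dual ℝ V} :
    n ∈ dualCone (PointedCone.hull ℝ s) ↔ ∀ y ∈ s, 0 ≤ n y := by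
  refine ⟨fun h y hy => h y (Submodule.subset_span hy), fun h x hx => ?_⟩
  induction hx using Submodule.span_induction with
  | mem y hy => exact h y hy
  | zero => simp
  | add y z _ _ hy hz => rw [map_add]; exact add_nonneg hy hz
  | smul a y _ hy =>
    have : n (a • y) = (a : ℝ) * n y := n.map_smul (a : ℝ) y
    rw [this]; exact mul_nonneg a.2 hy

theorem smul_mem_dualCone {n : Module.Dual ℝ V} (hn : n ∈ dualCone C) {t : ℝ} (ht : 0 ≤ t) :
    t • n ∈ dualCone C := fun x hx => by
  rw [LinearMap.smul_apply, smul_eq_mul]; exact mul_nonneg ht (hn x hx)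

/-- An element of the dual cone vanishing wherever the extremal functional `n` vanishes on the
generators is a multiple of `n`. -/
theorem exists_eq_smul_of_extremal (s : Finset V) {n n' : Module.Dual ℝ V}
    (hn : n ∈ primitiveNormals L (PointedCone.hull ℝ (s : Set V)))
    (hn' : n' ∈ dualCone (PointedCone.hull ℝ (s : Set V))) (h : ∀ y ∈ s, n y = 0 → n' y = 0) :
    ∃ t : ℝ, 0 ≤ t ∧ n' = t • n := by
  have hnd := mem_dualCone_hull.1 hn.1
  have hnd' := mem_dualCone_hull.1 hn'
  -- For small `η` the difference `n - η n'` stays in the dual cone, and extremality of `n` applies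
  -- to the sum `η n' + (n - η n')`.
  obtain ⟨η, hη, hle⟩ : ∃ η : ℝ, 0 < η ∧ ∀ y ∈ s, η * n' y ≤ n y := by
    have : ∀ y ∈ s, ∀ᶠ η : ℝ in nhdsWithin 0 (Set.Ioi 0), η * n' y ≤ n y := by
      intro y hy
      rcases (hnd y hy).eq_or_lt with h0 | h0
      · exact Filter.Eventually.of_forall fun η => by rw [h y hy h0.symm, ← h0]; simp
      · have hc : Filter.Tendsto (fun η : ℝ => η * n' y) (nhdsWithin 0 (Set.Ioi 0)) (nhds 0) := by
          have : Continuous fun η : ℝ => η * n' y := by fun_prop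
          have := this.tendsto 0
          rw [zero_mul] at this
          exact this.mono_left nhdsWithin_le_nhds
        filter_upwards [hc.eventually_lt_const h0] with η hη using hη.le
    have h2 : ∀ᶠ η : ℝ in nhdsWithin 0 (Set.Ioi 0), 0 < η := self_mem_nhdsWithin
    exact (h2.and ((Finset.eventually_all s).2 this)).exists
  obtain ⟨t, ht, hte⟩ := hn.2.2.2.2 (η • n') (smul_mem_dualCone hn' hη.le) (n - η • n')
    (mem_dualCone_hull.2 fun y hy => by
      rw [LinearMap.sub_apply, LinearMap.smul_apply, smul_eq_mul]
      linarith [hle y hy]) (by abel)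
  refine ⟨η⁻¹ * t, by positivity, ?_⟩
  rw [mul_smul, ← hte, smul_smul, inv_mul_cancel₀ hη.ne', one_smul]

theorem IsToricCone.exists_finset (hC : IsToricCone L C) :
    ∃ s : Finset V, (s : Set V) ⊆ L ∧ C = PointedCone.hull ℝ (s : Set V) ∧
      ∀ g : Module.Dual ℝ V, (∀ y ∈ s, g y = 0) → g = 0 := by
  obtain ⟨s, hs, hsL, rfl⟩ := hC.rational_polyhedral
  obtain ⟨s, rfl⟩ := hs.exists_finset_coe
  refine ⟨s, hsL, rfl, fun g hg => LinearMap.ext fun x => ?_⟩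
  have hgC : ∀ y ∈ PointedCone.hull ℝ (s : Set V), g y = 0 := by
    intro y hy
    have h1 := mem_dualCone_hull.2 (fun y hy => (hg y hy).ge) y hy
    have h2 := mem_dualCone_hull (n := -g).2 (fun y hy => by simp [hg y hy]) y hy
    rw [LinearMap.neg_apply] at h2
    linarith
  have hx : x ∈ Submodule.span ℝ ((PointedCone.hull ℝ (s : Set V) : PointedCone ℝ V) : Set V) := by
    rw [hC.full_dimensional]; trivial
  induction hx using Submodule.span_induction with
  | mem y hy => exact hgC y hy
  | zero => simp
  | add y z _ _ hy hz => rw [map_add, hy, hz]; simp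
  | smul a y _ hy => rw [map_smul, hy]; simp

/-- Take the sum of the generators: a primitive normal is non-negative on each of them, and by
full-dimensionality it cannot vanish on all. -/
theorem IsToricCone.exists_interior_vector (hC : IsToricCone L C) :
    ∃ c ∈ L, ∀ n ∈ primitiveNormals L C, 0 < n c := by
  obtain ⟨s, hs, rfl, hspan⟩ := hC.exists_finset
  refine ⟨∑ y ∈ s, y, L.sum_mem fun y hy => hs hy, fun n hn => ?_⟩
  rw [map_sum]
  refine Finset.sum_pos' (fun y hy => mem_dualCone_hull.1 hn.1 y hy) ?_
  by_contra! h
  exact hn.2.1 (hspan n fun y hy => le_antisymm (h y hy) (mem_dualCone_hull.1 hn.1 y hy))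

/-- The toric order on `V`: `u` dominates `v` when `A_u ⊆ A_v`. -/
def Dominates (L : Submodule ℤ V) (C : PointedCone ℝ V) (u v : V) : Prop :=
  ∀ n ∈ primitiveNormals L C, ⌈n v⌉ ≤ ⌈n u⌉

theorem dominates_refl (u : V) : Dominates L C u u := fun _ _ => le_rfl

theorem Dominates.trans {u v w : V} (h : Dominates L C u v) (h' : Dominates L C v w) :
    Dominates L C u w := fun n hn => (h' n hn).trans (h n hn)

theorem ceil_apply_add {n : Module.Dual ℝ V} (hn : n ∈ primitiveNormals L C) {m : V} (hm : m ∈ L)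
    (u : V) : ⌈n (u + m)⌉ = ⌈n u⌉ + ⌈n m⌉ := by
  obtain ⟨z, hz⟩ := hn.2.2.1 m hm
  rw [map_add, hz, Int.ceil_add_intCast, Int.ceil_intCast]

theorem dominates_add_right_iff {u v m : V} (hm : m ∈ L) :
    Dominates L C (u + m) (v + m) ↔ Dominates L C u v :=
  forall₂_congr fun n hn => by
    rw [ceil_apply_add hn hm, ceil_apply_add hn hm, add_le_add_iff_right]

variable [DiscreteTopology L] [IsZLattice ℝ L]

/-- Both functionals take the value `1` on the lattice, so `t` is an integer with an integer
inverse, and it is non-negative. -/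
theorem eq_of_smul_eq {n n' : Module.Dual ℝ V} (hn : n ∈ primitiveNormals L C)
    (hn' : n' ∈ primitiveNormals L C) {t : ℝ} (ht : 0 ≤ t) (h : n' = t • n) : n' = n := by
  obtain ⟨l, hl, h1⟩ := exists_apply_eq_one hn
  obtain ⟨l', hl', h1'⟩ := exists_apply_eq_one hn'
  obtain ⟨a, ha⟩ := hn'.2.2.1 l hl
  obtain ⟨b, hb⟩ := hn.2.2.1 l' hl'
  rw [h, LinearMap.smul_apply, h1, smul_eq_mul, mul_one] at ha
  rw [h, LinearMap.smul_apply, hb, smul_eq_mul, ha] at h1'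
  have h2 : a * b = 1 := by exact_mod_cast h1'
  have h3 : 0 ≤ a := by rw [ha] at ht; exact_mod_cast ht
  have h4 : a = 1 := by
    rcases Int.eq_one_or_neg_one_of_mul_eq_one h2 with h | h
    · exact h
    · lia
  rw [h, ha, h4]; simp

theorem eq_of_forall_apply_eq_zero (s : Finset V) {n n' : Module.Dual ℝ V}
    (hn : n ∈ primitiveNormals L (PointedCone.hull ℝ (s : Set V)))
    (hn' : n' ∈ primitiveNormals L (PointedCone.hull ℝ (s : Set V)))
    (h : ∀ y ∈ s, n y = 0 → n' y = 0) : n' = n := by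
  obtain ⟨t, ht, h⟩ := exists_eq_smul_of_extremal s hn hn'.1 h
  exact eq_of_smul_eq hn hn' ht h

/-- A functional in the dual cone whose zeros among the generators determine it up to scaling has
a positive multiple among the primitive normals. -/
theorem exists_smul_mem_primitiveNormals [FiniteDimensional ℝ V] (s : Finset V)
    (hs : (s : Set V) ⊆ L) {n : Module.Dual ℝ V} (h0 : n ≠ 0)
    (hn : ∀ y ∈ s, 0 ≤ n y) (hspan : ∀ g : Module.Dual ℝ V, (∀ y ∈ s, g y = 0) → g = 0)
    (huniq : ∀ g : Module.Dual ℝ V, (∀ y ∈ s, n y = 0 → g y = 0) → ∃ t : ℝ, g = t • n) :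
    ∃ t : ℝ, 0 < t ∧ t • n ∈ primitiveNormals L (PointedCone.hull ℝ (s : Set V)) := by
  obtain ⟨t, ht, hint⟩ := exists_isIntegral_smul (L := L) h0 {y | y ∈ s ∧ n y = 0}
    (fun y hy => hs hy.1) (fun y hy => hy.2) fun g hg => huniq g fun y hy h => hg y ⟨hy, h⟩
  obtain ⟨g, hg, ⟨l, hl, hlg⟩, hgi⟩ := exists_nat_of_isIntegral hint (smul_ne_zero ht.ne' h0)
  have hg' : (0 : ℝ) < g := by exact_mod_cast hg
  have hpos : 0 < (g : ℝ)⁻¹ * t := by positivity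
  rw [smul_smul] at hgi
  refine ⟨(g : ℝ)⁻¹ * t, hpos, smul_mem_dualCone (mem_dualCone_hull.2 hn) hpos.le,
    smul_ne_zero hpos.ne' h0, hgi, fun ε hε0 hε1 hε => ?_, fun a ha b hb hab => ?_⟩
  · obtain ⟨z, hz⟩ := hε l hl
    rw [LinearMap.smul_apply, mul_smul, LinearMap.smul_apply, hlg, smul_eq_mul, smul_eq_mul,
      inv_mul_cancel₀ hg'.ne', mul_one] at hz
    rw [hz] at hε0 hε1
    have h1 : (0 : ℤ) < z := by exact_mod_cast hε0
    have h2 : z < 1 := by exact_mod_cast hε1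
    lia
  · rw [mem_dualCone_hull] at ha hb
    obtain ⟨r, hr⟩ := huniq a fun y hy h => by
      have h1 := congrArg (fun m => m y) hab
      simp only [LinearMap.add_apply, LinearMap.smul_apply, h, smul_zero] at h1
      linarith [ha y hy, hb y hy]
    have hr0 : a = (r / ((g : ℝ)⁻¹ * t)) • (((g : ℝ)⁻¹ * t) • n) := by
      rw [smul_smul, div_mul_cancel₀ _ hpos.ne', hr]
    by_cases hneg : 0 ≤ r / ((g : ℝ)⁻¹ * t)
    · exact ⟨_, hneg, hr0⟩
    · -- then `n` vanishes on all generators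
      have hr1 : r < 0 := by
        by_contra h
        exact hneg (div_nonneg (not_lt.1 h) hpos.le)
      have hall : ∀ y ∈ s, n y = 0 := fun y hy => by
        have := ha y hy
        rw [hr, LinearMap.smul_apply, smul_eq_mul] at this
        nlinarith [hn y hy]
      exact absurd (hspan n hall) h0

/-- The dual cone is generated by its extremal rays. Induct on the number of generators at which `n`
is non-zero. If the zeros of `n` determine it up to scaling, it is a positive multiple of a
primitive normal. Otherwise some `g` independent of `n` shares these zeros; with `M` and `μ` the
extreme ratios of `g` to `n`, the functionals `M n - g` and `g - μ n` are in the dual cone, have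
more zeros, and add up to a positive multiple of `n`. -/
theorem nonneg_of_forall_primitiveNormals [FiniteDimensional ℝ V] (s : Finset V)
    (hs : (s : Set V) ⊆ L) (hspan : ∀ g : Module.Dual ℝ V, (∀ y ∈ s, g y = 0) → g = 0) {x : V}
    (hx : ∀ n ∈ primitiveNormals L (PointedCone.hull ℝ (s : Set V)), 0 ≤ n x)
    (n : Module.Dual ℝ V) (hn : ∀ y ∈ s, 0 ≤ n y) : 0 ≤ n x := by
  classical
  induction hk : (s.filter fun y => n y ≠ 0).card using Nat.strong_induction_on
    generalizing n with
  | _ k ih =>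
  by_cases h0 : n = 0
  · simp [h0]
  by_cases huniq : ∀ g : Module.Dual ℝ V, (∀ y ∈ s, n y = 0 → g y = 0) → ∃ t : ℝ, g = t • n
  · obtain ⟨t, ht, htn⟩ := exists_smul_mem_primitiveNormals s hs h0 hn hspan huniq
    have := hx _ htn
    rw [LinearMap.smul_apply, smul_eq_mul] at this
    exact nonneg_of_mul_nonneg_right this ht
  · push Not at huniq
    obtain ⟨g, hg, hgn⟩ := huniq
    have hne : (s.filter fun y => n y ≠ 0).Nonempty := by
      by_contra h
      rw [Finset.not_nonempty_iff_eq_empty, Finset.filter_eq_empty_iff] at h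
      exact h0 (hspan n fun y hy => not_not.1 (h hy))
    obtain ⟨a, ha, hmax⟩ := Finset.exists_max_image _ (fun y => g y / n y) hne
    obtain ⟨b, hb, hmin⟩ := Finset.exists_min_image _ (fun y => g y / n y) hne
    rw [Finset.mem_filter] at ha hb
    have hpos : ∀ y ∈ s, n y ≠ 0 → 0 < n y := fun y hy h => lt_of_le_of_ne (hn y hy) (Ne.symm h)
    have hsmall : ∀ m : Module.Dual ℝ V, (∀ y ∈ s, 0 ≤ m y) → (∀ y ∈ s, n y = 0 → m y = 0) →
        (∃ y ∈ s, n y ≠ 0 ∧ m y = 0) → 0 ≤ m x := by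
      intro m hm hmn ⟨y, hy, hny, hmy⟩
      refine ih _ ?_ m hm rfl
      rw [← hk]
      refine Finset.card_lt_card ⟨fun z hz => ?_, fun h => ?_⟩
      · rw [Finset.mem_filter] at hz ⊢
        exact ⟨hz.1, fun h => hz.2 (hmn z hz.1 h)⟩
      · exact (Finset.mem_filter.1 (h (Finset.mem_filter.2 ⟨hy, hny⟩))).2 hmy
    have h1 := hsmall ((g a / n a) • n - g) (fun y hy => by
        rw [LinearMap.sub_apply, LinearMap.smul_apply, smul_eq_mul]
        by_cases h : n y = 0
        · rw [h, hg y hy h]; simp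
        · have := hmax y (Finset.mem_filter.2 ⟨hy, h⟩)
          rw [div_le_iff₀ (hpos y hy h)] at this
          linarith) (fun y hy h => by simp [h, hg y hy h])
      ⟨a, ha.1, ha.2, by simp [div_mul_cancel₀ _ ha.2]⟩
    have h2 := hsmall (g - (g b / n b) • n) (fun y hy => by
        rw [LinearMap.sub_apply, LinearMap.smul_apply, smul_eq_mul]
        by_cases h : n y = 0
        · rw [h, hg y hy h]; simp
        · have := hmin y (Finset.mem_filter.2 ⟨hy, h⟩)
          rw [le_div_iff₀ (hpos y hy h)] at this
          linarith) (fun y hy h => by simp [h, hg y hy h])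
      ⟨b, hb.1, hb.2, by simp [div_mul_cancel₀ _ hb.2]⟩
    have hlt : g b / n b < g a / n a := by
      refine lt_of_le_of_ne (hmax b (Finset.mem_filter.2 hb)) fun h => hgn (g a / n a) ?_
      rw [← sub_eq_zero]
      refine hspan _ fun y hy => ?_
      rw [LinearMap.sub_apply, LinearMap.smul_apply, smul_eq_mul]
      by_cases hny : n y = 0
      · rw [hny, hg y hy hny]; simp
      · have h3 := hmax y (Finset.mem_filter.2 ⟨hy, hny⟩)
        have h4 := hmin y (Finset.mem_filter.2 ⟨hy, hny⟩)
        rw [h] at h4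
        rw [← le_antisymm h3 h4, div_mul_cancel₀ _ hny, sub_self]
    simp only [LinearMap.sub_apply, LinearMap.smul_apply, smul_eq_mul] at h1 h2
    nlinarith

/-- By extremality a primitive normal is determined by the set of generators that it kills. -/
theorem IsToricCone.finite_primitiveNormals (hC : IsToricCone L C) :
    (primitiveNormals L C).Finite := by
  classical
  obtain ⟨s, -, rfl, -⟩ := hC.exists_finset
  refine Set.Finite.of_finite_image (f := fun n => s.filter fun y => n y = 0)
    (Set.Finite.subset (s.powerset.finite_toSet) ?_) ?_
  · rintro _ ⟨n, -, rfl⟩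
    exact Finset.mem_coe.2 (Finset.mem_powerset.2 (Finset.filter_subset _ _))
  · intro n hn n' hn' h
    simp only at h
    refine (eq_of_forall_apply_eq_zero s hn hn' fun y hy h0 => ?_).symm
    have : y ∈ s.filter fun y => n' y = 0 := by
      rw [← h]; exact Finset.mem_filter.2 ⟨hy, h0⟩
    exact (Finset.mem_filter.1 this).2

theorem IsToricCone.mem_iff [FiniteDimensional ℝ V] (hC : IsToricCone L C) {x : V} :
    x ∈ C ↔ ∀ n ∈ primitiveNormals L C, 0 ≤ n x := by
  refine ⟨fun hx n hn => hn.1 x hx, fun h => ?_⟩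
  obtain ⟨s, hs, rfl, hspan⟩ := hC.exists_finset
  by_contra hx
  obtain ⟨n, hn, hnx⟩ := exists_dual_neg_of_notMem_hull s x hx
  exact hnx.not_ge (nonneg_of_forall_primitiveNormals s hs hspan h n hn)

/-- The sum of the generators lying on the facet of `n`: another primitive normal vanishing on all
of them would have to be `n`. -/
theorem IsToricCone.exists_facet_vector (hC : IsToricCone L C) {n : Module.Dual ℝ V}
    (hn : n ∈ primitiveNormals L C) :
    ∃ y ∈ L, n y = 0 ∧ ∀ n' ∈ primitiveNormals L C, n' ≠ n → 0 < n' y := by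
  classical
  obtain ⟨s, hs, rfl, -⟩ := hC.exists_finset
  refine ⟨∑ y ∈ s.filter fun y => n y = 0, y, L.sum_mem fun y hy =>
    hs (Finset.mem_filter.1 hy).1, ?_, fun n' hn' hne => ?_⟩
  · rw [map_sum]
    exact Finset.sum_eq_zero fun y hy => (Finset.mem_filter.1 hy).2
  · rw [map_sum]
    refine Finset.sum_pos' (fun y hy => mem_dualCone_hull.1 hn'.1 y (Finset.mem_filter.1 hy).1) ?_
    by_contra! h
    refine hne (eq_of_forall_apply_eq_zero s hn hn' fun y hy h0 => le_antisymm
      (h y (Finset.mem_filter.2 ⟨hy, h0⟩)) (mem_dualCone_hull.1 hn'.1 y hy))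

theorem IsToricCone.mem_interior_iff [FiniteDimensional ℝ V] (hC : IsToricCone L C) {x : V} :
    x ∈ interior (C : Set V) ↔ ∀ n ∈ primitiveNormals L C, 0 < n x := by
  constructor
  · intro hx n hn
    by_contra! h
    obtain ⟨c, -, hc⟩ := hC.exists_interior_vector
    have hcont : Filter.Tendsto (fun η : ℝ => x - η • c) (nhdsWithin 0 (Set.Ioi 0)) (nhds x) := by
      have : Continuous fun η : ℝ => x - η • c := by fun_prop
      have := this.tendsto 0
      rw [zero_smul, sub_zero] at this
      exact this.mono_left nhdsWithin_le_nhds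
    have h2 : ∀ᶠ η : ℝ in nhdsWithin 0 (Set.Ioi 0), 0 < η := self_mem_nhdsWithin
    obtain ⟨η, hη, hmem⟩ := (h2.and (hcont.eventually (mem_interior_iff_mem_nhds.1 hx))).exists
    have h3 := hC.mem_iff.1 hmem n hn
    rw [map_sub, map_smul, smul_eq_mul] at h3
    nlinarith [mul_pos hη (hc n hn)]
  · intro h
    rw [mem_interior]
    refine ⟨⋂ n ∈ primitiveNormals L C, {y | 0 < n y}, fun y hy => ?_, ?_, ?_⟩
    · rw [SetLike.mem_coe, hC.mem_iff]
      intro n hn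
      exact (Set.mem_iInter₂.1 hy n hn).le
    · exact hC.finite_primitiveNormals.isOpen_biInter fun n _ =>
        isOpen_lt continuous_const n.continuous_of_finiteDimensional
    · exact Set.mem_iInter₂.2 h

theorem IsToricCone.eq_zero [FiniteDimensional ℝ V] (hC : IsToricCone L C) {x : V}
    (hx : ∀ n ∈ primitiveNormals L C, n x = 0) : x = 0 :=
  hC.pointed x (hC.mem_iff.2 fun n hn => (hx n hn).ge)
    (hC.mem_iff.2 fun n hn => by rw [map_neg, hx n hn, neg_zero])

theorem IsToricCone.sub_mem_iff [FiniteDimensional ℝ V] (hC : IsToricCone L C) {m : V}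
    (hm : m ∈ L) (v : V) : m - v ∈ C ↔ ∀ n ∈ primitiveNormals L C, ⌈n v⌉ ≤ ⌈n m⌉ := by
  rw [hC.mem_iff]
  refine forall₂_congr fun n hn => ?_
  obtain ⟨z, hz⟩ := hn.2.2.1 m hm
  rw [map_sub, sub_nonneg, hz, Int.ceil_intCast, Int.ceil_le]

/-- For the converse, the number `⌈n u⌉` is detected by a lattice point of `C + u` as close as
possible to the facet of `n` and far from the other facets. -/
theorem IsToricCone.dominates_iff [FiniteDimensional ℝ V] (hC : IsToricCone L C) {u v : V} :
    Dominates L C u v ↔ ∀ m ∈ L, m - u ∈ C → m - v ∈ C := by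
  constructor
  · intro h m hm hmu
    rw [hC.sub_mem_iff hm] at hmu ⊢
    exact fun n hn => (h n hn).trans (hmu n hn)
  · intro h n hn
    obtain ⟨l, hl, hl1⟩ := exists_apply_eq_one hn
    obtain ⟨y, hy, hny, hy'⟩ := hC.exists_facet_vector hn
    -- a lattice point on the boundary of `C + u` for `n` and deep inside for the others
    obtain ⟨k, hk⟩ : ∃ k : ℕ, ∀ n' ∈ primitiveNormals L C, n' ≠ n →
        n' u ≤ n' ((⌈n u⌉ : ℤ) • l + (k : ℤ) • y) := by
      have h1 : ∀ n' ∈ primitiveNormals L C, ∀ᶠ k : ℕ in Filter.atTop, n' ≠ n →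
          n' u ≤ n' ((⌈n u⌉ : ℤ) • l + (k : ℤ) • y) := by
        intro n' hn'
        by_cases hne : n' = n
        · exact Filter.Eventually.of_forall fun _ h => absurd hne h
        · have hpos := hy' n' hn' hne
          filter_upwards [Filter.eventually_ge_atTop
            ⌈(n' u - ⌈n u⌉ * n' l) / n' y⌉₊] with k hk _
          have h3 := (Nat.le_ceil _).trans (Nat.cast_le (α := ℝ).2 hk)
          rw [div_le_iff₀ hpos] at h3
          rw [map_add, map_zsmul, map_zsmul, zsmul_eq_mul, zsmul_eq_mul, Int.cast_natCast]
          linarith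
      exact ((Filter.eventually_all_finite hC.finite_primitiveNormals).2 h1).exists
    set m := (⌈n u⌉ : ℤ) • l + (k : ℤ) • y with hmdef
    have hm : m ∈ L := L.add_mem (L.smul_mem _ hl) (L.smul_mem _ hy)
    have hnm : n m = ⌈n u⌉ := by
      rw [hmdef, map_add, map_zsmul, map_zsmul, hl1, hny]; simp
    have hmu : m - u ∈ C := by
      rw [hC.mem_iff]
      intro n' hn'
      rw [map_sub, sub_nonneg]
      by_cases hne : n' = n
      · rw [hne, hnm]; exact Int.le_ceil _
      · exact hk n' hn' hne
    have := (hC.sub_mem_iff hm v).1 (h m hm hmu) n hn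
    rwa [hnm, Int.ceil_intCast] at this

theorem IsToricCone.mem_chamber_iff [FiniteDimensional ℝ V] (hC : IsToricCone L C) {v w : V} :
    w ∈ chamber L C v ↔ ∀ n ∈ primitiveNormals L C, ⌈n w⌉ = ⌈n v⌉ := by
  constructor
  · intro h n hn
    exact le_antisymm (hC.dominates_iff.2 (fun m hm => (h m hm).2) n hn)
      (hC.dominates_iff.2 (fun m hm => (h m hm).1) n hn)
  · intro h m hm
    exact ⟨hC.dominates_iff.1 (fun n hn => (h n hn).ge) m hm,
      hC.dominates_iff.1 (fun n hn => (h n hn).le) m hm⟩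

/-- Pointedness: a lattice translation that preserves all the ceilings is killed by every normal.
This leaves a single relevant degree in `Hom(P_u, S_v)`. -/
theorem IsToricCone.eq_of_dominates [FiniteDimensional ℝ V] (hC : IsToricCone L C) {v m m' : V}
    (hm : m ∈ L) (hm' : m' ∈ L) (h : Dominates L C (v + m) (v + m'))
    (h' : Dominates L C (v + m') (v + m)) : m = m' := by
  rw [← sub_eq_zero]
  refine hC.eq_zero fun n hn => ?_
  have h1 := le_antisymm (h' n hn) (h n hn)
  rw [ceil_apply_add hn hm, ceil_apply_add hn hm', add_left_cancel_iff] at h1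
  obtain ⟨z, hz⟩ := hn.2.2.1 m hm
  obtain ⟨z', hz'⟩ := hn.2.2.1 m' hm'
  rw [hz, hz', Int.ceil_intCast, Int.ceil_intCast] at h1
  rw [map_sub, hz, hz', h1, sub_self]

/-- Every translate of the cone contains a lattice point. -/
theorem IsToricCone.exists_sub_mem [FiniteDimensional ℝ V] (hC : IsToricCone L C) (v : V) :
    ∃ m ∈ L, m ∈ C ∧ m - v ∈ C := by
  obtain ⟨c, hc, hpos⟩ := hC.exists_interior_vector
  have h1 : ∀ n ∈ primitiveNormals L C, ∀ᶠ k : ℕ in Filter.atTop, n v ≤ n ((k : ℤ) • c) := by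
    intro n hn
    filter_upwards [Filter.eventually_ge_atTop ⌈n v / n c⌉₊] with k hk
    have h3 := (Nat.le_ceil _).trans (Nat.cast_le (α := ℝ).2 hk)
    rw [div_le_iff₀ (hpos n hn)] at h3
    rwa [map_zsmul, zsmul_eq_mul, Int.cast_natCast]
  obtain ⟨k, hk⟩ := ((Filter.eventually_all_finite hC.finite_primitiveNormals).2 h1).exists
  refine ⟨(k : ℤ) • c, L.smul_mem _ hc, hC.mem_iff.2 fun n hn => ?_, hC.mem_iff.2 fun n hn => ?_⟩
  · rw [map_zsmul, zsmul_eq_mul, Int.cast_natCast]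
    exact mul_nonneg (Nat.cast_nonneg k) (hpos n hn).le
  · rw [map_sub, sub_nonneg]; exact hk n hn

/-- The open cone at `x` has the same lattice points as the closed cone at a nearby point. -/
theorem IsToricCone.exists_sub_mem_interior_iff [FiniteDimensional ℝ V] (hC : IsToricCone L C)
    (x : V) : ∃ y : V, (∀ n ∈ primitiveNormals L C, ⌈n y⌉ = ⌊n x⌋ + 1) ∧
      ∀ m ∈ L, (m - x ∈ interior (C : Set V) ↔ m - y ∈ C) := by
  obtain ⟨c, -, hc⟩ := hC.exists_interior_vector
  -- A short move in the interior direction `c` takes each `n x` strictly above its floor without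
  -- passing the next integer.
  have h1 : ∀ n ∈ primitiveNormals L C, ∀ᶠ η : ℝ in nhdsWithin 0 (Set.Ioi 0),
      n (x + η • c) < ⌊n x⌋ + 1 := by
    intro n hn
    have hcont : Filter.Tendsto (fun η : ℝ => n (x + η • c)) (nhdsWithin 0 (Set.Ioi 0))
        (nhds (n x)) := by
      have : Continuous fun η : ℝ => n (x + η • c) := by
        simp only [map_add, map_smul, smul_eq_mul]; fun_prop
      have := this.tendsto 0
      rw [zero_smul, add_zero] at this
      exact this.mono_left nhdsWithin_le_nhds
    exact hcont.eventually_lt_const (Int.lt_floor_add_one _)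
  have h2 : ∀ᶠ η : ℝ in nhdsWithin 0 (Set.Ioi 0), 0 < η := self_mem_nhdsWithin
  obtain ⟨η, hη, hlt⟩ :=
    (h2.and ((Filter.eventually_all_finite hC.finite_primitiveNormals).2 h1)).exists
  have hceil : ∀ n ∈ primitiveNormals L C, ⌈n (x + η • c)⌉ = ⌊n x⌋ + 1 := by
    intro n hn
    rw [Int.ceil_eq_iff]
    push_cast
    refine ⟨?_, (hlt n hn).le⟩
    rw [map_add, map_smul, smul_eq_mul, add_sub_cancel_right]
    linarith [Int.floor_le (n x), mul_pos hη (hc n hn)]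
  refine ⟨x + η • c, hceil, fun m hm => ?_⟩
  rw [hC.sub_mem_iff hm, hC.mem_interior_iff]
  refine forall₂_congr fun n hn => ?_
  rw [hceil n hn]
  obtain ⟨z, hz⟩ := hn.2.2.1 m hm
  rw [map_sub, sub_pos, hz, Int.ceil_intCast, ← Int.floor_lt, Int.add_one_le_iff]

end Polyhedral

/-! ### Monomials in the Laurent ring -/

section MonoidAlgebra

variable {𝕜 M : Type*} [Field 𝕜]

theorem eq_of_coeff_single_ne_zero {m m' : M} {c : 𝕜}
    (h : (AddMonoidAlgebra.single m c).coeff m' ≠ 0) : m = m' := by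
  classical
  rw [AddMonoidAlgebra.coeff_single, Finsupp.single_apply] at h
  by_contra h'
  rw [if_neg h'] at h
  exact h rfl

variable [AddCommGroup M]

theorem exists_of_coeff_mul_ne_zero {F G : AddMonoidAlgebra 𝕜 M} {m : M} (h : (F * G).coeff m ≠ 0) :
    ∃ m₁ m₂ : M, F.coeff m₁ ≠ 0 ∧ G.coeff m₂ ≠ 0 ∧ m₁ + m₂ = m := by
  classical
  have := AddMonoidAlgebra.support_coeff_mul_subset F G (Finsupp.mem_support_iff.2 h)
  obtain ⟨a, ha, b, hb, rfl⟩ := Finset.mem_add.1 this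
  exact ⟨a, b, Finsupp.mem_support_iff.1 ha, Finsupp.mem_support_iff.1 hb, rfl⟩

theorem single_mul_single_neg (m : M) :
    (AddMonoidAlgebra.single m 1 : AddMonoidAlgebra 𝕜 M) * AddMonoidAlgebra.single (-m) 1 = 1 := by
  rw [AddMonoidAlgebra.single_mul_single, add_neg_cancel, mul_one]; rfl

theorem mul_single_cancel {F G : AddMonoidAlgebra 𝕜 M} {m : M}
    (h : F * AddMonoidAlgebra.single m 1 = G * AddMonoidAlgebra.single m 1) : F = G := by
  have := congrArg (· * (AddMonoidAlgebra.single (-m) 1 : AddMonoidAlgebra 𝕜 M)) h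
  simpa only [mul_assoc, single_mul_single_neg, mul_one] using this

end MonoidAlgebra

/-! ### Homomorphisms of conic modules as Laurent polynomials -/

section Multiplier

variable {𝕜 : Type u} [Field 𝕜] {V : Type v} [NormedAddCommGroup V] [NormedSpace ℝ V]
  {L : Submodule ℤ V} {C : PointedCone ℝ V}

theorem mem_conicModule {v : V} {a : Laurent 𝕜 L} :
    a ∈ conicModule 𝕜 L C v ↔ ∀ m : L, a.coeff m ≠ 0 → (m : V) - v ∈ C :=
  forall_congr' fun m => by rw [Finsupp.mem_support_iff]; rfl

theorem smul_coe (r : toricAlgebra 𝕜 L C) (a : Laurent 𝕜 L) : r • a = (r : Laurent 𝕜 L) * a := rfl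

theorem single_mem_conicModule {v : V} {m : L} (hm : (m : V) - v ∈ C) (c : 𝕜) :
    (AddMonoidAlgebra.single m c : Laurent 𝕜 L) ∈ conicModule 𝕜 L C v := by
  rw [mem_conicModule]
  intro m' hm'
  rwa [← eq_of_coeff_single_ne_zero hm']

theorem single_mem_toricAlgebra {m : L} (hm : (m : V) ∈ C) (c : 𝕜) :
    (AddMonoidAlgebra.single m c : Laurent 𝕜 L) ∈ toricAlgebra 𝕜 L C := by
  intro m' hm'
  rwa [← eq_of_coeff_single_ne_zero (Finsupp.mem_support_iff.1 hm')]

variable [FiniteDimensional ℝ V] [DiscreteTopology L] [IsZLattice ℝ L] (hC : IsToricCone L C)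

include hC in
theorem IsToricCone.eq_of_forall_mul_eq {v : V} {F G : Laurent 𝕜 L}
    (h : ∀ a ∈ conicModule 𝕜 L C v, F * a = G * a) : F = G := by
  obtain ⟨m, hm, -, hmv⟩ := hC.exists_sub_mem v
  exact mul_single_cancel (h _ (single_mem_conicModule (m := ⟨m, hm⟩) hmv 1))

include hC in
/-- A homomorphism from a conic module to the Laurent ring is multiplication by a Laurent
polynomial. -/
theorem IsToricCone.exists_multiplier {v : V}
    (φ : conicModule 𝕜 L C v →ₗ[toricAlgebra 𝕜 L C] Laurent 𝕜 L) :
    ∃ F : Laurent 𝕜 L, ∀ a, φ a = F * a := by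
  classical
  obtain ⟨m₀, hm₀, -, hm₀v⟩ := hC.exists_sub_mem v
  set x₀ : conicModule 𝕜 L C v := ⟨AddMonoidAlgebra.single ⟨m₀, hm₀⟩ 1,
    single_mem_conicModule (m := ⟨m₀, hm₀⟩) hm₀v 1⟩ with hx₀
  -- One value determines the multiplier, because the monomial `x₀` is invertible in the Laurent
  -- ring.
  set F : Laurent 𝕜 L := φ x₀ * AddMonoidAlgebra.single (-⟨m₀, hm₀⟩) 1 with hF
  have hFx : φ x₀ = F * x₀ := by
    rw [hF, mul_assoc, mul_comm (AddMonoidAlgebra.single (-_) _), hx₀, single_mul_single_neg,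
      mul_one]
  refine ⟨F, fun a => ?_⟩
  -- multiply by an element of the ring moving `a` into the submodule generated by `x₀`
  obtain ⟨r, s, hr, hrs⟩ : ∃ (r s : toricAlgebra 𝕜 L C),
      (∀ F G : Laurent 𝕜 L, r • F = r • G → F = G) ∧ r • a = s • x₀ := by
    have hfin : ∃ k : L, (k : V) ∈ C ∧
        ∀ m ∈ (a : Laurent 𝕜 L).coeff.support, ((k + m - ⟨m₀, hm₀⟩ : L) : V) ∈ C := by
      generalize (a : Laurent 𝕜 L).coeff.support = S
      induction S using Finset.induction_on with
      | empty => exact ⟨0, C.zero_mem, by simp⟩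
      | insert m S _ ih =>
        obtain ⟨k, hk, hkS⟩ := ih
        obtain ⟨k', hk', hk'C, hk'm⟩ := hC.exists_sub_mem (m₀ - m)
        refine ⟨k + ⟨k', hk'⟩, C.add_mem hk hk'C, fun m' hm' => ?_⟩
        rcases Finset.mem_insert.1 hm' with rfl | hm'
        · have := C.add_mem hk hk'm
          convert this using 1
          push_cast
          abel
        · have := C.add_mem (hkS m' hm') hk'C
          convert this using 1
          push_cast
          abel
    obtain ⟨k, hk, hkS⟩ := hfin
    have hs : (AddMonoidAlgebra.single (k - ⟨m₀, hm₀⟩) 1 * (a : Laurent 𝕜 L) : Laurent 𝕜 L) ∈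
        toricAlgebra 𝕜 L C := by
      intro m hm
      obtain ⟨m₁, m₂, h1, h2, rfl⟩ :=
        exists_of_coeff_mul_ne_zero (Finsupp.mem_support_iff.1 hm)
      rw [← eq_of_coeff_single_ne_zero h1]
      have := hkS m₂ (Finsupp.mem_support_iff.2 h2)
      rwa [show k + m₂ - ⟨m₀, hm₀⟩ = k - ⟨m₀, hm₀⟩ + m₂ by abel] at this
    refine ⟨⟨_, single_mem_toricAlgebra hk 1⟩, ⟨_, hs⟩, fun F G h => ?_, Subtype.ext ?_⟩
    · rw [smul_coe, smul_coe, mul_comm, mul_comm _ G] at h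
      exact mul_single_cancel h
    · change (AddMonoidAlgebra.single k 1 : Laurent 𝕜 L) * (a : Laurent 𝕜 L) =
        (AddMonoidAlgebra.single (k - ⟨m₀, hm₀⟩) 1 * (a : Laurent 𝕜 L) : Laurent 𝕜 L) *
          (AddMonoidAlgebra.single ⟨m₀, hm₀⟩ 1 : Laurent 𝕜 L)
      rw [mul_right_comm, AddMonoidAlgebra.single_mul_single, sub_add_cancel, mul_one]
  apply hr
  rw [← map_smul, hrs, map_smul, hFx, smul_coe, smul_coe, mul_left_comm, mul_left_comm _ F]
  congr 1
  exact (congrArg Subtype.val hrs).symm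

include hC in
/-- The monomials of a multiplier between conic modules shift one into the other. -/
theorem IsToricCone.dominates_of_multiplier {u v : V} {F : Laurent 𝕜 L}
    (h : ∀ a ∈ conicModule 𝕜 L C u, F * a ∈ conicModule 𝕜 L C v) {m : L} (hm : F.coeff m ≠ 0) :
    Dominates L C (u + m) v := by
  classical
  rw [hC.dominates_iff]
  intro k hk hku
  have h1 : ((⟨k, hk⟩ - m : L) : V) - u ∈ C := by
    convert hku using 1
    push_cast
    abel
  have h2 := mem_conicModule.1 (h _ (single_mem_conicModule h1 1)) ⟨k, hk⟩
  apply h2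
  have h3 := F.coeff_mul_single_add 1 (⟨k, hk⟩ - m) m
  rw [add_sub_cancel, mul_one] at h3
  rwa [h3]

include hC in
theorem IsToricCone.mul_mem_of_dominates {u v : V} {F : Laurent 𝕜 L}
    (h : ∀ m : L, F.coeff m ≠ 0 → Dominates L C (u + m) v) {a : Laurent 𝕜 L}
    (ha : a ∈ conicModule 𝕜 L C u) : F * a ∈ conicModule 𝕜 L C v := by
  rw [mem_conicModule] at ha ⊢
  intro m hm
  obtain ⟨m₁, m₂, h1, h2, rfl⟩ := exists_of_coeff_mul_ne_zero hm
  refine hC.dominates_iff.1 (h m₁ h1) _ (m₁ + m₂).2 ?_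
  convert ha m₂ h2 using 1
  push_cast
  abel

end Multiplier

/-! ### Elements of `P_v` as tuples of Laurent polynomials -/

section Symbol

variable {𝕜 : Type u} [Field 𝕜] {V : Type v} [NormedAddCommGroup V] [NormedSpace ℝ V]
  {L : Submodule ℤ V} {C : PointedCone ℝ V} {ι : Type} {w : ι → V}

/-- An element of `P_v`, as a linear map. -/
def projModule.toHom {v : V} (f : projModule 𝕜 L C w v) :
    conicSum 𝕜 L C w →ₗ[toricAlgebra 𝕜 L C] conicModule 𝕜 L C v := f

theorem projModule.toHom_smul {v : V} (g : (conicEnd 𝕜 L C w)ᵐᵒᵖ) (f : projModule 𝕜 L C w v)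
    (a : conicSum 𝕜 L C w) : (g • f).toHom a = f.toHom (g.unop a) := rfl

theorem projModule.toHom_add {v : V} (f g : projModule 𝕜 L C w v) (a : conicSum 𝕜 L C w) :
    (f + g).toHom a = f.toHom a + g.toHom a := rfl

theorem projModule.ext {v : V} {f g : projModule 𝕜 L C w v} (h : ∀ a, f.toHom a = g.toHom a) :
    f = g := LinearMap.ext h

/-- The homomorphisms `P_u → P_v` induced by homomorphisms `A_u → A_v`. -/
def projModule.map (w : ι → V) {u v : V}
    (h : conicModule 𝕜 L C u →ₗ[toricAlgebra 𝕜 L C] conicModule 𝕜 L C v) :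
    projModule 𝕜 L C w u →ₗ[(conicEnd 𝕜 L C w)ᵐᵒᵖ] projModule 𝕜 L C w v where
  toFun f := h.comp f.toHom
  map_add' _ _ := LinearMap.comp_add _ _ _
  map_smul' _ _ := rfl

theorem projModule.toHom_map {u v : V}
    (h : conicModule 𝕜 L C u →ₗ[toricAlgebra 𝕜 L C] conicModule 𝕜 L C v)
    (f : projModule 𝕜 L C w u) (a : conicSum 𝕜 L C w) :
    (projModule.map w h f).toHom a = h (f.toHom a) := rfl

/-- The matrix of Laurent polynomials representing `f : 𝔸 → A_v`. -/
def symbol {v : V} (f : projModule 𝕜 L C w v) (i : ι) : Laurent 𝕜 L :=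
  open Classical in
  Classical.epsilon fun F => ∀ a : conicModule 𝕜 L C (w i),
    (f.toHom (Pi.single i a) : Laurent 𝕜 L) = F * (a : Laurent 𝕜 L)

variable [FiniteDimensional ℝ V] [DiscreteTopology L] [IsZLattice ℝ L] (hC : IsToricCone L C)

include hC in
theorem toHom_single {v : V} (f : projModule 𝕜 L C w v) [inst : DecidableEq ι] (i : ι)
    (a : conicModule 𝕜 L C (w i)) :
    (f.toHom (Pi.single i a) : Laurent 𝕜 L) = symbol f i * (a : Laurent 𝕜 L) := by
  obtain rfl : inst = fun a b => Classical.propDecidable (a = b) := Subsingleton.elim _ _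
  classical
  have key : ∃ F : Laurent 𝕜 L, ∀ a : conicModule 𝕜 L C (w i),
      (f.toHom (Pi.single i a) : Laurent 𝕜 L) = F * (a : Laurent 𝕜 L) :=
    hC.exists_multiplier ((conicModule 𝕜 L C v).subtype.comp (f.toHom.comp
      (LinearMap.single (toricAlgebra 𝕜 L C) (fun i => conicModule 𝕜 L C (w i)) i)))
  exact Classical.epsilon_spec key a

include hC in
theorem dominates_of_symbol {v : V} (f : projModule 𝕜 L C w v) {i : ι} {m : L}
    (h : (symbol f i).coeff m ≠ 0) : Dominates L C (w i + m) v := by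
  classical
  refine hC.dominates_of_multiplier (fun a ha => ?_) h
  rw [← toHom_single hC f i ⟨a, ha⟩]
  exact (f.toHom (Pi.single i ⟨a, ha⟩)).2

variable [Fintype ι]

include hC in
theorem toHom_apply {v : V} (f : projModule 𝕜 L C w v) (a : conicSum 𝕜 L C w) :
    (f.toHom a : Laurent 𝕜 L) = ∑ i, symbol f i * (a i : Laurent 𝕜 L) := by
  classical
  have h : a = ∑ i, Pi.single i (a i) := (Finset.univ_sum_single a).symm
  conv_lhs => rw [h]
  rw [map_sum, AddSubmonoidClass.coe_finsetSum]
  exact Finset.sum_congr rfl fun i _ => toHom_single hC f i (a i)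

include hC in
theorem symbol_eq {v : V} {f : projModule 𝕜 L C w v} {F : ι → Laurent 𝕜 L}
    (h : ∀ a : conicSum 𝕜 L C w, (f.toHom a : Laurent 𝕜 L) = ∑ i, F i * (a i : Laurent 𝕜 L)) :
    symbol f = F := by
  classical
  funext i
  refine hC.eq_of_forall_mul_eq (v := w i) fun a ha => ?_
  rw [← toHom_single hC f i ⟨a, ha⟩, h, Finset.sum_eq_single i]
  · rw [Pi.single_eq_same]
  · intro j _ hj
    rw [Pi.single_eq_of_ne hj]; simp
  · simp

include hC in
theorem symbol_injective {v : V} {f g : projModule 𝕜 L C w v} (h : symbol f = symbol g) :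
    f = g :=
  projModule.ext fun a => Subtype.ext (by rw [toHom_apply hC, toHom_apply hC, h])

include hC in
-- With `dominates_of_symbol` and `symbol_injective` this describes `P_v` completely: a basis is
-- given by the pairs `(i, m)` such that `x^m` maps `A_{w i}` into `A_v`.
theorem exists_symbol_eq {v : V} (F : ι → Laurent 𝕜 L)
    (hF : ∀ i (m : L), (F i).coeff m ≠ 0 → Dominates L C (w i + m) v) :
    ∃ f : projModule 𝕜 L C w v, symbol f = F := by
  let f : conicSum 𝕜 L C w →ₗ[toricAlgebra 𝕜 L C] conicModule 𝕜 L C v :=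
    { toFun := fun a => ⟨∑ i, F i * (a i : Laurent 𝕜 L), Submodule.sum_mem _ fun i _ =>
        hC.mul_mem_of_dominates (hF i) (a i).2⟩
      map_add' := fun a b => Subtype.ext (by
        simp only [Pi.add_apply, Submodule.coe_add, mul_add, Finset.sum_add_distrib])
      map_smul' := fun r a => Subtype.ext (by
        change ∑ i, F i * ((r : Laurent 𝕜 L) * (a i : Laurent 𝕜 L)) =
          (r : Laurent 𝕜 L) * ∑ i, F i * (a i : Laurent 𝕜 L)
        rw [Finset.mul_sum]
        exact Finset.sum_congr rfl fun i _ => mul_left_comm _ _ _) }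
  exact ⟨f, symbol_eq hC fun a => rfl⟩

/-- Taking symbols, as an additive map. -/
def symbolHom (w : ι → V) (v : V) : projModule 𝕜 L C w v →+ (ι → Laurent 𝕜 L) where
  toFun := symbol
  map_zero' := symbol_eq hC fun a => by
    simp only [Pi.zero_apply, zero_mul, Finset.sum_const_zero]; rfl
  map_add' f g := symbol_eq hC fun a => by
    rw [projModule.toHom_add, Submodule.coe_add, toHom_apply hC, toHom_apply hC,
      ← Finset.sum_add_distrib]
    exact Finset.sum_congr rfl fun i _ => (add_mul _ _ _).symm

include hC in
-- Composition of homomorphisms is multiplication of matrices of Laurent polynomials.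
theorem symbol_smul {v : V} (g : (conicEnd 𝕜 L C w)ᵐᵒᵖ) (f : projModule 𝕜 L C w v) (j : ι) :
    symbol (g • f) j = ∑ i, symbol f i * symbol (v := w i)
      ((LinearMap.proj i).comp g.unop : conicSum 𝕜 L C w →ₗ[toricAlgebra 𝕜 L C] _) j := by
  refine congrFun (symbol_eq hC (F := fun j => ∑ i, symbol f i * symbol (v := w i)
      ((LinearMap.proj i).comp g.unop : conicSum 𝕜 L C w →ₗ[toricAlgebra 𝕜 L C] _) j) fun a => ?_) j
  rw [projModule.toHom_smul, toHom_apply hC]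
  simp only [Finset.sum_mul]
  rw [Finset.sum_comm]
  refine Finset.sum_congr rfl fun i _ => ?_
  have := toHom_apply (v := w i) hC
    ((LinearMap.proj i).comp g.unop : conicSum 𝕜 L C w →ₗ[toricAlgebra 𝕜 L C] _) a
  refine (congrArg (symbol f i * ·) this).trans ?_
  simp only [Finset.mul_sum, mul_assoc]

include hC in
theorem symbol_map {u v : V}
    {h : conicModule 𝕜 L C u →ₗ[toricAlgebra 𝕜 L C] conicModule 𝕜 L C v} {F : Laurent 𝕜 L}
    (hF : ∀ a, (h a : Laurent 𝕜 L) = F * (a : Laurent 𝕜 L)) (f : projModule 𝕜 L C w u) (i : ι) :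
    symbol (projModule.map w h f) i = F * symbol f i := by
  refine congrFun (symbol_eq hC (F := fun i => F * symbol f i) fun a => ?_) i
  rw [projModule.toHom_map, hF, toHom_apply hC, Finset.mul_sum]
  exact Finset.sum_congr rfl fun i _ => (mul_assoc _ _ _).symm

include hC in
theorem exists_hom_multiplier {u v : V}
    (h : conicModule 𝕜 L C u →ₗ[toricAlgebra 𝕜 L C] conicModule 𝕜 L C v) :
    ∃ F : Laurent 𝕜 L, (∀ a, (h a : Laurent 𝕜 L) = F * (a : Laurent 𝕜 L)) ∧
      ∀ m : L, F.coeff m ≠ 0 → Dominates L C (u + m) v := by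
  obtain ⟨F, hF⟩ := hC.exists_multiplier ((conicModule 𝕜 L C v).subtype.comp h)
  refine ⟨F, hF, fun m hm => hC.dominates_of_multiplier (fun a ha => ?_) hm⟩
  rw [← hF ⟨a, ha⟩]
  exact (h ⟨a, ha⟩).2

/-- Multiplication by a Laurent polynomial, between conic modules. -/
def IsToricCone.mulHom {u v : V} (F : Laurent 𝕜 L)
    (hF : ∀ m : L, F.coeff m ≠ 0 → Dominates L C (u + m) v) :
    conicModule 𝕜 L C u →ₗ[toricAlgebra 𝕜 L C] conicModule 𝕜 L C v where
  toFun a := ⟨F * (a : Laurent 𝕜 L), hC.mul_mem_of_dominates hF a.2⟩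
  map_add' _ _ := Subtype.ext (mul_add _ _ _)
  map_smul' r a := Subtype.ext (mul_left_comm F (r : Laurent 𝕜 L) a)

/-- Conic modules are isomorphic if and only if they agree up to a lattice translation. -/
def Equivalent (L : Submodule ℤ V) (C : PointedCone ℝ V) (u v : V) : Prop :=
  ∃ m ∈ L, Dominates L C (u + m) v ∧ Dominates L C v (u + m)

include hC in
-- Inverse isomorphisms have multipliers with `F * G = 1`. The constant term of this product
-- provides opposite monomials of `F` and `G`, which shift one module onto the other.
theorem IsToricCone.nonempty_equiv_iff {u v : V} :
    Nonempty (conicModule 𝕜 L C u ≃ₗ[toricAlgebra 𝕜 L C] conicModule 𝕜 L C v) ↔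
      Equivalent L C u v := by
  constructor
  · rintro ⟨e⟩
    obtain ⟨F, hF, hF'⟩ := exists_hom_multiplier hC e.toLinearMap
    obtain ⟨G, hG, hG'⟩ := exists_hom_multiplier hC e.symm.toLinearMap
    have hFG : F * G = 1 := by
      refine hC.eq_of_forall_mul_eq (v := v) fun a ha => ?_
      rw [one_mul, mul_assoc, ← hG ⟨a, ha⟩, ← hF]
      exact congrArg Subtype.val (e.apply_symm_apply ⟨a, ha⟩)
    obtain ⟨m₁, m₂, h1, h2, h12⟩ := exists_of_coeff_mul_ne_zero (F := F) (G := G) (m := 0)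
      (by rw [hFG, AddMonoidAlgebra.one_def, AddMonoidAlgebra.coeff_single,
        Finsupp.single_eq_same]; exact one_ne_zero)
    refine ⟨m₁, m₁.2, hF' m₁ h1, ?_⟩
    have h3 := (dominates_add_right_iff m₁.2).2 (hG' m₂ h2)
    have h4 : v + (m₂ : V) + m₁ = v := by
      rw [add_assoc, add_comm (m₂ : V), ← Submodule.coe_add, h12]; simp
    rwa [h4] at h3
  · rintro ⟨m, hm, h1, h2⟩
    have h3 : ∀ m' : L, (AddMonoidAlgebra.single (⟨m, hm⟩ : L) (1 : 𝕜)).coeff m' ≠ 0 →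
        Dominates L C (u + m') v := fun m' h => by
      rw [← eq_of_coeff_single_ne_zero h]; exact h1
    have h4 : ∀ m' : L, (AddMonoidAlgebra.single (-⟨m, hm⟩ : L) (1 : 𝕜)).coeff m' ≠ 0 →
        Dominates L C (v + m') u := fun m' h => by
      rw [← eq_of_coeff_single_ne_zero h, ← dominates_add_right_iff hm]
      convert h2 using 1
      push_cast
      abel
    refine ⟨LinearEquiv.ofLinearMap (hC.mulHom _ h3) (hC.mulHom _ h4) ?_ ?_⟩
    · refine LinearMap.ext fun a => Subtype.ext ?_
      change (AddMonoidAlgebra.single (⟨m, hm⟩ : L) (1 : 𝕜) : Laurent 𝕜 L) *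
        (AddMonoidAlgebra.single (-⟨m, hm⟩ : L) (1 : 𝕜) * (a : Laurent 𝕜 L)) = a
      rw [← mul_assoc, single_mul_single_neg, one_mul]
    · refine LinearMap.ext fun a => Subtype.ext ?_
      change (AddMonoidAlgebra.single (-⟨m, hm⟩ : L) (1 : 𝕜) : Laurent 𝕜 L) *
        (AddMonoidAlgebra.single (⟨m, hm⟩ : L) (1 : 𝕜) * (a : Laurent 𝕜 L)) = a
      rw [mul_left_comm, ← mul_assoc, single_mul_single_neg, one_mul]

end Symbol

/-! ### Projectivity and the maximal graded submodule -/

section Radical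

variable {𝕜 : Type u} [Field 𝕜] {V : Type v} [NormedAddCommGroup V] [NormedSpace ℝ V]
  {L : Submodule ℤ V} {C : PointedCone ℝ V} {ι : Type} {w : ι → V}

theorem coeff_sum_apply {κ M : Type*} (s : Finset κ) (F : κ → AddMonoidAlgebra 𝕜 M) (m : M) :
    (∑ k ∈ s, F k).coeff m = ∑ k ∈ s, (F k).coeff m := by
  rw [AddMonoidAlgebra.coeff_sum, Finsupp.finsetSum_apply]

theorem projective_self (A : Type*) [Semiring A] : Module.Projective A A := inferInstance

/-- A conic module is a retract of a complete sum of conic modules. -/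
theorem IsComplete.exists_retract (hw : IsComplete 𝕜 L C w) (v : V) :
    ∃ (s : conicModule 𝕜 L C v →ₗ[toricAlgebra 𝕜 L C] conicSum 𝕜 L C w)
      (p : projModule 𝕜 L C w v), ∀ a, p.toHom (s a) = a := by
  classical
  obtain ⟨i, ⟨e⟩⟩ := hw v
  let p : conicSum 𝕜 L C w →ₗ[toricAlgebra 𝕜 L C] conicModule 𝕜 L C v :=
    e.symm.toLinearMap.comp (LinearMap.proj i)
  refine ⟨(LinearMap.single (toricAlgebra 𝕜 L C) (fun i => conicModule 𝕜 L C (w i)) i).comp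
    e.toLinearMap, p, fun a => ?_⟩
  change e.symm ((Pi.single i (e a) : conicSum 𝕜 L C w) i) = a
  rw [Pi.single_eq_same, e.symm_apply_apply]

/-- A retraction of `𝔸` onto `A_v` makes `P_v` a direct summand of the free module of rank one,
generated by `p`, since `f = p ∘ (s ∘ f)`. -/
theorem IsComplete.projective (hw : IsComplete 𝕜 L C w) (v : V) :
    Module.Projective (conicEnd 𝕜 L C w)ᵐᵒᵖ (projModule 𝕜 L C w v) := by
  obtain ⟨s, p, hsp⟩ := hw.exists_retract v
  let j : projModule 𝕜 L C w v →ₗ[(conicEnd 𝕜 L C w)ᵐᵒᵖ] (conicEnd 𝕜 L C w)ᵐᵒᵖ :=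
    { toFun := fun f => MulOpposite.op (s.comp f.toHom)
      map_add' := fun f g => congrArg MulOpposite.op (LinearMap.comp_add _ _ _)
      map_smul' := fun g f => rfl }
  have : Module.Projective (conicEnd 𝕜 L C w)ᵐᵒᵖ (conicEnd 𝕜 L C w)ᵐᵒᵖ :=
    projective_self _
  refine Module.Projective.of_split j (LinearMap.toSpanSingleton _ _ p) (LinearMap.ext fun f => ?_)
  exact projModule.ext fun a => hsp (f.toHom a)

variable [FiniteDimensional ℝ V] [DiscreteTopology L] [IsZLattice ℝ L] (hC : IsToricCone L C)
  [Fintype ι]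

/-- The elements of `P_v` none of whose monomials is an isomorphism onto `A_v`. -/
def gradedRadical (w : ι → V) (v : V) :
    Submodule (conicEnd 𝕜 L C w)ᵐᵒᵖ (projModule 𝕜 L C w v) where
  carrier := {f | ∀ i (m : L), (symbol f i).coeff m ≠ 0 → ¬ Dominates L C v (w i + m)}
  zero_mem' i m h := by
    rw [show symbol (0 : projModule 𝕜 L C w v) = 0 from (symbolHom hC w v).map_zero] at h
    exact absurd rfl h
  add_mem' := by
    intro f g hf hg i m h
    rw [show symbol (f + g) = symbol f + symbol g from (symbolHom hC w v).map_add f g,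
      Pi.add_apply, AddMonoidAlgebra.coeff_add, Finsupp.add_apply] at h
    by_cases h1 : (symbol f i).coeff m = 0
    · rw [h1, zero_add] at h
      exact hg i m h
    · exact hf i m h1
  smul_mem' := by
    intro g f hf j m h hv
    rw [symbol_smul hC, coeff_sum_apply] at h
    obtain ⟨i, -, hi⟩ := Finset.exists_ne_zero_of_sum_ne_zero h
    obtain ⟨m₁, m₂, h1, h2, rfl⟩ := exists_of_coeff_mul_ne_zero hi
    -- If a composite of two monomial maps is onto `A_v`, so is the one applied last.
    refine hf i m₁ h1 (hv.trans ?_)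
    have := (dominates_add_right_iff m₁.2).2 (dominates_of_symbol hC _ h2)
    convert this using 1
    push_cast
    abel

theorem mem_gradedRadical {v : V} {f : projModule 𝕜 L C w v} :
    f ∈ gradedRadical hC w v ↔
      ∀ i (m : L), (symbol f i).coeff m ≠ 0 → ¬ Dominates L C v (w i + m) := Iff.rfl

include hC in
theorem exists_symbol_single {v : V} [DecidableEq ι] (i : ι) {F : Laurent 𝕜 L}
    (hF : ∀ m : L, F.coeff m ≠ 0 → Dominates L C (w i + m) v) :
    ∃ f : projModule 𝕜 L C w v, symbol f = Pi.single i F := by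
  refine exists_symbol_eq hC _ fun j m h => ?_
  rcases eq_or_ne j i with rfl | hj
  · rw [Pi.single_eq_same] at h
    exact hF m h
  · rw [Pi.single_eq_of_ne hj] at h
    exact absurd rfl h

omit [Fintype ι] in
include hC in
theorem eq_of_symbol_coeff_ne_zero {v : V} {f : projModule 𝕜 L C w v} {m : L}
    (hf : IsHomogeneousOfDegree f m) {i : ι} {m' : L} (h : (symbol f i).coeff m' ≠ 0) :
    m' = m := by
  classical
  obtain ⟨k, hk, -, hkw⟩ := hC.exists_sub_mem (w i)
  let x : conicModule 𝕜 L C (w i) :=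
    ⟨AddMonoidAlgebra.single ⟨k, hk⟩ 1, single_mem_conicModule (m := ⟨k, hk⟩) hkw 1⟩
  have h1 := hf ⟨k, hk⟩ (Pi.single i x) fun j => by
    rcases eq_or_ne j i with rfl | hj
    · rw [Pi.single_eq_same]
      exact Finsupp.support_single_subset
    · rw [Pi.single_eq_of_ne hj]
      exact fun _ h => absurd rfl (Finsupp.mem_support_iff.1 h)
  have h2 : m' + ⟨k, hk⟩ ∈ (f.toHom (Pi.single i x) : Laurent 𝕜 L).coeff.support := by
    rw [toHom_single hC, Finsupp.mem_support_iff, AddMonoidAlgebra.coeff_mul_single_add, mul_one]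
    exact h
  have h3 := Finset.mem_singleton.1 (h1 h2)
  rwa [add_comm, add_right_inj] at h3

include hC in
theorem isHomogeneousOfDegree_of_symbol {v : V} {f : projModule 𝕜 L C w v} {m : L}
    (h : ∀ i (m' : L), (symbol f i).coeff m' ≠ 0 → m' = m) : IsHomogeneousOfDegree f m := by
  intro n a ha k hk
  rw [Finsupp.mem_support_iff] at hk
  change (f.toHom a : Laurent 𝕜 L).coeff k ≠ 0 at hk
  rw [toHom_apply hC, coeff_sum_apply] at hk
  obtain ⟨i, -, hi⟩ := Finset.exists_ne_zero_of_sum_ne_zero hk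
  obtain ⟨m₁, m₂, h1, h2, rfl⟩ := exists_of_coeff_mul_ne_zero hi
  rw [h i m₁ h1, Finset.mem_singleton.1 (ha i (Finsupp.mem_support_iff.2 h2)), add_comm]
  exact Finset.mem_singleton_self _

include hC in
/-- A graded submodule of `P_v` containing an isomorphism from a summand onto `A_v` is everything. -/
theorem eq_top_of_homogeneous {v : V}
    {N : Submodule (conicEnd 𝕜 L C w)ᵐᵒᵖ (projModule 𝕜 L C w v)} {g : projModule 𝕜 L C w v}
    (hg : g ∈ N) {m : L} (hgm : IsHomogeneousOfDegree g m) (hgN : g ∉ gradedRadical hC w v) :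
    N = ⊤ := by
  classical
  rw [mem_gradedRadical] at hgN
  push Not at hgN
  obtain ⟨i, m', hi, hv⟩ := hgN
  obtain rfl := eq_of_symbol_coeff_ne_zero hC hgm hi
  set c := (symbol g i).coeff m' with hc
  have hs : symbol g i = AddMonoidAlgebra.single m' c := by
    refine AddMonoidAlgebra.ext (Finsupp.ext fun k => ?_)
    by_cases hk : (symbol g i).coeff k = 0
    · rw [hk, AddMonoidAlgebra.coeff_single, Finsupp.single_apply, if_neg]
      rintro rfl
      exact hi hk
    · rw [eq_of_symbol_coeff_ne_zero hC hgm hk, AddMonoidAlgebra.coeff_single, Finsupp.single_eq_same]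
  have hF : ∀ k : L, (AddMonoidAlgebra.single (-m') c⁻¹ : Laurent 𝕜 L).coeff k ≠ 0 →
      Dominates L C (v + k) (w i) := fun k hk => by
    rw [← eq_of_coeff_single_ne_zero hk, ← dominates_add_right_iff m'.2]
    convert hv using 1
    push_cast
    abel
  rw [eq_top_iff]
  intro f _
  -- By homogeneity the `i`-th component of `g` is one invertible monomial. The endomorphism `E`
  -- applies `f`, then the inverse monomial into the `i`-th summand, so that `g ∘ E = f`.
  let E : conicEnd 𝕜 L C w :=
    (LinearMap.single (toricAlgebra 𝕜 L C) (fun i => conicModule 𝕜 L C (w i)) i).comp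
      ((hC.mulHom _ hF).comp f.toHom)
  have hE : f = MulOpposite.op E • g := by
    refine projModule.ext fun a => Subtype.ext ?_
    rw [projModule.toHom_smul]
    change _ = (g.toHom (Pi.single i (hC.mulHom _ hF (f.toHom a))) : Laurent 𝕜 L)
    rw [toHom_single hC, hs]
    change _ = AddMonoidAlgebra.single m' c * (AddMonoidAlgebra.single (-m') c⁻¹ *
      (f.toHom a : Laurent 𝕜 L))
    rw [← mul_assoc, AddMonoidAlgebra.single_mul_single, add_neg_cancel, mul_inv_cancel₀ hi,
      ← AddMonoidAlgebra.one_def, one_mul]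
  rw [hE]
  exact N.smul_mem _ hg

include hC in
-- Membership is a condition on each monomial of the symbol separately, so the monomial components
-- of an element belong to the submodule too.
theorem isGraded_gradedRadical (v : V) : IsGraded (gradedRadical (𝕜 := 𝕜) hC w v) := by
  classical
  intro f hf
  have h1 : ∀ (i : ι) (m : L), ∃ g : projModule 𝕜 L C w v,
      symbol g = Pi.single i (AddMonoidAlgebra.single m ((symbol f i).coeff m)) := fun i m => by
    refine exists_symbol_single hC i fun m' h => ?_
    obtain rfl := eq_of_coeff_single_ne_zero h
    rw [AddMonoidAlgebra.coeff_single, Finsupp.single_eq_same] at h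
    exact dominates_of_symbol hC f h
  choose g hg using h1
  have h2 : ∀ (i : ι) (m : L) (j : ι) (m' : L), (symbol (g i m) j).coeff m' ≠ 0 →
      m' = m ∧ (symbol f j).coeff m' ≠ 0 := fun i m j m' h => by
    rw [hg] at h
    rcases eq_or_ne j i with rfl | hj
    · rw [Pi.single_eq_same] at h
      obtain rfl := eq_of_coeff_single_ne_zero h
      rw [AddMonoidAlgebra.coeff_single, Finsupp.single_eq_same] at h
      exact ⟨rfl, h⟩
    · rw [Pi.single_eq_of_ne hj] at h
      exact absurd rfl h
  have h3 : f = ∑ i, ∑ m ∈ (symbol f i).coeff.support, g i m := by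
    refine symbol_injective hC ?_
    change _ = symbolHom hC w v _
    simp only [map_sum]
    funext j
    rw [Finset.sum_apply, Finset.sum_eq_single j, Finset.sum_apply]
    · refine (AddMonoidAlgebra.sum_coeff_single (symbol f j)).symm.trans ?_
      refine Finset.sum_congr rfl fun m _ => ?_
      change _ = symbol (g j m) j
      rw [hg, Pi.single_eq_same]
    · intro i _ hi
      rw [Finset.sum_apply]
      refine Finset.sum_eq_zero fun m _ => ?_
      change symbol (g i m) j = 0
      rw [hg, Pi.single_eq_of_ne hi.symm]
    · simp
  rw [h3]
  refine sum_mem fun i _ => sum_mem fun m _ => AddSubgroup.subset_closure ⟨?_, m, ?_⟩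
  · exact fun j m' h => hf j m' (h2 i m j m' h).2
  · exact isHomogeneousOfDegree_of_symbol hC fun j m' h => (h2 i m j m' h).1

omit [Fintype ι] in
include hC in
/-- Every `A_v` is isomorphic to a summand by multiplication by a monomial. -/
theorem IsComplete.exists_translate (hw : IsComplete 𝕜 L C w) (v : V) :
    ∃ (i : ι) (m : L), Dominates L C (w i + m) v ∧ Dominates L C v (w i + m) := by
  obtain ⟨i, ⟨e⟩⟩ := hw v
  obtain ⟨m, hm, h1, h2⟩ := hC.nonempty_equiv_iff.1 ⟨e.symm⟩
  exact ⟨i, ⟨m, hm⟩, h1, h2⟩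

include hC in
-- A homogeneous element outside `gradedRadical` generates all of `P_v`, so every proper graded
-- submodule lies inside it. It is itself proper because, by completeness, some summand is
-- isomorphic to `A_v`.
theorem IsComplete.maximalGradedSubmodule_eq (hw : IsComplete 𝕜 L C w) (v : V) :
    maximalGradedSubmodule 𝕜 L C w v = gradedRadical hC w v := by
  classical
  refine le_antisymm (sSup_le ?_) (le_sSup ⟨isGraded_gradedRadical hC v, fun h => ?_⟩)
  · rintro N ⟨hN, hNtop⟩ f hf
    have h1 := hN f hf
    refine (AddSubgroup.closure_le (gradedRadical (𝕜 := 𝕜) hC w v).toAddSubgroup).2 ?_ h1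
    rintro g ⟨hg, m, hgm⟩
    by_contra hgN
    exact hNtop (eq_top_of_homogeneous hC hg hgm hgN)
  · obtain ⟨i, m, h1, h2⟩ := hw.exists_translate hC v
    obtain ⟨f, hf⟩ := exists_symbol_single (𝕜 := 𝕜) (w := w) (v := v) hC i
      (F := (AddMonoidAlgebra.single m 1 : Laurent 𝕜 L)) fun m' h => by
        rwa [← eq_of_coeff_single_ne_zero h]
    have h3 : f ∈ gradedRadical hC w v := h ▸ Submodule.mem_top
    refine h3 i m ?_ h2
    rw [hf, Pi.single_eq_same, AddMonoidAlgebra.coeff_single, Finsupp.single_eq_same]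
    exact one_ne_zero

end Radical

/-! ### Dimension of a space of morphisms out of a direct sum -/

section RankHom

open CategoryTheory

universe w₁ w₂ t

variable {𝕜 : Type t} [Field 𝕜] {A : Type w₁} [Category.{w₂} A] [Preadditive A] [Linear 𝕜 A]

/-- The dimension of the space of morphisms out of a finite direct sum, when the morphisms out of
each summand form a space of dimension at most one. -/
theorem rank_hom_eq_card {κ : Type*} [Fintype κ] {X Y : A} {Q : κ → A}
    (inj : ∀ k, Q k ⟶ X) (π : ∀ k, X ⟶ Q k) (h_same : ∀ k, inj k ≫ π k = 𝟙 _)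
    (h_ne : ∀ j k, j ≠ k → inj j ≫ π k = 0) (h_sum : ∑ k, π k ≫ inj k = 𝟙 X)
    {p : κ → Prop} (h_not : ∀ k, ¬ p k → ∀ φ : Q k ⟶ Y, φ = 0)
    (h_p : ∀ k, p k → ∃ ψ : Q k ⟶ Y, ψ ≠ 0 ∧ ∀ φ : Q k ⟶ Y, ∃ c : 𝕜, φ = c • ψ) :
    Module.rank 𝕜 (X ⟶ Y) = (Nat.card {k // p k} : Cardinal) := by
  classical
  choose ψ hψ hψ' using fun k : {k // p k} => h_p k k.2
  have hli : LinearIndependent 𝕜 fun k : {k // p k} => π k ≫ ψ k := by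
    rw [Fintype.linearIndependent_iff]
    intro g hg j
    have h1 := congrArg (fun φ => inj j ≫ φ) hg
    simp only [Preadditive.comp_sum, Linear.comp_smul, Limits.comp_zero] at h1
    rw [Finset.sum_eq_single j, ← Category.assoc, h_same, Category.id_comp] at h1
    · exact (smul_eq_zero.1 h1).resolve_right (hψ j)
    · intro k _ hk
      rw [← Category.assoc, h_ne _ _ fun h => hk (Subtype.ext h.symm), Limits.zero_comp, smul_zero]
    · simp
  have hsp : ⊤ ≤ Submodule.span 𝕜 (Set.range fun k : {k // p k} => π k ≫ ψ k) := by
    intro φ _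
    rw [← Category.id_comp φ, ← h_sum, Preadditive.sum_comp]
    refine Submodule.sum_mem _ fun k _ => ?_
    rw [Category.assoc]
    by_cases hk : p k
    · obtain ⟨c, hc⟩ := hψ' ⟨k, hk⟩ (inj k ≫ φ)
      rw [hc, Linear.comp_smul]
      exact Submodule.smul_mem _ _ (Submodule.subset_span ⟨⟨k, hk⟩, rfl⟩)
    · rw [h_not k hk (inj k ≫ φ), Limits.comp_zero]
      exact Submodule.zero_mem _
  rw [rank_eq_card_basis (Module.Basis.mk hli hsp), Nat.card_eq_fintype_card]

end RankHom

/-! ### Homomorphisms from `P_u` to the simple modules -/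

section HomSimple

variable {𝕜 : Type u} [Field 𝕜] {V : Type v} [NormedAddCommGroup V] [NormedSpace ℝ V]
  {L : Submodule ℤ V} {C : PointedCone ℝ V} {ι : Type} {w : ι → V}

/-- Homomorphisms from `P_u` to a quotient of `P_v` come from homomorphisms `A_u → A_v`. -/
theorem IsComplete.exists_eq_mkQ_map (hw : IsComplete 𝕜 L C w) {u v : V}
    {N : Submodule (conicEnd 𝕜 L C w)ᵐᵒᵖ (projModule 𝕜 L C w v)}
    (φ : projModule 𝕜 L C w u →ₗ[(conicEnd 𝕜 L C w)ᵐᵒᵖ] projModule 𝕜 L C w v ⧸ N) :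
    ∃ h : conicModule 𝕜 L C u →ₗ[toricAlgebra 𝕜 L C] conicModule 𝕜 L C v,
      ∀ f, φ f = N.mkQ (projModule.map w h f) := by
  obtain ⟨s, p, hsp⟩ := hw.exists_retract u
  -- The retraction `p` generates `P_u`, so lifting the single value `φ p` lifts `φ`.
  obtain ⟨q, hq⟩ := N.mkQ_surjective (φ p)
  refine ⟨q.toHom.comp s, fun f => ?_⟩
  have h1 : f = MulOpposite.op (s.comp f.toHom) • p :=
    projModule.ext fun a => (hsp (f.toHom a)).symm
  have h2 : projModule.map w (q.toHom.comp s) f = MulOpposite.op (s.comp f.toHom) • q := rfl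
  rw [h2, map_smul, hq, ← map_smul, ← h1]

variable [FiniteDimensional ℝ V] [DiscreteTopology L] [IsZLattice ℝ L] (hC : IsToricCone L C)
  [Fintype ι]

include hC in
theorem IsComplete.mem_maximalGradedSubmodule (hw : IsComplete 𝕜 L C w) {v : V}
    {f : projModule 𝕜 L C w v} : f ∈ maximalGradedSubmodule 𝕜 L C w v ↔
      ∀ i (m : L), (symbol f i).coeff m ≠ 0 → ¬ Dominates L C v (w i + m) := by
  rw [hw.maximalGradedSubmodule_eq hC]; rfl

/-- The inclusion `P_u → P_v` for `A_u ⊆ A_v`, and zero otherwise. -/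
def incl (𝕜 : Type u) [Field 𝕜] (w : ι → V) (u v : V) :
    projModule 𝕜 L C w u →ₗ[(conicEnd 𝕜 L C w)ᵐᵒᵖ] projModule 𝕜 L C w v :=
  open Classical in
  if h : Dominates L C u v then projModule.map w (hC.mulHom 1 fun m hm => by
    rw [AddMonoidAlgebra.one_def] at hm
    rw [← eq_of_coeff_single_ne_zero hm]
    simpa using h) else 0

theorem symbol_incl {u v : V} (h : Dominates L C u v) (f : projModule 𝕜 L C w u) :
    symbol (incl hC 𝕜 w u v f) = symbol f := by
  rw [incl, dif_pos h]
  funext i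
  rw [symbol_map hC (F := 1) fun a => rfl, one_mul]

/-- A homomorphism from `P_u` to a simple module vanishes on a smaller `P_{u'}`. -/
theorem IsComplete.comp_incl_eq_zero (hw : IsComplete 𝕜 L C w) {u u' v : V}
    (h : Dominates L C u' u) (h' : ¬ Dominates L C u u')
    (φ : projModule 𝕜 L C w u →ₗ[(conicEnd 𝕜 L C w)ᵐᵒᵖ]
      projModule 𝕜 L C w v ⧸ maximalGradedSubmodule 𝕜 L C w v) (f : projModule 𝕜 L C w u') :
    φ (incl hC 𝕜 w u' u f) = 0 := by
  obtain ⟨g, hg⟩ := hw.exists_eq_mkQ_map φ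
  obtain ⟨G, hG, hGv⟩ := exists_hom_multiplier hC g
  rw [hg, Submodule.mkQ_apply, Submodule.Quotient.mk_eq_zero, hw.mem_maximalGradedSubmodule hC]
  intro i k hk hvk
  rw [symbol_map hC hG, symbol_incl hC h] at hk
  obtain ⟨m₁, m₂, h1, h2, rfl⟩ := exists_of_coeff_mul_ne_zero hk
  refine h' ((dominates_add_right_iff m₁.2).1 (((hGv m₁ h1).trans hvk).trans ?_))
  have := (dominates_add_right_iff m₁.2).2 (dominates_of_symbol hC _ h2)
  convert this using 1
  push_cast
  abel

include hC in
-- If no monomial of `G` is onto `A_v`, then no composite with a map into `A_u` has such a monomial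
-- either.
theorem map_mem_maximalGradedSubmodule (hw : IsComplete 𝕜 L C w) {u v : V}
    {h : conicModule 𝕜 L C u →ₗ[toricAlgebra 𝕜 L C] conicModule 𝕜 L C v} {G : Laurent 𝕜 L}
    (hG : ∀ a, (h a : Laurent 𝕜 L) = G * (a : Laurent 𝕜 L))
    (hGv : ∀ m : L, G.coeff m ≠ 0 → ¬ Dominates L C v (u + m)) (f : projModule 𝕜 L C w u) :
    projModule.map w h f ∈ maximalGradedSubmodule 𝕜 L C w v := by
  rw [hw.mem_maximalGradedSubmodule hC]
  intro i k hk hvk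
  rw [symbol_map hC hG] at hk
  obtain ⟨m₁, m₂, h1, h2, rfl⟩ := exists_of_coeff_mul_ne_zero hk
  refine hGv m₁ h1 (hvk.trans ?_)
  have := (dominates_add_right_iff m₁.2).2 (dominates_of_symbol hC _ h2)
  convert this using 1
  push_cast
  abel

include hC in
-- A homomorphism lifts to a multiplier `A_u → A_v`. When the modules are not isomorphic, none of
-- its monomials is onto `A_v`, so its image is in the radical.
theorem IsComplete.hom_eq_zero (hw : IsComplete 𝕜 L C w) {u v : V} (h : ¬ Equivalent L C u v)
    (φ : projModule 𝕜 L C w u →ₗ[(conicEnd 𝕜 L C w)ᵐᵒᵖ]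
      projModule 𝕜 L C w v ⧸ maximalGradedSubmodule 𝕜 L C w v) : φ = 0 := by
  obtain ⟨g, hg⟩ := hw.exists_eq_mkQ_map φ
  obtain ⟨G, hG, hGv⟩ := exists_hom_multiplier hC g
  refine LinearMap.ext fun f => ?_
  rw [hg, LinearMap.zero_apply, Submodule.mkQ_apply, Submodule.Quotient.mk_eq_zero]
  exact map_mem_maximalGradedSubmodule hC hw hG (fun m hm hv => h ⟨m, m.2, hGv m hm, hv⟩) f

include hC in
theorem symbol_algebraMap_smul {v : V} (c : 𝕜) (f : projModule 𝕜 L C w v) (i : ι) :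
    symbol (algebraMap 𝕜 (conicEnd 𝕜 L C w)ᵐᵒᵖ c • f) i = c • symbol f i := by
  refine congrFun (symbol_eq hC (F := fun i => c • symbol f i) fun a => ?_) i
  rw [projModule.toHom_smul, toHom_apply hC]
  refine Finset.sum_congr rfl fun i _ => ?_
  rw [smul_mul_assoc, ← mul_smul_comm]
  rfl

include hC in
-- Exactly one monomial `x^{m₀}` maps `A_u` isomorphically onto `A_v`; every other monomial of a
-- multiplier lands in the radical. So the class of multiplication by `x^{m₀}` spans.
theorem IsComplete.exists_hom_ne_zero (hw : IsComplete 𝕜 L C w) {u v : V}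
    (h : Equivalent L C u v) :
    ∃ ψ : projModule 𝕜 L C w u →ₗ[(conicEnd 𝕜 L C w)ᵐᵒᵖ]
      projModule 𝕜 L C w v ⧸ maximalGradedSubmodule 𝕜 L C w v, ψ ≠ 0 ∧
      ∀ φ : projModule 𝕜 L C w u →ₗ[(conicEnd 𝕜 L C w)ᵐᵒᵖ]
        projModule 𝕜 L C w v ⧸ maximalGradedSubmodule 𝕜 L C w v,
        ∃ c : 𝕜, ∀ f, φ f = algebraMap 𝕜 (conicEnd 𝕜 L C w)ᵐᵒᵖ c • ψ f := by
  classical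
  obtain ⟨m₀', hm₀, h1, h2⟩ := h
  obtain ⟨m₀, rfl⟩ : ∃ m₀ : L, (m₀ : V) = m₀' := ⟨⟨m₀', hm₀⟩, rfl⟩
  have hx : ∀ m : L, (AddMonoidAlgebra.single m₀ 1 : Laurent 𝕜 L).coeff m ≠ 0 →
      Dominates L C (u + m) v := fun m hm => by
    rwa [← eq_of_coeff_single_ne_zero hm]
  have hx' : ∀ a, (hC.mulHom (AddMonoidAlgebra.single m₀ 1 : Laurent 𝕜 L) hx a : Laurent 𝕜 L) =
      AddMonoidAlgebra.single m₀ 1 * (a : Laurent 𝕜 L) := fun a => rfl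
  refine ⟨(maximalGradedSubmodule 𝕜 L C w v).mkQ.comp
    (projModule.map w (hC.mulHom (AddMonoidAlgebra.single m₀ 1) hx)), fun h0 => ?_, fun φ => ?_⟩
  · obtain ⟨i, m, h3, h4⟩ := hw.exists_translate hC u
    obtain ⟨f, hf⟩ := exists_symbol_single (𝕜 := 𝕜) (w := w) (v := u) hC i
      (F := (AddMonoidAlgebra.single m 1 : Laurent 𝕜 L)) fun m' h => by
        rwa [← eq_of_coeff_single_ne_zero h]
    have h5 := LinearMap.congr_fun h0 f
    rw [LinearMap.zero_apply, LinearMap.comp_apply, Submodule.mkQ_apply,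
      Submodule.Quotient.mk_eq_zero, hw.mem_maximalGradedSubmodule hC] at h5
    refine h5 i (m₀ + m) ?_ (h2.trans ?_)
    · rw [symbol_map hC hx', hf, Pi.single_eq_same, AddMonoidAlgebra.single_mul_single,
        AddMonoidAlgebra.coeff_single, Finsupp.single_eq_same, one_mul]
      exact one_ne_zero
    · have := (dominates_add_right_iff m₀.2).2 h4
      convert this using 1
      push_cast
      abel
  · obtain ⟨g, hg⟩ := hw.exists_eq_mkQ_map φ
    obtain ⟨G, hG, hGv⟩ := exists_hom_multiplier hC g
    -- Removing the monomial of degree `m₀` from `G` leaves a multiplier whose image is in the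
    -- radical.
    refine ⟨G.coeff m₀, fun f => ?_⟩
    rw [hg, LinearMap.comp_apply, ← map_smul, ← sub_eq_zero, ← map_sub, Submodule.mkQ_apply,
      Submodule.Quotient.mk_eq_zero, hw.mem_maximalGradedSubmodule hC]
    intro i k hk hvk
    have h3 : symbol (projModule.map w g f - algebraMap 𝕜 (conicEnd 𝕜 L C w)ᵐᵒᵖ (G.coeff m₀) •
        projModule.map w (hC.mulHom (AddMonoidAlgebra.single m₀ 1) hx) f) i =
        (G - AddMonoidAlgebra.single m₀ (G.coeff m₀)) * symbol f i := by
      have := congrFun ((symbolHom hC w v).map_sub (projModule.map w g f)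
        (algebraMap 𝕜 (conicEnd 𝕜 L C w)ᵐᵒᵖ (G.coeff m₀) •
        projModule.map w (hC.mulHom (AddMonoidAlgebra.single m₀ 1) hx) f)) i
      refine this.trans ?_
      change symbol (projModule.map w g f) i -
        symbol (algebraMap 𝕜 (conicEnd 𝕜 L C w)ᵐᵒᵖ (G.coeff m₀) •
        projModule.map w (hC.mulHom (AddMonoidAlgebra.single m₀ 1) hx) f) i = _
      rw [symbol_map hC hG, symbol_algebraMap_smul hC, symbol_map hC hx', sub_mul, ← smul_mul_assoc,
        AddMonoidAlgebra.smul_single, smul_eq_mul, mul_one]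
    rw [h3] at hk
    obtain ⟨m₁, m₂, h4, h5, rfl⟩ := exists_of_coeff_mul_ne_zero hk
    have h6 : Dominates L C (w i + (m₁ + m₂ : L)) (u + m₁) := by
      have := (dominates_add_right_iff m₁.2).2 (dominates_of_symbol hC _ h5)
      convert this using 1
      push_cast
      abel
    have hm : m₁ ≠ m₀ := by
      rintro rfl
      rw [AddMonoidAlgebra.coeff_sub, Finsupp.sub_apply, AddMonoidAlgebra.coeff_single,
        Finsupp.single_eq_same, sub_self] at h4
      exact h4 rfl
    have h7 : Dominates L C (u + m₁) v := by
      refine hGv m₁ ?_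
      rwa [AddMonoidAlgebra.coeff_sub, Finsupp.sub_apply, AddMonoidAlgebra.coeff_single,
        Finsupp.single_eq_of_ne hm, sub_zero] at h4
    exact hm (Subtype.ext (hC.eq_of_dominates m₁.2 m₀.2 (h7.trans h2)
      (h1.trans (hvk.trans h6))))

end HomSimple

/-! ### The open conic modules of the cells, and exactness in a fixed degree -/

section CellComplex

variable {V : Type v} [NormedAddCommGroup V] [NormedSpace ℝ V]
  (L : Submodule ℤ V) (C : PointedCone ℝ V)

/-- The primitive normals, as a family of functionals. -/
def normal (n : primitiveNormals L C) : Module.Dual ℝ V := n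

/-- The upper bounds `d_n` of the normals on the chamber of `v`. -/
def bound (v : V) (n : primitiveNormals L C) : ℝ := (⌈normal L C n v⌉ : ℝ)

/-- `y I` is a point such that `A_{y I}` is the open conic module of the cell with active set `I`. -/
def IsCellPoint [Fintype (primitiveNormals L C)] (v : V)
    (y : Finset (primitiveNormals L C) → V) : Prop :=
  ∀ I, IsFace (normal L C) (bound L C v) I → ∀ n,
    (n ∈ I → ⌈normal L C n (y I)⌉ = ⌈normal L C n v⌉ + 1) ∧
    (n ∉ I → ⌈normal L C n (y I)⌉ = ⌈normal L C n v⌉)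

variable {L C} [Fintype (primitiveNormals L C)]

/-- A lattice point is strictly beyond `x` for `n` when its value is at least `⌊n x⌋ + 1`. This
exceeds the bound of the chamber by one precisely for the active constraints. -/
theorem floor_add_one_eq {v x : V}
    (hx : InRegion (normal L C) (bound L C v) x) (n : primitiveNormals L C) :
    (n ∈ active (normal L C) (bound L C v) x →
      ⌊normal L C n x⌋ + 1 = ⌈normal L C n v⌉ + 1) ∧
    (n ∉ active (normal L C) (bound L C v) x →
      ⌊normal L C n x⌋ + 1 = ⌈normal L C n v⌉) := by
  refine ⟨fun h => ?_, fun h => ?_⟩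
  · rw [mem_active.1 h, bound, Int.floor_intCast]
  · rw [← eq_sub_iff_add_eq, Int.floor_eq_iff]
    have h1 := hx n
    have h2 := lt_of_le_of_ne h1.2 fun h' => h (mem_active.2 h')
    rw [bound] at h1 h2
    push_cast
    exact ⟨h1.1.le, by linarith⟩

variable (hC : IsToricCone L C)

include hC in
theorem IsToricCone.exists_isCellPoint [FiniteDimensional ℝ V] [DiscreteTopology L]
    [IsZLattice ℝ L] (v : V) : ∃ y, IsCellPoint L C v y := by
  have : ∀ I, ∃ y, IsFace (normal L C) (bound L C v) I → ∀ n,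
      (n ∈ I → ⌈normal L C n y⌉ = ⌈normal L C n v⌉ + 1) ∧
      (n ∉ I → ⌈normal L C n y⌉ = ⌈normal L C n v⌉) := by
    intro I
    by_cases hI : IsFace (normal L C) (bound L C v) I
    · obtain ⟨x, hx, rfl⟩ := hI
      obtain ⟨y, hy, -⟩ := hC.exists_sub_mem_interior_iff x
      refine ⟨y, fun _ n => ?_⟩
      rw [show ⌈normal L C n y⌉ = _ from hy n n.2]
      exact floor_add_one_eq hx n
    · exact ⟨0, fun h => absurd h hI⟩
  choose y hy using this
  exact ⟨y, hy⟩

/-- Together with `subset_of_dominates`: the smaller the closed face, the smaller its open conic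
module, and distinct faces give distinct modules. -/
theorem IsCellPoint.dominates_of_subset {v : V} {y : Finset (primitiveNormals L C) → V}
    (hy : IsCellPoint L C v y) {I J : Finset (primitiveNormals L C)}
    (hI : IsFace (normal L C) (bound L C v) I) (hJ : IsFace (normal L C) (bound L C v) J)
    (hJI : J ⊆ I) : Dominates L C (y I) (y J) := by
  intro n hn
  change ⌈normal L C ⟨n, hn⟩ (y J)⌉ ≤ ⌈normal L C ⟨n, hn⟩ (y I)⌉
  have h1 := hy I hI ⟨n, hn⟩
  have h2 := hy J hJ ⟨n, hn⟩
  by_cases h3 : (⟨n, hn⟩ : primitiveNormals L C) ∈ J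
  · rw [h1.1 (hJI h3), h2.1 h3]
  · rw [h2.2 h3]
    by_cases h4 : (⟨n, hn⟩ : primitiveNormals L C) ∈ I
    · rw [h1.1 h4]; lia
    · rw [h1.2 h4]

theorem IsCellPoint.subset_of_dominates {v : V} {y : Finset (primitiveNormals L C) → V}
    (hy : IsCellPoint L C v y) {I J : Finset (primitiveNormals L C)}
    (hI : IsFace (normal L C) (bound L C v) I) (hJ : IsFace (normal L C) (bound L C v) J)
    (h : Dominates L C (y J) (y I)) : I ⊆ J := by
  intro n hn
  by_contra hnJ
  have h1 : ⌈normal L C n (y I)⌉ ≤ ⌈normal L C n (y J)⌉ := h n n.2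
  rw [(hy I hI n).1 hn, (hy J hJ n).2 hnJ] at h1
  lia

/-- The link between algebra and geometry: a degree `u` dominating the chamber occurs in the module
of the face `I` when `u` exceeds all the bounds active on `I`. -/
theorem IsCellPoint.dominates_iff {v : V} {y : Finset (primitiveNormals L C) → V}
    (hy : IsCellPoint L C v y) {I : Finset (primitiveNormals L C)}
    (hI : IsFace (normal L C) (bound L C v) I) (u : V) :
    Dominates L C u (y I) ↔ Dominates L C u v ∧ ∀ n ∈ I, bound L C v n < normal L C n u := by
  constructor
  · refine fun h => ⟨fun n hn => ?_, fun n hn => ?_⟩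
    · have h1 := hy I hI ⟨n, hn⟩
      have h2 := h n hn
      change ⌈normal L C ⟨n, hn⟩ v⌉ ≤ ⌈normal L C ⟨n, hn⟩ u⌉
      change ⌈normal L C ⟨n, hn⟩ (y I)⌉ ≤ ⌈normal L C ⟨n, hn⟩ u⌉ at h2
      by_cases h3 : (⟨n, hn⟩ : primitiveNormals L C) ∈ I
      · rw [h1.1 h3] at h2; lia
      · rwa [h1.2 h3] at h2
    · have h2 : ⌈normal L C n (y I)⌉ ≤ ⌈normal L C n u⌉ := h n n.2
      rw [(hy I hI n).1 hn, Int.add_one_le_iff, Int.lt_ceil] at h2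
      exact h2
  · rintro ⟨h1, h2⟩ n hn
    change ⌈normal L C ⟨n, hn⟩ (y I)⌉ ≤ ⌈normal L C ⟨n, hn⟩ u⌉
    by_cases h3 : (⟨n, hn⟩ : primitiveNormals L C) ∈ I
    · rw [(hy I hI ⟨n, hn⟩).1 h3, Int.add_one_le_iff, Int.lt_ceil]
      exact h2 _ h3
    · rw [(hy I hI ⟨n, hn⟩).2 h3]
      exact h1 n hn

include hC in
/-- Moving slightly inwards turns the strict inequalities at `u` into all the non-strict ones. -/
theorem IsToricCone.exists_perturbation {u v : V} (h : Dominates L C u v) :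
    ∃ u', (∀ n, bound L C v n - 1 < normal L C n u') ∧
      ∀ n, (bound L C v n < normal L C n u → bound L C v n < normal L C n u') ∧
        (normal L C n u ≤ bound L C v n → normal L C n u' < bound L C v n) := by
  obtain ⟨c, -, hc⟩ := hC.exists_interior_vector
  have hlow : ∀ n, bound L C v n - 1 < normal L C n u := fun n => by
    have h1 : ⌈normal L C n v⌉ ≤ ⌈normal L C n u⌉ := h n n.2
    have h2 := Int.ceil_lt_add_one (normal L C n u)
    have h3 : (⌈normal L C n v⌉ : ℝ) ≤ ⌈normal L C n u⌉ := by exact_mod_cast h1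
    rw [bound]
    linarith
  obtain ⟨η, hη, h1, h2, h3⟩ := exists_mem_region hlow (-c)
  refine ⟨u + η • -c, h1, fun n => ⟨h3 n, fun h4 => ?_⟩⟩
  rw [map_add, map_smul, map_neg, smul_eq_mul]
  have : 0 < η * normal L C n c := mul_pos hη (hc n n.2)
  linarith

include hC in
/-- In a degree `u` outside of the chamber of `v`, the cellular complex of open conic modules is
exact. -/
theorem IsCellPoint.exists_boundary [FiniteDimensional ℝ V] {𝕜 : Type*} [Field 𝕜] {v : V}
    {y : Finset (primitiveNormals L C) → V}
    (hy : IsCellPoint L C v y)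
    {ε : Finset (primitiveNormals L C) → Finset (primitiveNormals L C) → ℤ}
    (hε : IsIncidence (normal L C) (bound L C v) ε) (u : V)
    (c : Finset (primitiveNormals L C) → 𝕜)
    (hc : ∀ I, c I ≠ 0 → IsFace (normal L C) (bound L C v) I ∧ Dominates L C u (y I))
    (hc0 : ∀ J, ∑ I, (ε I J : 𝕜) * c I = 0) (h0 : c ∅ ≠ 0 → ¬ Dominates L C v u) :
    ∃ b : Finset (primitiveNormals L C) → 𝕜,
      (∀ I, b I ≠ 0 → IsFace (normal L C) (bound L C v) I ∧ Dominates L C u (y I)) ∧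
      (∀ J, ∑ I, (ε I J : 𝕜) * b I = c J) ∧ (c = 0 → b = 0) := by
  classical
  by_cases hc' : c = 0
  -- The zero cycle gets the zero chain, so that chains chosen degree by degree are non-zero in
  -- finitely many degrees only.
  · exact ⟨0, fun I h => absurd rfl h, fun J => by simp [hc'], fun _ => rfl⟩
  obtain ⟨I₀, hI₀⟩ := Function.ne_iff.1 hc'
  obtain ⟨hI₀f, hI₀d⟩ := hc I₀ hI₀
  have huv : Dominates L C u v := ((hy.dominates_iff hI₀f u).1 hI₀d).1
  -- At `u'` no constraint is exactly tight, and the violated ones are those strictly exceeded at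
  -- `u`. So the faces visible from `u'` are those whose module contains the degree `u`.
  obtain ⟨u', hlow, hu'⟩ := hC.exists_perturbation huv
  have hvis : ∀ I, Visible (normal L C) (bound L C v) u' I ↔
      IsFace (normal L C) (bound L C v) I ∧ Dominates L C u (y I) := by
    intro I
    refine and_congr_right fun hI => ?_
    rw [hy.dominates_iff hI u]
    have h1 : ∀ n, bound L C v n ≤ normal L C n u' ↔ bound L C v n < normal L C n u := fun n => by
      refine ⟨fun h => ?_, fun h => ((hu' n).1 h).le⟩
      by_contra h'
      exact absurd ((hu' n).2 (not_lt.1 h')) (not_lt.2 h)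
    have h2 : active (normal L C) (bound L C v) u' ⊆ I := by
      intro n hn
      have h3 := mem_active.1 hn
      have h4 := (hu' n).1 ((h1 n).1 h3.ge)
      exact absurd h3 h4.ne'
    exact ⟨fun h => ⟨huv, fun n hn => (h1 n).1 (h.2 n hn)⟩,
      fun h => ⟨h2, fun n hn => (h1 n).2 (h.2 n hn)⟩⟩
  -- If nothing were violated, `u` would lie in the chamber of `v` and only the open cell would
  -- contribute, which `h0` excludes.
  have hpos : ∃ n, bound L C v n < normal L C n u' := by
    by_contra hneg
    push Not at hneg
    have hle : ∀ n, normal L C n u ≤ bound L C v n := fun n => by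
      by_contra h
      exact absurd ((hu' n).1 (not_le.1 h)) (not_lt.2 (hneg n))
    have hI₀e : I₀ = ∅ := by
      refine Finset.eq_empty_of_forall_notMem fun n hn => ?_
      exact absurd (((hy.dominates_iff hI₀f u).1 hI₀d).2 n hn) (not_lt.2 (hle n))
    rw [hI₀e] at hI₀
    exact h0 hI₀ fun n hn => Int.ceil_le.2 (hle ⟨n, hn⟩)
  obtain ⟨b, hb, hbc⟩ := exactOn_visible 𝕜 hε u' hlow hpos c (fun I hI => (hvis I).2 (hc I hI))
    fun J _ => hc0 J
  refine ⟨b, fun I hI => (hvis I).1 (hb I hI), fun J => ?_, fun h => absurd h hc'⟩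
  by_cases hJ : Visible (normal L C) (bound L C v) u' J
  · exact hbc J hJ
  · have h1 : c J = 0 := by
      by_contra h
      exact hJ ((hvis J).2 (hc J h))
    rw [h1]
    refine Finset.sum_eq_zero fun I _ => ?_
    by_contra h
    have h2 : ε I J ≠ 0 := by
      rintro h2
      rw [h2] at h
      simp at h
    obtain ⟨hI, hJf, hJI, -⟩ := hε.of_ne_zero I J h2
    have h3 := ((hvis I).1 (hb I (right_ne_zero_of_mul h))).2
    exact hJ ((hvis J).2 ⟨hJf, h3.trans (hy.dominates_of_subset hI hJf hJI)⟩)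

end CellComplex

/-! ### Ext from a minimal resolution -/

section Resolution

open CategoryTheory CategoryTheory.Limits CategoryTheory.Abelian

universe w₁ w₂ w₃ t

variable {𝕜 : Type t} [CommRing 𝕜] {A : Type w₁} [Category.{w₂} A] [Abelian A] [Linear 𝕜 A]
  [HasExt.{w₃} A]

/-- A projective resolution `⋯ → P 1 → P 0 → S` computes `Ext(S, Y)` without any cohomology being
taken when all the differentials induce zero on morphisms to `Y`. -/
theorem nonempty_ext_linearEquiv {Y : A} (n : ℕ) {S : A} {P : ℕ → A} [∀ k, Projective (P k)]
    (d : ∀ k, P (k + 1) ⟶ P k) (e : P 0 ⟶ S) [Epi e] (h0 : d 0 ≫ e = 0)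
    (hd : ∀ k, d (k + 1) ≫ d k = 0) (h0' : (ShortComplex.mk _ _ h0).Exact)
    (hd' : ∀ k, (ShortComplex.mk _ _ (hd k)).Exact)
    (hY : ∀ k (φ : P k ⟶ Y), d k ≫ φ = 0) :
    Nonempty (Ext S Y n ≃ₗ[𝕜] (P n ⟶ Y)) := by
  have hSE : (ShortComplex.mk (kernel.ι e) e (kernel.condition e)).ShortExact :=
    { exact := ShortComplex.exact_kernel e }
  let e' : P 1 ⟶ kernel e := kernel.lift e (d 0) h0
  have he' : e' ≫ kernel.ι e = d 0 := kernel.lift_ι e (d 0) h0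
  have : Epi e' := (ShortComplex.exact_iff_epi_kernel_lift _).1 h0'
  have hι : ∀ φ : P 0 ⟶ Y, kernel.ι e ≫ φ = 0 := fun φ => by
    rw [← cancel_epi e', comp_zero, ← Category.assoc, he', hY]
  induction n generalizing S P with
  | zero =>
    let F : (S ⟶ Y) →ₗ[𝕜] (P 0 ⟶ Y) := Linear.leftComp 𝕜 Y e
    refine ⟨(Ext.linearEquiv₀ (R := 𝕜)).trans (LinearEquiv.ofBijective F ⟨?_, fun φ => ?_⟩)⟩
    · intro φ ψ h
      exact (cancel_epi e).1 h
    · exact ⟨hSE.exact.desc φ (hι φ), hSE.exact.g_desc φ (hι φ)⟩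
  | succ n ih =>
    let F : Ext (kernel e) Y n →ₗ[𝕜] Ext S Y (n + 1) :=
      hSE.extClass.precompOfLinear 𝕜 Y (add_comm 1 n)
    have hF : Function.Bijective F := by
      -- Dimension shifting along `kernel e → P 0 → S`. Positive Ext groups of `P 0` vanish, which
      -- gives surjectivity and, for positive `n`, injectivity. For `n = 0`, injectivity needs
      -- minimality: morphisms to `Y` that extend to `P 0` are zero on `kernel e`.
      constructor
      · rw [injective_iff_map_eq_zero]
        intro x hx
        obtain ⟨y, rfl⟩ := Ext.contravariant_sequence_exact₁ hSE Y x (add_comm 1 n) hx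
        cases n with
        | zero =>
          obtain ⟨φ, rfl⟩ := (Ext.mk₀_bijective _ _).2 y
          rw [Ext.mk₀_comp_mk₀]
          exact (congrArg Ext.mk₀ (hι φ)).trans (Ext.mk₀_zero _ _)
        | succ n => rw [Ext.eq_zero_of_projective y, Ext.comp_zero]
      · intro x
        exact Ext.contravariant_sequence_exact₃ hSE Y x (Ext.eq_zero_of_projective _)
          (add_comm 1 n)
    have h1 : d 1 ≫ e' = 0 := by
      rw [← cancel_mono (kernel.ι e), Category.assoc, he', hd, zero_comp]
    -- Replacing the target `P 0` by its subobject `kernel e` does not affect exactness at `P 1`.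
    have h1' : (ShortComplex.mk _ _ h1).Exact := by
      let f : ShortComplex.mk _ _ h1 ⟶ ShortComplex.mk _ _ (hd 0) :=
        { τ₁ := 𝟙 _, τ₂ := 𝟙 _, τ₃ := kernel.ι e, comm₁₂ := by simp, comm₂₃ := by simp [he'] }
      have : Epi f.τ₁ := inferInstanceAs (Epi (𝟙 _))
      have : IsIso f.τ₂ := inferInstanceAs (IsIso (𝟙 _))
      have : Mono f.τ₃ := inferInstanceAs (Mono (kernel.ι e))
      exact (ShortComplex.exact_iff_of_epi_of_isIso_of_mono f).2 (hd' 0)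
    have key := ih (S := kernel e) (P := fun k => P (k + 1)) (fun k => d (k + 1)) e' h1
      (fun k => hd (k + 1)) h1' (fun k => hd' (k + 1)) (fun k => hY (k + 1))
      { exact := ShortComplex.exact_kernel e' } (kernel.lift_ι _ _ _)
      ((ShortComplex.exact_iff_epi_kernel_lift _).1 h1') (fun φ => by
        have : Epi (kernel.lift e' (d 1) h1) := (ShortComplex.exact_iff_epi_kernel_lift _).1 h1'
        rw [← cancel_epi (kernel.lift e' (d 1) h1), comp_zero, ← Category.assoc,
          kernel.lift_ι, hY])
    exact key.map fun E => (LinearEquiv.ofBijective F hF).symm.trans E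

end Resolution

/-! ### The cellular complex of projective modules -/

section CellModules

theorem projective_pi {A κ : Type*} [Semiring A] [Finite κ] (X : κ → Type*)
    [∀ k, AddCommMonoid (X k)] [∀ k, Module A (X k)] [∀ k, Module.Projective A (X k)] :
    Module.Projective A (∀ k, X k) := by
  classical
  have := Fintype.ofFinite κ
  exact Module.Projective.of_equiv (DirectSum.linearEquivFunOnFintype A κ X)

theorem codim_empty {V ν : Type*} [AddCommGroup V] [Module ℝ V] (f : ν → Module.Dual ℝ V) :
    codim f ∅ = 0 := by
  rw [codim, conormal, Finset.coe_empty, Set.image_empty, Submodule.span_empty, finrank_bot]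

variable {𝕜 : Type u} [Field 𝕜] {V : Type v} [NormedAddCommGroup V] [NormedSpace ℝ V]
  {L : Submodule ℤ V} {C : PointedCone ℝ V} {ι : Type} {w : ι → V}
  [Fintype (primitiveNormals L C)]

variable (L C) in
/-- The cells of codimension `k` in the chamber of `v`, given by their active sets. -/
abbrev Face (v : V) (k : ℕ) : Type v :=
  {I : Finset (primitiveNormals L C) //
    IsFace (normal L C) (bound L C v) I ∧ codim (normal L C) I = k}

instance (v : V) (k : ℕ) : Fintype (Face L C v k) := Fintype.ofFinite _

variable (𝕜 L C w) in
/-- The direct sum of the projective modules of the cells of codimension `k`. -/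
abbrev CellModule (v : V) (y : Finset (primitiveNormals L C) → V) (k : ℕ) : Type (max u v) :=
  ∀ I : Face L C v k, projModule 𝕜 L C w (y I.1)

open Classical in
/-- The coefficients in degree `m` of the `i`-th components of the symbols. -/
def cellCoeff {v : V} {y : Finset (primitiveNormals L C) → V} {k : ℕ}
    (c : CellModule 𝕜 L C w v y k) (i : ι) (m : L) (I : Finset (primitiveNormals L C)) : 𝕜 :=
  if h : IsFace (normal L C) (bound L C v) I ∧ codim (normal L C) I = k then
    (symbol (c ⟨I, h⟩) i).coeff m else 0

theorem cellCoeff_face {v : V} {y : Finset (primitiveNormals L C) → V} {k : ℕ}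
    (c : CellModule 𝕜 L C w v y k) (i : ι) (m : L) (I : Face L C v k) :
    cellCoeff c i m I.1 = (symbol (c I) i).coeff m := dif_pos I.2

theorem of_cellCoeff_ne_zero {v : V} {y : Finset (primitiveNormals L C) → V} {k : ℕ}
    {c : CellModule 𝕜 L C w v y k} {i : ι} {m : L} {I : Finset (primitiveNormals L C)}
    (h : cellCoeff c i m I ≠ 0) :
    ∃ h' : IsFace (normal L C) (bound L C v) I ∧ codim (normal L C) I = k,
      (symbol (c ⟨I, h'⟩) i).coeff m ≠ 0 := by
  by_cases h' : IsFace (normal L C) (bound L C v) I ∧ codim (normal L C) I = k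
  · rw [cellCoeff, dif_pos h'] at h
    exact ⟨h', h⟩
  · rw [cellCoeff, dif_neg h'] at h
    exact absurd rfl h

/-- Coefficients are extended by zero to all subsets of normals, so that the combinatorial exactness
statements apply without indexing by codimension. -/
theorem sum_mul_cellCoeff {v : V} {y : Finset (primitiveNormals L C) → V} {k : ℕ}
    (c : CellModule 𝕜 L C w v y k) (i : ι) (m : L) (a : Finset (primitiveNormals L C) → 𝕜) :
    ∑ I, a I * cellCoeff c i m I = ∑ I : Face L C v k, a I.1 * (symbol (c I) i).coeff m := by
  classical
  simp only [← cellCoeff_face]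
  refine (Finset.sum_of_injOn (fun I : Face L C v k => I.1) (fun I _ J _ h => Subtype.ext h)
    (fun _ _ => Finset.mem_coe.2 (Finset.mem_univ _)) (fun I _ hI => ?_) fun _ _ => rfl).symm
  rw [cellCoeff, dif_neg, mul_zero]
  exact fun h => hI ⟨⟨I, h⟩, Finset.mem_coe.2 (Finset.mem_univ _), rfl⟩

variable [FiniteDimensional ℝ V] [DiscreteTopology L] [IsZLattice ℝ L] (hC : IsToricCone L C)
  [Fintype ι]

/-- The differential of the cellular complex of projective modules. -/
def cellBoundary (𝕜 : Type u) [Field 𝕜] (w : ι → V) (v : V)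
    (y : Finset (primitiveNormals L C) → V)
    (ε : Finset (primitiveNormals L C) → Finset (primitiveNormals L C) → ℤ) (k : ℕ) :
    CellModule 𝕜 L C w v y (k + 1) →ₗ[(conicEnd 𝕜 L C w)ᵐᵒᵖ] CellModule 𝕜 L C w v y k :=
  LinearMap.pi fun J => ∑ I : Face L C v (k + 1),
    ε I.1 J.1 • (incl hC 𝕜 w (y I.1) (y J.1)).comp (LinearMap.proj I)

omit [Fintype ι] in
theorem cellBoundary_apply {v : V} {y : Finset (primitiveNormals L C) → V}
    {ε : Finset (primitiveNormals L C) → Finset (primitiveNormals L C) → ℤ} {k : ℕ}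
    (c : CellModule 𝕜 L C w v y (k + 1)) (J : Face L C v k) :
    cellBoundary hC 𝕜 w v y ε k c J =
      ∑ I : Face L C v (k + 1), ε I.1 J.1 • incl hC 𝕜 w (y I.1) (y J.1) (c I) := by
  rw [cellBoundary, LinearMap.pi_apply, LinearMap.sum_apply]
  rfl

variable {v : V} {y : Finset (primitiveNormals L C) → V} (hy : IsCellPoint L C v y)
  {ε : Finset (primitiveNormals L C) → Finset (primitiveNormals L C) → ℤ}
  (hε : IsIncidence (normal L C) (bound L C v) ε)

omit [Fintype ι] in
include hC in
theorem dominates_of_cellCoeff {k : ℕ} {c : CellModule 𝕜 L C w v y k} {i : ι} {m : L}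
    {I : Finset (primitiveNormals L C)} (h : cellCoeff c i m I ≠ 0) :
    IsFace (normal L C) (bound L C v) I ∧ Dominates L C (w i + m) (y I) := by
  obtain ⟨h', h⟩ := of_cellCoeff_ne_zero h
  exact ⟨h'.1, dominates_of_symbol hC _ h⟩

include hC in
theorem cellModule_ext {k : ℕ} {c c' : CellModule 𝕜 L C w v y k}
    (h : ∀ i m I, cellCoeff c i m I = cellCoeff c' i m I) : c = c' := by
  funext I
  refine symbol_injective hC (funext fun i => AddMonoidAlgebra.ext (Finsupp.ext fun m => ?_))
  rw [← cellCoeff_face, ← cellCoeff_face, h]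

include hC in
theorem cellCoeff_zero {k : ℕ} (i : ι) (m : L) (I : Finset (primitiveNormals L C)) :
    cellCoeff (0 : CellModule 𝕜 L C w v y k) i m I = 0 := by
  by_contra h
  obtain ⟨h', h⟩ := of_cellCoeff_ne_zero h
  have h1 : symbol (0 : projModule 𝕜 L C w (y I)) = 0 := (symbolHom hC w (y I)).map_zero
  change (symbol (0 : projModule 𝕜 L C w (y I)) i).coeff m ≠ 0 at h
  rw [h1] at h
  exact h rfl

include hy hε in
-- Inclusions do not change symbols, so in each bidegree the differential is the scalar cellular
-- boundary.
theorem cellCoeff_cellBoundary {k : ℕ} (c : CellModule 𝕜 L C w v y (k + 1)) (i : ι) (m : L)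
    (J : Finset (primitiveNormals L C)) :
    cellCoeff (cellBoundary hC 𝕜 w v y ε k c) i m J = ∑ I, (ε I J : 𝕜) * cellCoeff c i m I := by
  by_cases hJ : IsFace (normal L C) (bound L C v) J ∧ codim (normal L C) J = k
  · rw [sum_mul_cellCoeff, cellCoeff, dif_pos hJ, cellBoundary_apply]
    have h1 := congrFun (map_sum (symbolHom hC w (y J)) (fun I : Face L C v (k + 1) =>
      ε I.1 J • incl hC 𝕜 w (y I.1) (y J) (c I)) Finset.univ) i
    refine (congrArg (fun F : Laurent 𝕜 L => F.coeff m) h1).trans ?_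
    rw [Finset.sum_apply, coeff_sum_apply]
    refine Finset.sum_congr rfl fun I _ => ?_
    rw [map_zsmul]
    by_cases hIJ : ε I.1 J = 0
    · rw [hIJ]; simp
    · obtain ⟨hI, hJ', hJI, -⟩ := hε.of_ne_zero I.1 J hIJ
      change (ε I.1 J • symbol (incl hC 𝕜 w (y I.1) (y J) (c I)) i).coeff m = _
      rw [symbol_incl hC (hy.dominates_of_subset hI hJ' hJI), AddMonoidAlgebra.coeff_smul,
        Finsupp.smul_apply, zsmul_eq_mul]
  · rw [cellCoeff, dif_neg hJ]
    refine (Finset.sum_eq_zero fun I _ => ?_).symm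
    by_contra h
    have h2 : ε I J ≠ 0 := by
      rintro h2
      rw [h2] at h
      simp at h
    obtain ⟨hI, -⟩ := of_cellCoeff_ne_zero (right_ne_zero_of_mul h)
    obtain ⟨-, hJ', -, hc⟩ := hε.of_ne_zero I J h2
    exact hJ ⟨hJ', by lia⟩

include hy hε in
theorem cellBoundary_cellBoundary {k : ℕ} (c : CellModule 𝕜 L C w v y (k + 1 + 1)) :
    cellBoundary hC 𝕜 w v y ε k (cellBoundary hC 𝕜 w v y ε (k + 1) c) = 0 := by
  refine cellModule_ext hC fun i m K => ?_
  rw [cellCoeff_zero hC, cellCoeff_cellBoundary hC hy hε]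
  simp only [cellCoeff_cellBoundary hC hy hε, Finset.mul_sum]
  rw [Finset.sum_comm]
  refine Finset.sum_eq_zero fun I _ => ?_
  have h1 := congrArg (Int.cast : ℤ → 𝕜) (hε.sum_mul I K)
  push_cast at h1
  calc ∑ J, (ε J K : 𝕜) * ((ε I J : 𝕜) * cellCoeff c i m I)
      = (∑ J, (ε I J : 𝕜) * (ε J K : 𝕜)) * cellCoeff c i m I := by
        rw [Finset.sum_mul]
        exact Finset.sum_congr rfl fun J _ => by ring
    _ = 0 := by rw [h1, zero_mul]

include hy hε in
-- Solve degree by degree with `IsCellPoint.exists_boundary`, then assemble the solutions. The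
-- hypothesis `hc0` excludes the degrees in the chamber itself, where the open cell contributes the
-- homology `S_v`.
theorem exists_cellBoundary_eq {k : ℕ} (c : CellModule 𝕜 L C w v y k)
    (hc : ∀ i m J, ∑ I, (ε I J : 𝕜) * cellCoeff c i m I = 0)
    (hc0 : ∀ i (m : L), cellCoeff c i m ∅ ≠ 0 → ¬ Dominates L C v (w i + m)) :
    ∃ b, cellBoundary hC 𝕜 w v y ε k b = c := by
  classical
  choose b hb hbc hb0 using fun i (m : L) => hy.exists_boundary hC hε (w i + m)
    (cellCoeff c i m) (fun I h => dominates_of_cellCoeff hC h) (hc i m) (hc0 i m)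
  -- Outside these degrees the cycle is zero, hence so is the chosen chain; this makes the assembled
  -- symbols Laurent polynomials.
  let S : ι → Finset L := fun i => Finset.univ.biUnion fun J => (symbol (c J) i).coeff.support
  have hS : ∀ i m I, b i m I ≠ 0 → m ∈ S i := by
    intro i m I h
    by_contra hm
    refine h (congrFun (hb0 i m (funext fun J => ?_)) I)
    by_contra hJ
    obtain ⟨hJ', hJ⟩ := of_cellCoeff_ne_zero hJ
    exact hm (Finset.mem_biUnion.2 ⟨⟨J, hJ'⟩, Finset.mem_univ _, Finsupp.mem_support_iff.2 hJ⟩)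
  have h1 : ∀ I : Face L C v (k + 1), ∃ f : projModule 𝕜 L C w (y I.1), symbol f = fun i =>
      AddMonoidAlgebra.ofCoeff (Finsupp.onFinset (S i) (fun m => b i m I.1) (hS i · I.1)) :=
    fun I => exists_symbol_eq hC _ fun i m h => (hb i m I.1 h).2
  choose f hf using h1
  have hfb : ∀ i m (I : Finset (primitiveNormals L C)),
      IsFace (normal L C) (bound L C v) I ∧ codim (normal L C) I = k + 1 →
      cellCoeff f i m I = b i m I := by
    intro i m I hI
    rw [cellCoeff, dif_pos hI, hf]
    rfl
  refine ⟨f, cellModule_ext hC fun i m J => ?_⟩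
  rw [cellCoeff_cellBoundary hC hy hε]
  -- The chain `b` may have components in other codimensions. Only those of codimension `k + 1` are
  -- kept, since only they have non-zero incidence with faces of codimension `k`.
  by_cases hJ : codim (normal L C) J = k
  · rw [← hbc]
    refine Finset.sum_congr rfl fun I _ => ?_
    by_cases hIJ : ε I J = 0
    · rw [hIJ]; simp
    · obtain ⟨hI, -, -, hcod⟩ := hε.of_ne_zero I J hIJ
      rw [hfb i m I ⟨hI, by lia⟩]
  · rw [show cellCoeff c i m J = 0 from dif_neg fun h => hJ h.2]
    refine Finset.sum_eq_zero fun I _ => ?_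
    by_contra h
    have h2 : ε I J ≠ 0 := by
      rintro h2
      rw [h2] at h
      simp at h
    obtain ⟨hI, -⟩ := of_cellCoeff_ne_zero (right_ne_zero_of_mul h)
    obtain ⟨-, -, -, hcod⟩ := hε.of_ne_zero I J h2
    exact hJ (by lia)

include hy hε in
-- The excluded degrees concern only the open cell `∅`, which is absent in positive codimension.
theorem cellBoundary_exact {k : ℕ} (c : CellModule 𝕜 L C w v y (k + 1))
    (hc : cellBoundary hC 𝕜 w v y ε k c = 0) :
    ∃ b, cellBoundary hC 𝕜 w v y ε (k + 1) b = c := by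
  refine exists_cellBoundary_eq hC hy hε c (fun i m J => ?_) fun i m h => ?_
  · rw [← cellCoeff_cellBoundary hC hy hε, hc]
    exact cellCoeff_zero hC i m J
  · obtain ⟨h', -⟩ := of_cellCoeff_ne_zero h
    exact absurd h'.2 (by rw [codim_empty]; lia)

end CellModules

/-! ### The minimal projective resolution of the simple module -/

section CellResolution

open CategoryTheory

variable {𝕜 : Type u} [Field 𝕜] {V : Type v} [NormedAddCommGroup V] [NormedSpace ℝ V]
  {L : Submodule ℤ V} {C : PointedCone ℝ V} {ι : Type} {w : ι → V}
  [Fintype (primitiveNormals L C)]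
  [FiniteDimensional ℝ V] [DiscreteTopology L] [IsZLattice ℝ L] (hC : IsToricCone L C)
  [Fintype ι]

omit [DiscreteTopology L] [IsZLattice ℝ L] [FiniteDimensional ℝ V] in
include hC in
theorem IsToricCone.isFace_empty (v : V) : IsFace (normal L C) (bound L C v) ∅ := by
  obtain ⟨x, h1, h2⟩ := hC.exists_perturbation (dominates_refl (L := L) (C := C) v)
  have h3 : ∀ n, normal L C n x < bound L C v n := fun n => (h2 n).2 (Int.le_ceil _)
  exact ⟨x, fun n => ⟨h1 n, (h3 n).le⟩,
    Finset.eq_empty_of_forall_notMem fun n hn => (h3 n).ne (mem_active.1 hn)⟩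

/-- The open cell of the chamber. -/
def topFace (v : V) : Face L C v 0 := ⟨∅, hC.isFace_empty v, codim_empty _⟩

/-- The augmentation onto the simple module. -/
def cellAugmentation (𝕜 : Type u) [Field 𝕜] (w : ι → V) (v : V)
    (y : Finset (primitiveNormals L C) → V) :
    CellModule 𝕜 L C w v y 0 →ₗ[(conicEnd 𝕜 L C w)ᵐᵒᵖ]
      projModule 𝕜 L C w v ⧸ maximalGradedSubmodule 𝕜 L C w v :=
  (maximalGradedSubmodule 𝕜 L C w v).mkQ.comp
    ((incl hC 𝕜 w (y (topFace hC v).1) v).comp (LinearMap.proj (topFace hC v)))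

variable {v : V} {y : Finset (primitiveNormals L C) → V} (hy : IsCellPoint L C v y)
  {ε : Finset (primitiveNormals L C) → Finset (primitiveNormals L C) → ℤ}
  (hε : IsIncidence (normal L C) (bound L C v) ε)

omit [FiniteDimensional ℝ V] [DiscreteTopology L] [IsZLattice ℝ L] in
include hC hy in
theorem IsCellPoint.dominates_empty_iff (u : V) : Dominates L C u (y ∅) ↔ Dominates L C u v := by
  rw [hy.dominates_iff (hC.isFace_empty v)]
  exact and_iff_left fun n hn => absurd hn (Finset.notMem_empty n)

include hy in
-- The kernel of the augmentation consists exactly of the elements avoiding the degrees excluded in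
-- `exists_cellBoundary_eq`.
theorem cellAugmentation_eq_zero_iff (hw : IsComplete 𝕜 L C w) (c : CellModule 𝕜 L C w v y 0) :
    cellAugmentation hC 𝕜 w v y c = 0 ↔
      ∀ i (m : L), cellCoeff c i m ∅ ≠ 0 → ¬ Dominates L C v (w i + m) := by
  have h1 : Dominates L C (y (topFace hC v).1) v :=
    (hy.dominates_empty_iff hC _).1 (dominates_refl _)
  have h2 : cellAugmentation hC 𝕜 w v y c =
      (maximalGradedSubmodule 𝕜 L C w v).mkQ (incl hC 𝕜 w (y (topFace hC v).1) v (c (topFace hC v))) := rfl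
  rw [h2, Submodule.mkQ_apply, Submodule.Quotient.mk_eq_zero, hw.mem_maximalGradedSubmodule hC,
    symbol_incl hC h1]
  exact forall₂_congr fun i m => by rw [← cellCoeff_face c i m (topFace hC v)]; rfl

include hy in
theorem cellAugmentation_surjective :
    Function.Surjective (cellAugmentation hC 𝕜 w v y) := by
  classical
  intro s
  obtain ⟨f, rfl⟩ := (maximalGradedSubmodule 𝕜 L C w v).mkQ_surjective s
  obtain ⟨g, hg⟩ := exists_symbol_eq (w := w) (v := y (topFace hC v).1) hC (symbol f) fun i m h =>
    (hy.dominates_empty_iff hC _).2 (dominates_of_symbol hC f h)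
  have h1 : Dominates L C (y (topFace hC v).1) v :=
    (hy.dominates_empty_iff hC _).1 (dominates_refl _)
  refine ⟨Pi.single (topFace hC v) g, ?_⟩
  change (maximalGradedSubmodule 𝕜 L C w v).mkQ (incl hC 𝕜 w (y (topFace hC v).1) v
    ((Pi.single (topFace hC v) g : CellModule 𝕜 L C w v y 0) (topFace hC v))) = _
  rw [Pi.single_eq_same]
  congr 1
  exact symbol_injective hC ((symbol_incl hC h1 g).trans hg)

include hy hε in
-- A face of codimension one has a module strictly smaller than `A_v`, so none of its monomials is
-- an isomorphism onto `A_v`.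
theorem cellAugmentation_cellBoundary (hw : IsComplete 𝕜 L C w)
    (c : CellModule 𝕜 L C w v y 1) :
    cellAugmentation hC 𝕜 w v y (cellBoundary hC 𝕜 w v y ε 0 c) = 0 := by
  rw [cellAugmentation_eq_zero_iff hC hy hw]
  intro i m h hv
  rw [cellCoeff_cellBoundary hC hy hε] at h
  obtain ⟨I, -, hI⟩ := Finset.exists_ne_zero_of_sum_ne_zero h
  obtain ⟨hIf, hId⟩ := dominates_of_cellCoeff hC (right_ne_zero_of_mul hI)
  have h1 : Dominates L C (y ∅) (y I) :=
    (((hy.dominates_empty_iff hC _).1 (dominates_refl _)).trans hv).trans hId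
  have h2 := hy.subset_of_dominates hIf (hC.isFace_empty v) h1
  obtain ⟨h', -⟩ := of_cellCoeff_ne_zero (right_ne_zero_of_mul hI)
  rw [Finset.subset_empty.1 h2, codim_empty] at h'
  exact absurd h'.2 (by lia)

include hy hε in
theorem exists_cellBoundary_of_cellAugmentation (hw : IsComplete 𝕜 L C w)
    (c : CellModule 𝕜 L C w v y 0) (hc : cellAugmentation hC 𝕜 w v y c = 0) :
    ∃ b, cellBoundary hC 𝕜 w v y ε 0 b = c := by
  refine exists_cellBoundary_eq hC hy hε c (fun i m J => ?_)
    ((cellAugmentation_eq_zero_iff hC hy hw c).1 hc)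
  refine Finset.sum_eq_zero fun I _ => ?_
  by_contra h
  obtain ⟨h', -⟩ := of_cellCoeff_ne_zero (right_ne_zero_of_mul h)
  have h2 : ε I J ≠ 0 := by
    rintro h2
    rw [h2] at h
    simp at h
  obtain ⟨-, -, -, h3⟩ := hε.of_ne_zero I J h2
  lia

include hy hε in
-- Minimality: the components of the differential are multiples of strict inclusions, and these are
-- killed by every map to a simple module.
theorem comp_cellBoundary_eq_zero (hw : IsComplete 𝕜 L C w) {v' : V} {k : ℕ}
    (φ : CellModule 𝕜 L C w v y k →ₗ[(conicEnd 𝕜 L C w)ᵐᵒᵖ]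
      projModule 𝕜 L C w v' ⧸ maximalGradedSubmodule 𝕜 L C w v')
    (c : CellModule 𝕜 L C w v y (k + 1)) : φ (cellBoundary hC 𝕜 w v y ε k c) = 0 := by
  classical
  rw [← Finset.univ_sum_single (cellBoundary hC 𝕜 w v y ε k c), map_sum]
  refine Finset.sum_eq_zero fun J _ => ?_
  change φ.comp (LinearMap.single _ (fun J : Face L C v k => projModule 𝕜 L C w (y J.1)) J)
    (cellBoundary hC 𝕜 w v y ε k c J) = 0
  rw [cellBoundary_apply, map_sum]
  refine Finset.sum_eq_zero fun I _ => ?_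
  rw [map_zsmul]
  by_cases hIJ : ε I.1 J.1 = 0
  · rw [hIJ, zero_smul]
  · obtain ⟨hI, hJ, hJI, hcod⟩ := hε.of_ne_zero _ _ hIJ
    rw [hw.comp_incl_eq_zero hC (hy.dominates_of_subset hI hJ hJI), smul_zero]
    intro h
    rw [(hy.subset_of_dominates hI hJ h).antisymm hJI] at hcod
    lia

/-- The cellular complex, as a complex in the category of modules. -/
abbrev cellObj (𝕜 : Type u) [Field 𝕜] (L : Submodule ℤ V) (C : PointedCone ℝ V)
    [Fintype (primitiveNormals L C)] (w : ι → V) (v : V)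
    (y : Finset (primitiveNormals L C) → V) (k : ℕ) :
    ModuleCat.{max u v} (conicEnd 𝕜 L C w)ᵐᵒᵖ :=
  ModuleCat.of _ (CellModule 𝕜 L C w v y k)

include hC hy hε in
theorem nonempty_ext_simpleModule (hw : IsComplete 𝕜 L C w) (v' : V) (k : ℕ) :
    Nonempty (Abelian.Ext (simpleModule 𝕜 L C w v) (simpleModule 𝕜 L C w v') k ≃ₗ[𝕜]
      (cellObj 𝕜 L C w v y k ⟶ simpleModule 𝕜 L C w v')) := by
  have hproj : ∀ k, Projective (cellObj 𝕜 L C w v y k) := fun k => by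
    have := fun I : Face L C v k => hw.projective (y I.1)
    have := projective_pi (A := (conicEnd 𝕜 L C w)ᵐᵒᵖ)
      fun I : Face L C v k => projModule 𝕜 L C w (y I.1)
    exact (IsProjective.iff_projective _).1 this
  let e : cellObj 𝕜 L C w v y 0 ⟶ simpleModule 𝕜 L C w v :=
    ModuleCat.ofHom (cellAugmentation hC 𝕜 w v y)
  have he : Epi e := (ModuleCat.epi_iff_surjective _).2 (cellAugmentation_surjective hC hy)
  let d : ∀ k, cellObj 𝕜 L C w v y (k + 1) ⟶ cellObj 𝕜 L C w v y k := fun k =>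
    ModuleCat.ofHom (cellBoundary hC 𝕜 w v y ε k)
  refine nonempty_ext_linearEquiv k d e ?_ ?_ ?_ ?_ ?_
  · exact ModuleCat.hom_ext (LinearMap.ext (cellAugmentation_cellBoundary hC hy hε hw))
  · exact fun k => ModuleCat.hom_ext (LinearMap.ext (cellBoundary_cellBoundary hC hy hε))
  · exact (ShortComplex.moduleCat_exact_iff _).2
      (exists_cellBoundary_of_cellAugmentation hC hy hε hw)
  · exact fun k => (ShortComplex.moduleCat_exact_iff _).2 (cellBoundary_exact hC hy hε)
  · exact fun k φ => ModuleCat.hom_ext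
      (LinearMap.ext (comp_cellBoundary_eq_zero hC hy hε hw φ.hom))

include hC in
theorem rank_hom_simpleModule (hw : IsComplete 𝕜 L C w) (v' : V) (k : ℕ) :
    Module.rank 𝕜 (cellObj 𝕜 L C w v y k ⟶ simpleModule 𝕜 L C w v') =
      (Nat.card {I : Face L C v k // Equivalent L C (y I.1) v'} : Cardinal) := by
  classical
  let Q : Face L C v k → ModuleCat.{max u v} (conicEnd 𝕜 L C w)ᵐᵒᵖ := fun I =>
    ModuleCat.of _ (projModule 𝕜 L C w (y I.1))
  let inj : ∀ I, Q I ⟶ cellObj 𝕜 L C w v y k := fun I => ModuleCat.ofHom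
    (LinearMap.single _ (fun I : Face L C v k => projModule 𝕜 L C w (y I.1)) I)
  let π : ∀ I, cellObj 𝕜 L C w v y k ⟶ Q I := fun I => ModuleCat.ofHom (LinearMap.proj I)
  refine rank_hom_eq_card (𝕜 := 𝕜) inj π (fun I => ?_) (fun I J h => ?_) ?_ (fun I hI φ => ?_)
    fun I hI => ?_
  · exact ModuleCat.hom_ext (LinearMap.ext fun f => Pi.single_eq_same
      (M := fun I : Face L C v k => projModule 𝕜 L C w (y I.1)) I f)
  · exact ModuleCat.hom_ext (LinearMap.ext fun f => Pi.single_eq_of_ne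
      (M := fun I : Face L C v k => projModule 𝕜 L C w (y I.1)) h.symm f)
  · refine ModuleCat.hom_ext (LinearMap.ext fun c => ?_)
    rw [ModuleCat.hom_sum, LinearMap.sum_apply]
    exact Finset.univ_sum_single c
  · exact ModuleCat.hom_ext (hw.hom_eq_zero hC hI φ.hom)
  · obtain ⟨ψ, hψ, hψ'⟩ := hw.exists_hom_ne_zero hC hI
    refine ⟨ModuleCat.ofHom ψ, fun h => hψ (congrArg ModuleCat.Hom.hom h), fun φ => ?_⟩
    obtain ⟨c, hc⟩ := hψ' φ.hom
    exact ⟨c, ModuleCat.hom_ext (LinearMap.ext hc)⟩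

end CellResolution

/-! ### Cells, their codimension, and the count -/

section CountCells

variable {𝕜 : Type u} [Field 𝕜] {V : Type v} [NormedAddCommGroup V] [NormedSpace ℝ V]
  {L : Submodule ℤ V} {C : PointedCone ℝ V} [Fintype (primitiveNormals L C)]

/-- The open cell with a given active set. -/
def cellOf (v : V) (I : Finset (primitiveNormals L C)) : Set V :=
  {x | InRegion (normal L C) (bound L C v) x ∧ active (normal L C) (bound L C v) x = I}

/-- The set `Ω` lists the inactive normals, while faces are indexed by the active ones. -/
theorem cellOf_eq_cellSet (v : V) {I : Finset (primitiveNormals L C)}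
    {Ω : Set (Module.Dual ℝ V)} (hΩ : Ω ⊆ primitiveNormals L C)
    (h : ∀ n : primitiveNormals L C, n ∈ I ↔ normal L C n ∉ Ω) :
    cellSet L C v Ω = cellOf v I := by
  ext x
  constructor
  · rintro ⟨h1, h2⟩
    refine ⟨fun n => ?_, Finset.ext fun n => ?_⟩
    · by_cases hn : n ∈ I
      · have h3 : normal L C n x = bound L C v n := h2 _ n.2 ((h n).1 hn)
        exact ⟨by rw [h3]; linarith, h3.le⟩
      · exact ⟨(h1 _ (not_not.1 fun h' => hn ((h n).2 h'))).1,
          (h1 _ (not_not.1 fun h' => hn ((h n).2 h'))).2.le⟩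
    · rw [mem_active, h n]
      exact ⟨fun h3 h4 => (h1 _ h4).2.ne h3, fun h3 => h2 _ n.2 h3⟩
  · rintro ⟨h1, h2⟩
    refine ⟨fun n hn => ?_, fun n hn hnΩ => ?_⟩
    · have h3 := h1 ⟨n, hΩ hn⟩
      refine ⟨h3.1, lt_of_le_of_ne h3.2 fun h4 => ?_⟩
      have h5 : (⟨n, hΩ hn⟩ : primitiveNormals L C) ∈ I := by
        rw [← h2]; exact mem_active.2 h4
      exact (h _).1 h5 hn
    · have h5 : (⟨n, hn⟩ : primitiveNormals L C) ∈ active (normal L C) (bound L C v) x := by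
        rw [h2]; exact (h _).2 hnΩ
      exact mem_active.1 h5

theorem cellOf_injOn (v : V) :
    Set.InjOn (cellOf (L := L) (C := C) v) {I | IsFace (normal L C) (bound L C v) I} := by
  rintro I ⟨x, hx, hxI⟩ J _ hIJ
  have h : x ∈ cellOf v J := hIJ ▸ ⟨hx, hxI⟩
  rw [← hxI, h.2]

/-- The cell is relatively open: a short move in any direction killed by the active normals stays in
it, so all these directions occur in its affine span. -/
theorem vectorSpan_cellOf {v : V} {I : Finset (primitiveNormals L C)}
    (hI : IsFace (normal L C) (bound L C v) I) :
    vectorSpan ℝ (cellOf v I) = (conormal (normal L C) I).dualCoannihilator := by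
  apply le_antisymm
  · rw [vectorSpan_def, Submodule.span_le]
    rintro _ ⟨x, ⟨-, hx⟩, x', ⟨-, hx'⟩, rfl⟩
    rw [SetLike.mem_coe, Submodule.mem_dualCoannihilator]
    intro n hn
    refine Submodule.span_induction ?_ rfl (fun a b _ _ ha hb => ?_) (fun t a _ ha => ?_) hn
    · rintro _ ⟨n, hnI, rfl⟩
      have h1 : normal L C n x = bound L C v n := mem_active.1 (by rw [hx]; exact hnI)
      have h2 : normal L C n x' = bound L C v n := mem_active.1 (by rw [hx']; exact hnI)
      change normal L C n (x - x') = 0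
      rw [map_sub, h1, h2, sub_self]
    · rw [LinearMap.add_apply, ha, hb, add_zero]
    · rw [LinearMap.smul_apply, ha, smul_zero]
  · intro z hz
    rw [Submodule.mem_dualCoannihilator] at hz
    obtain ⟨x, hx, rfl⟩ := hI
    have h1 : ∀ n, n ∈ active (normal L C) (bound L C v) x → normal L C n z = 0 :=
      fun n hn => hz _ (mem_conormal hn)
    obtain ⟨η, hη0, hlow, hupp, -⟩ := exists_mem_region (fun n => (hx n).1) z
    have h3 : ∀ n, n ∈ active (normal L C) (bound L C v) x →
        normal L C n (x + η • z) = bound L C v n := fun n hn => by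
      rw [map_add, map_smul, h1 n hn, smul_zero, add_zero, mem_active.1 hn]
    have h4 : x + η • z ∈ cellOf v (active (normal L C) (bound L C v) x) := by
      refine ⟨fun n => ⟨hlow n, ?_⟩, Finset.ext fun n => ?_⟩
      · by_cases hn : n ∈ active (normal L C) (bound L C v) x
        · exact (h3 n hn).le
        · exact (hupp n (lt_of_le_of_ne (hx n).2 fun h => hn (mem_active.2 h))).le
      · refine ⟨fun h => ?_, fun h => mem_active.2 (h3 n h)⟩
        by_contra hn
        exact (hupp n (lt_of_le_of_ne (hx n).2 fun h => hn (mem_active.2 h))).ne (mem_active.1 h)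
    have h5 := vsub_mem_vectorSpan ℝ h4
      (show x ∈ cellOf v (active (normal L C) (bound L C v) x) from ⟨hx, rfl⟩)
    rw [vsub_eq_sub, add_sub_cancel_left] at h5
    exact (Submodule.smul_mem_iff _ (ne_of_gt hη0)).1 h5

theorem hasCodim_cellOf_iff [FiniteDimensional ℝ V] {v : V} {I : Finset (primitiveNormals L C)}
    (hI : IsFace (normal L C) (bound L C v) I) (k : ℕ) :
    HasCodim (cellOf v I) k ↔ codim (normal L C) I = k := by
  have h := Subspace.finrank_add_finrank_dualCoannihilator_eq (conormal (normal L C) I)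
  rw [HasCodim, vectorSpan_cellOf hI]
  rw [codim]
  lia

omit [Fintype (primitiveNormals L C)] in
theorem Equivalent.of_dominates {u u' v : V} (h : Equivalent L C u v) (h1 : Dominates L C u u')
    (h2 : Dominates L C u' u) : Equivalent L C u' v := by
  obtain ⟨m, hm, h3, h4⟩ := h
  exact ⟨m, hm, ((dominates_add_right_iff hm).2 h2).trans h3,
    h4.trans ((dominates_add_right_iff hm).2 h1)⟩

variable [FiniteDimensional ℝ V] [DiscreteTopology L] [IsZLattice ℝ L] (hC : IsToricCone L C)

include hC in
-- The open conic module at `x` equals a conic module `A_z`, whose ceilings are those of `y I`.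
theorem IsCellPoint.nonempty_equiv_iff {v v' : V} {y : Finset (primitiveNormals L C) → V}
    (hy : IsCellPoint L C v y) {I : Finset (primitiveNormals L C)} {x : V} (hx : x ∈ cellOf v I) :
    Nonempty (openConicModule 𝕜 L C x ≃ₗ[toricAlgebra 𝕜 L C] conicModule 𝕜 L C v') ↔
      Equivalent L C (y I) v' := by
  obtain ⟨z, hz, hzx⟩ := hC.exists_sub_mem_interior_iff x
  have h1 : openConicModule 𝕜 L C x = conicModule 𝕜 L C z := by
    ext a
    exact forall₂_congr fun m _ => hzx m m.2
  have h2 : ∀ n : primitiveNormals L C, ⌈normal L C n z⌉ = ⌈normal L C n (y I)⌉ := by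
    intro n
    rw [show ⌈normal L C n z⌉ = _ from hz n n.2]
    have h3 := floor_add_one_eq hx.1 n
    rw [hx.2] at h3
    by_cases hn : n ∈ I
    · rw [(hy I ⟨x, hx⟩ n).1 hn]
      exact h3.1 hn
    · rw [(hy I ⟨x, hx⟩ n).2 hn]
      exact h3.2 hn
  rw [h1, hC.nonempty_equiv_iff]
  have h3 : Dominates L C z (y I) := fun n hn => (h2 ⟨n, hn⟩).ge
  have h4 : Dominates L C (y I) z := fun n hn => (h2 ⟨n, hn⟩).le
  exact ⟨fun h => h.of_dominates h3 h4, fun h => h.of_dominates h4 h3⟩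

include hC in
theorem IsCellPoint.cellsOfType_eq {Δ : Set V} (hΔ : IsChamber L C Δ) {v v' : V} (hv : v ∈ Δ)
    {y : Finset (primitiveNormals L C) → V} (hy : IsCellPoint L C v y) (k : ℕ) :
    cellsOfType 𝕜 L C Δ v' k = cellOf v '' {I | (IsFace (normal L C) (bound L C v) I ∧
      codim (normal L C) I = k) ∧ Equivalent L C (y I) v'} := by
  classical
  obtain ⟨v₀, rfl⟩ := hΔ
  ext τ
  constructor
  · rintro ⟨⟨hne, v₁, hv₁, Ω, hΩ, rfl⟩, hcod, heq⟩
    -- The integers `d_n` are constant on a chamber, so the cells do not depend on the point used to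
    -- compute them.
    have h1 : cellSet L C v₁ Ω = cellSet L C v Ω := by
      have h2 : ∀ n ∈ primitiveNormals L C, ⌈n v₁⌉ = ⌈n v⌉ := fun n hn =>
        ((hC.mem_chamber_iff).1 hv₁ n hn).trans ((hC.mem_chamber_iff).1 hv n hn).symm
      ext x
      refine and_congr (forall₂_congr fun n hn => ?_) (forall₂_congr fun n hn => ?_)
      · rw [h2 n (hΩ hn)]
      · rw [h2 n hn]
    have h3 := cellOf_eq_cellSet (C := C) v hΩ
      (I := Finset.univ.filter fun n => normal L C n ∉ Ω) (fun n => by simp)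
    rw [h1, h3] at hne hcod heq
    rw [h1, h3]
    obtain ⟨x, hx⟩ := hne
    exact ⟨_, ⟨⟨⟨x, hx⟩, (hasCodim_cellOf_iff ⟨x, hx⟩ k).1 hcod⟩,
      (hy.nonempty_equiv_iff hC hx).1 (heq x hx)⟩, rfl⟩
  · rintro ⟨I, ⟨⟨hI, hcod⟩, heq⟩, rfl⟩
    refine ⟨⟨hI, v, hv, {n | ∃ h : n ∈ primitiveNormals L C, (⟨n, h⟩ : primitiveNormals L C) ∉ I},
      fun n hn => hn.1, (cellOf_eq_cellSet v (fun n hn => hn.1) fun n => ?_).symm⟩,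
      (hasCodim_cellOf_iff hI k).2 hcod, fun x hx => (hy.nonempty_equiv_iff hC hx).2 heq⟩
    exact ⟨fun h ⟨_, h'⟩ => h' h, fun h => not_not.1 fun h' => h ⟨n.2, h'⟩⟩

include hC in
theorem IsCellPoint.ncard_cellsOfType {Δ : Set V} (hΔ : IsChamber L C Δ) {v v' : V} (hv : v ∈ Δ)
    {y : Finset (primitiveNormals L C) → V} (hy : IsCellPoint L C v y) (k : ℕ) :
    (cellsOfType 𝕜 L C Δ v' k).ncard = Nat.card {I : Face L C v k // Equivalent L C (y I.1) v'} := by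
  rw [hy.cellsOfType_eq hC hΔ hv, ((cellOf_injOn v).mono fun I hI => hI.1.1).ncard_image, ← Nat.card_coe_set_eq]
  exact Nat.card_congr (Equiv.subtypeSubtypeEquivSubtypeInter
    (fun I => IsFace (normal L C) (bound L C v) I ∧ codim (normal L C) I = k)
    fun I => Equivalent L C (y I) v').symm

end CountCells

end Toric

end

/-! ### The dimension formula -/

theorem proposition6p5 {𝕜 : Type*} [Field 𝕜]
    {V : Type*} [NormedAddCommGroup V] [NormedSpace ℝ V] [FiniteDimensional ℝ V]
    (L : Submodule ℤ V) [DiscreteTopology L] [IsZLattice ℝ L]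
    (C : PointedCone ℝ V) (hC : Toric.IsToricCone L C)
    {ι : Type} [Finite ι] (w : ι → V) (hw : Toric.IsComplete 𝕜 L C w)
    (Δ Δ' : Set V) (hΔ : Toric.IsChamber L C Δ) (hΔ' : Toric.IsChamber L C Δ')
    (v : V) (hv : v ∈ Δ) (v' : V) (hv' : v' ∈ Δ') (i : ℕ) :
    (Toric.cellsOfType 𝕜 L C Δ v' i).Finite ∧
    Module.rank 𝕜 (CategoryTheory.Abelian.Ext (Toric.simpleModule 𝕜 L C w v)
        (Toric.simpleModule 𝕜 L C w v') i) =
      ((Toric.cellsOfType 𝕜 L C Δ v' i).ncard : Cardinal) := by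
  have := hC.finite_primitiveNormals.fintype
  have := Fintype.ofFinite ι
  obtain ⟨y, hy⟩ := hC.exists_isCellPoint v
  obtain ⟨ε, hε⟩ := Toric.exists_isIncidence (Toric.normal L C) (Toric.bound L C v)
  refine ⟨?_, ?_⟩
  · rw [hy.cellsOfType_eq hC hΔ hv]
    exact (Set.toFinite _).image _
  · obtain ⟨E⟩ := Toric.nonempty_ext_simpleModule hC hy hε hw v' i
    rw [E.rank_eq, Toric.rank_hom_simpleModule hC hw, hy.ncard_cellsOfType hC hΔ hv]
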